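/- Let $\Bbbk$ be a field and let $\mathcal{V}$ be a $\Bbbk$-linear braided tensor category consisting of vector spaces and linear maps; that is, $\mathcal{V}$ is an abelian $\Bbbk$-linear braided monoidal category with countable direct sums and a faithful exact $\Bbbk$-linear monoidal functor to $\Bbbk$-vector spaces (sending each object to its underlying space) that preserves countable direct sums, as for comodules over a coquasitriangular bialgebra or Yetter–Drinfeld modules over a Hopf algebra with bijective antipode. For an object $V$ of $\mathcal{V}$ let $T(V)=\bigoplus_{n\ge 0}V^{\otimes n}$ be the tensor bialgebra, in which the elements of $V$ are primitive. Let $R\subseteq\bigoplus_{n\ge 2}V^{\otimes n}$ be a graded subobject in $\mathcal{V}$ such that the two-sided ideal $\langle R\rangle$ is a biideal of $T(V)$, and let $\mathcal{B}=T(V)/\langle R\rangle$, a graded bialgebra in $\mathcal{V}$ with multiplication $m$, comultiplication $\Delta$ and counit $\varepsilon$. Put $\mathcal{B}^+=\ker\varepsilon$ and let $(\mathcal{B}^+)^2$ be the image of the multiplication $\mathcal{B}^+\otimes_{\mathcal{B}}\mathcal{B}^+\to\mathcal{B}^+$. Assume that the epimorphism $\mathcal{B}^+\otimes_{\mathcal{B}}\mathcal{B}^+\to(\mathcal{B}^+)^2$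 splits in $\mathcal{V}$. Write $P(\mathcal{B})=\{x\in\mathcal{B}:\Delta(x)=x\otimes 1+1\otimes x\}$, and for graded objects $X,Y$ of $\mathcal{V}$ write $\operatorname{Hom}(X,Y)_\ell$ for the space of morphisms of $\mathcal{V}$ that are homogeneous of degree $\ell\in\mathbb{Z}$. For $\ell\in\mathbb Z$ let $\widehat H^2_b(\mathcal{B})_\ell$ be the cohomology, at the middle term, of the complex $$\operatorname{Hom}(\mathcal{B},\mathcal{B})_\ell\to\operatorname{Hom}(\mathcal{B}^{\otimes 2},\mathcal{B})_\ell\oplus\operatorname{Hom}(\mathcal{B},\mathcal{B}^{\otimes 2})_\ell\to\operatorname{Hom}(\mathcal{B}^{\otimes 3},\mathcal{B})_\ell\oplus\operatorname{Hom}(\mathcal{B}^{\otimes 2},\mathcal{B}^{\otimes 2})_\ell\oplus\operatorname{Hom}(\mathcal{B},\mathcal{B}^{\otimes 3})_\ell,$$ where $h\mapsto(\partial^h h,-\partial^c h)$ and $(f,g)\mapsto(\partial^h f,\ \partial^c f+\partial^h g,\ -\partial^c g)$, with \begin{align*} (\partial^h h)(a,b)&=a\,h(b)-h(ab)+h(a)\,b,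 & (\partial^c h)(a)&=a_{(1)}\otimes h(a_{(2)})-\Delta h(a)+h(a_{(1)})\otimes a_{(2)},\\ (\partial^h f)(a,b,c)&=a f(b,c)-f(ab,c)+f(a,bc)-f(a,b)c, & \partial^c f&=(m\otimes f)\Delta_{\mathcal{B}\otimes\mathcal{B}}-\Delta f+(f\otimes m)\Delta_{\mathcal{B}\otimes\mathcal{B}},\\ (\partial^h g)(a,b)&=\Delta(a)g(b)-g(ab)+g(a)\Delta(b), & (\partial^c g)(a)&=a_{(1)}\otimes g(a_{(2)})-(\Delta\otimes\operatorname{id})g(a)+(\operatorname{id}\otimes\Delta)g(a)-g(a_{(1)})\otimes a_{(2)}; \end{align*} here the coproduct $\Delta_{\mathcal{B}\otimes\mathcal{B}}$ and the products in $\mathcal{B}\otimes\mathcal{B}$ are those twisted by the braiding. A graded deformation of $\mathcal{B}$ is the structure of a graded bialgebra over $\Bbbk[t]$ (with $\deg t=1$) on $\mathcal{B}[t]=\mathcal{B}\otimes\Bbbk[t]$ whose structure morphisms have the form $\sum_{i\ge 0}f_i t^i$, with $f_i$ a morphism of $\mathcal{V}$ that is homogeneous of degree $-i$, and whose multiplication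 and comultiplication are $m$ and $\Delta$ at $t=0$. Two graded deformations are equivalent if they are isomorphic as graded bialgebras over $\Bbbk[t]$, by isomorphisms of the same form, and $\mathcal{B}$ is rigid if every graded deformation of $\mathcal{B}$ is equivalent to the trivial one. (1) If $\ell<0$ and $\operatorname{Hom}(R,P(\mathcal{B}))_\ell=0$, then $\widehat H^2_b(\mathcal{B})_\ell=0$. (2) If $\operatorname{Hom}(R,P(\mathcal{B}))_\ell=0$ for all $\ell<0$, then $\mathcal{B}$ is rigid. -/

import Mathlib

open CategoryTheory MonoidalCategory Limits

universe u v₁ u₁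

set_option linter.unusedSectionVars false

namespace BraidedRigidity

open MonObj ComonObj

noncomputable section

/-! ### The tensor bialgebra -/

section Primitive

variable {C : Type u₁} [Category.{v₁} C] [MonoidalCategory C] [Preadditive C]

/-- The morphism `x ↦ x ⊗ 1 + 1 ⊗ x`. -/
def primitiveMap (A : C) [MonObj A] : A ⟶ A ⊗ A :=
  (ρ_ A).inv ≫ A ◁ η[A] + (λ_ A).inv ≫ η[A] ▷ A

end Primitive

section TensorAlgebra

variable {C : Type u₁} [Category.{v₁} C] [MonoidalCategory C]

/-- The tensor powers `V^{⊗n}`. -/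
@[reducible] def tpow (V : C) : ℕ → C
  | 0 => 𝟙_ C
  | n + 1 => V ⊗ tpow V n

variable [HasColimitsOfShape (Discrete ℕ) C]

/-- The object `T(V) = ⨁ₙ V^{⊗n}`. -/
def tensorObject (V : C) : C := ∐ tpow V

/-- The inclusion `V^{⊗n} → T(V)`. -/
def incl (V : C) (n : ℕ) : tpow V n ⟶ tensorObject V := Sigma.ι (tpow V) n

/-- `T(V)` is the coproduct of the tensor powers. -/
def inclIsColimit (V : C) : IsColimit (Cofan.mk (tensorObject V) (incl V)) :=
  coproductIsCoproduct (tpow V)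

section
variable {D : Type*} [Category D] (G : C ⥤ D) [PreservesColimitsOfShape (Discrete ℕ) G]

/-- A functor preserving countable coproducts sends `T(V)` to the coproduct of the images. -/
def mapIsColimit (V : C) :
    IsColimit (Cofan.mk (G.obj (tensorObject V)) fun n => G.map (incl V n)) :=
  isColimitCofanMkObjOfIsColimit G _ _ (inclIsColimit V)

theorem map_ext (V : C) {Y : D} {f g : G.obj (tensorObject V) ⟶ Y}
    (h : ∀ n, G.map (incl V n) ≫ f = G.map (incl V n) ≫ g) : f = g :=
  Cofan.IsColimit.hom_ext (mapIsColimit G V) _ _ h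

end

variable [∀ X : C, PreservesColimitsOfShape (Discrete ℕ) (tensorLeft X)]
  [∀ X : C, PreservesColimitsOfShape (Discrete ℕ) (tensorRight X)]

/-- Left multiplication `V ⊗ T(V) → T(V)` by elements of degree one, the sum of the maps
`V ⊗ V^{⊗n} = V^{⊗(n+1)}`. -/
def cons (V : C) : V ⊗ tensorObject V ⟶ tensorObject V :=
  Cofan.IsColimit.desc (mapIsColimit (tensorLeft V) V) fun n => incl V (n + 1)

theorem incl_cons (V : C) (n : ℕ) : V ◁ incl V n ≫ cons V = incl V (n + 1) :=
  Cofan.IsColimit.fac (mapIsColimit (tensorLeft V) V) _ n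

theorem incl_cons_assoc (V : C) (n : ℕ) {Z : C} (h : tensorObject V ⟶ Z) :
    V ◁ incl V n ≫ cons V ≫ h = incl V (n + 1) ≫ h := by
  rw [← Category.assoc, incl_cons]

/-- The product `V^{⊗n} ⊗ T(V) → T(V)`. -/
def mulPow (V : C) : ∀ n, tpow V n ⊗ tensorObject V ⟶ tensorObject V
  | 0 => (λ_ (tensorObject V)).hom
  | n + 1 => (α_ V (tpow V n) (tensorObject V)).hom ≫ V ◁ mulPow V n ≫ cons V

/-- The product of `T(V)`, i.e. concatenation of tensors. -/
def tensorMul (V : C) : tensorObject V ⊗ tensorObject V ⟶ tensorObject V :=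
  Cofan.IsColimit.desc (mapIsColimit (tensorRight (tensorObject V)) V) (mulPow V)

theorem incl_mul (V : C) (n : ℕ) : incl V n ▷ tensorObject V ≫ tensorMul V = mulPow V n :=
  Cofan.IsColimit.fac (mapIsColimit (tensorRight (tensorObject V)) V) _ n

theorem incl_mul_assoc (V : C) (n : ℕ) {Z : C} (h : tensorObject V ⟶ Z) :
    incl V n ▷ tensorObject V ≫ tensorMul V ≫ h = mulPow V n ≫ h := by
  rw [← Category.assoc, incl_mul]

theorem ext_right {V X Y : C} {f g : tensorObject V ⊗ X ⟶ Y}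
    (h : ∀ n, incl V n ▷ X ≫ f = incl V n ▷ X ≫ g) : f = g :=
  map_ext (tensorRight X) V h

theorem ext_left {V X Y : C} {f g : X ⊗ tensorObject V ⟶ Y}
    (h : ∀ n, X ◁ incl V n ≫ f = X ◁ incl V n ≫ g) : f = g :=
  map_ext (tensorLeft X) V h

theorem ext_left_right {V X Y Z : C} {f g : (X ⊗ tensorObject V) ⊗ Y ⟶ Z}
    (h : ∀ n, (X ◁ incl V n) ▷ Y ≫ f = (X ◁ incl V n) ▷ Y ≫ g) : f = g :=
  map_ext (tensorLeft X ⋙ tensorRight Y) V h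

theorem ext_right_right {V X Y Z : C} {f g : (tensorObject V ⊗ X) ⊗ Y ⟶ Z}
    (h : ∀ n, (incl V n ▷ X) ▷ Y ≫ f = (incl V n ▷ X) ▷ Y ≫ g) : f = g :=
  map_ext (tensorRight X ⋙ tensorRight Y) V h

theorem cons_mul (V : C) : cons V ▷ tensorObject V ≫ tensorMul V =
    (α_ _ _ _).hom ≫ V ◁ tensorMul V ≫ cons V := by
  refine ext_left_right fun n => ?_
  rw [← comp_whiskerRight_assoc, incl_cons, incl_mul, associator_naturality_middle_assoc,
    ← whiskerLeft_comp_assoc, incl_mul]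
  rfl

/-- The unit of `T(V)`: the inclusion of `V^{⊗0} = 𝟙`. -/
def tensorOne (V : C) : 𝟙_ C ⟶ tensorObject V := incl V 0

theorem tensorOne_mul (V : C) : tensorOne V ▷ tensorObject V ≫ tensorMul V = (λ_ _).hom :=
  incl_mul V 0

theorem mulPow_one_succ {V P : C} {i : P ⟶ tensorObject V}
    {m : P ⊗ tensorObject V ⟶ tensorObject V} (h : P ◁ tensorOne V ≫ m = (ρ_ P).hom ≫ i) :
    (V ⊗ P) ◁ tensorOne V ≫ (α_ V P (tensorObject V)).hom ≫ V ◁ m ≫ cons V =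
      (ρ_ (V ⊗ P)).hom ≫ V ◁ i ≫ cons V := by
  rw [tensor_whiskerLeft_assoc, Iso.inv_hom_id_assoc, ← whiskerLeft_comp_assoc, h]
  simp

theorem mulPow_one (V : C) : ∀ n,
    tpow V n ◁ tensorOne V ≫ mulPow V n = (ρ_ (tpow V n)).hom ≫ incl V n
  | 0 => by
    have : 𝟙_ C ◁ tensorOne V ≫ (λ_ (tensorObject V)).hom = (ρ_ (𝟙_ C)).hom ≫ tensorOne V := by
      rw [leftUnitor_naturality, unitors_equal]
    exact this
  | n + 1 => by
    rw [← incl_cons]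
    exact mulPow_one_succ (mulPow_one V n)

theorem mulPow_mul_succ {V P : C} {m : P ⊗ tensorObject V ⟶ tensorObject V}
    (h : m ▷ tensorObject V ≫ tensorMul V = (α_ _ _ _).hom ≫ P ◁ tensorMul V ≫ m) :
    ((α_ V P (tensorObject V)).hom ≫ V ◁ m ≫ cons V) ▷ tensorObject V ≫ tensorMul V =
      (α_ _ _ _).hom ≫ (V ⊗ P) ◁ tensorMul V ≫
        (α_ V P (tensorObject V)).hom ≫ V ◁ m ≫ cons V := by
  rw [comp_whiskerRight_assoc, comp_whiskerRight_assoc, cons_mul,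
    associator_naturality_middle_assoc, ← whiskerLeft_comp_assoc V (m ▷ _), h]
  simp

theorem mulPow_mul (V : C) : ∀ n, mulPow V n ▷ tensorObject V ≫ tensorMul V =
    (α_ _ _ _).hom ≫ tpow V n ◁ tensorMul V ≫ mulPow V n
  | 0 => by
    have : (λ_ (tensorObject V)).hom ▷ tensorObject V ≫ tensorMul V =
        (α_ _ _ _).hom ≫ 𝟙_ C ◁ tensorMul V ≫ (λ_ (tensorObject V)).hom := by simp
    exact this
  | n + 1 => mulPow_mul_succ (mulPow_mul V n)

instance tensorMonObj (V : C) : MonObj (tensorObject V) where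
  one := tensorOne V
  mul := tensorMul V
  one_mul := tensorOne_mul V
  mul_one := ext_right fun n => by
    rw [← whisker_exchange_assoc, incl_mul, mulPow_one, rightUnitor_naturality]
  mul_assoc := ext_right_right fun n => by
    rw [← comp_whiskerRight_assoc, incl_mul, mulPow_mul, associator_naturality_left_assoc,
      ← whisker_exchange_assoc, incl_mul]

/-- The inclusion of the generators `V → T(V)`. -/
def gen (V : C) : V ⟶ tensorObject V := (ρ_ V).inv ≫ incl V 1

theorem gen_mul (V : C) : gen V ▷ tensorObject V ≫ μ = cons V := by
  have h : incl V 1 ▷ tensorObject V ≫ tensorMul V =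
      (α_ V (𝟙_ C) (tensorObject V)).hom ≫ V ◁ (λ_ (tensorObject V)).hom ≫ cons V :=
    incl_mul V 1
  have h2 : gen V ▷ tensorObject V ≫ tensorMul V = (ρ_ V).inv ▷ tensorObject V ≫
      incl V 1 ▷ tensorObject V ≫ tensorMul V := by
    rw [gen]; exact comp_whiskerRight_assoc _ _ _ _
  refine h2.trans ?_
  rw [h]
  simp

/-- Extension of a morphism from `V` to a monoid on the tensor powers of `V`. -/
def liftPow {V A : C} [MonObj A] (f : V ⟶ A) : ∀ n, tpow V n ⟶ A
  | 0 => η[A]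
  | n + 1 => (f ⊗ₘ liftPow f n) ≫ μ[A]

/-- The monoid morphism `T(V) → A` that extends a morphism `V → A`. -/
def lift {V A : C} [MonObj A] (f : V ⟶ A) : tensorObject V ⟶ A :=
  Cofan.IsColimit.desc (inclIsColimit V) (liftPow f)

theorem incl_lift {V A : C} [MonObj A] (f : V ⟶ A) (n : ℕ) :
    incl V n ≫ lift f = liftPow f n :=
  Cofan.IsColimit.fac (inclIsColimit V) _ n

theorem cons_lift {V A : C} [MonObj A] (f : V ⟶ A) :
    cons V ≫ lift f = (f ⊗ₘ lift f) ≫ μ := by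
  refine ext_left fun n => ?_
  rw [incl_cons_assoc, incl_lift, liftPow, tensorHom_def', tensorHom_def']
  simp only [Category.assoc]
  rw [← whiskerLeft_comp_assoc, incl_lift]

theorem liftPow_mul_succ {V P A : C} [MonObj A] (f : V ⟶ A) {l : P ⟶ A}
    {m : P ⊗ tensorObject V ⟶ tensorObject V} (h : m ≫ lift f = (l ⊗ₘ lift f) ≫ μ) :
    ((α_ V P (tensorObject V)).hom ≫ V ◁ m ≫ cons V) ≫ lift f =
      (((f ⊗ₘ l) ≫ μ) ⊗ₘ lift f) ≫ μ := by
  have e : V ◁ m ≫ (f ⊗ₘ lift f) = (f ⊗ₘ (l ⊗ₘ lift f)) ≫ A ◁ μ := by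
    rw [← id_tensorHom, ← id_tensorHom, tensorHom_comp_tensorHom, tensorHom_comp_tensorHom, h]
    simp
  have e2 : (((f ⊗ₘ l) ≫ μ) ⊗ₘ lift f) = ((f ⊗ₘ l) ⊗ₘ lift f) ≫ μ ▷ A := by
    rw [← tensorHom_id, tensorHom_comp_tensorHom, Category.comp_id]
  rw [e2]
  simp only [Category.assoc, cons_lift]
  rw [reassoc_of% e, MonObj.mul_assoc, associator_naturality_assoc]

instance lift_isMonHom {V A : C} [MonObj A] (f : V ⟶ A) : IsMonHom (lift f) where
  one_hom := incl_lift f 0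
  mul_hom := ext_right fun n => by
    have h : ∀ n, mulPow V n ≫ lift f = (liftPow f n ⊗ₘ lift f) ≫ μ := fun n => by
      induction n with
      | zero => exact (one_mul_hom _).symm
      | succ n ih => exact liftPow_mul_succ f ih
    have h' : incl V n ▷ tensorObject V ≫ tensorMul V ≫ lift f = (liftPow f n ⊗ₘ lift f) ≫ μ := by
      rw [incl_mul_assoc, h]
    refine h'.trans ?_
    rw [← tensorHom_id, tensorHom_comp_tensorHom_assoc, incl_lift, Category.id_comp]

theorem gen_lift {V A : C} [MonObj A] (f : V ⟶ A) : gen V ≫ lift f = f := by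
  rw [gen, Category.assoc, incl_lift, liftPow, liftPow, mul_one_hom, Iso.inv_hom_id_assoc]

theorem mon_hom_ext {V A : C} [MonObj A] {f g : tensorObject V ⟶ A} [IsMonHom f] [IsMonHom g]
    (h : gen V ≫ f = gen V ≫ g) : f = g := by
  refine Cofan.IsColimit.hom_ext (inclIsColimit V) _ _ fun n => ?_
  change incl V n ≫ f = incl V n ≫ g
  induction n with
  | zero => exact (IsMonHom.one_hom f).trans (IsMonHom.one_hom g).symm
  | succ n ih =>
    have key : ∀ (φ : tensorObject V ⟶ A) [IsMonHom φ],
        incl V (n + 1) ≫ φ = ((gen V ≫ φ) ⊗ₘ (incl V n ≫ φ)) ≫ μ := fun φ _ => by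
      rw [← incl_cons, ← gen_mul]
      simp only [Category.assoc, IsMonHom.mul_hom]
      rw [← Category.assoc, ← Category.assoc, ← tensorHom_def', tensorHom_comp_tensorHom]
    rw [key f, key g, h, ih]

section Bialgebra

variable [BraidedCategory C] [Preadditive C] [MonoidalPreadditive C]

/-- The comultiplication of `T(V)`: the morphism of monoids to the braided tensor product
`T(V) ⊗ T(V)` for which the elements of `V` are primitive. -/
def tensorComul (V : C) : tensorObject V ⟶ tensorObject V ⊗ tensorObject V :=
  lift (gen V ≫ primitiveMap (tensorObject V))

/-- The counit of `T(V)`: the morphism of monoids to the unit object that vanishes on `V`. -/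
def tensorCounit (V : C) : tensorObject V ⟶ 𝟙_ C := lift 0

instance (V : C) : IsMonHom (tensorComul V) := lift_isMonHom _
instance (V : C) : IsMonHom (tensorCounit V) := lift_isMonHom _

theorem gen_comul (V : C) : gen V ≫ tensorComul V = gen V ≫ primitiveMap (tensorObject V) :=
  gen_lift _

theorem gen_comul_assoc (V : C) {Z : C} (h : tensorObject V ⊗ tensorObject V ⟶ Z) :
    gen V ≫ tensorComul V ≫ h = gen V ≫ primitiveMap (tensorObject V) ≫ h := by
  rw [← Category.assoc, gen_comul, Category.assoc]

theorem gen_counit (V : C) : gen V ≫ tensorCounit V = 0 := gen_lift _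

theorem one_counit' (V : C) : η[tensorObject V] ≫ tensorCounit V = 𝟙 _ :=
  IsMonHom.one_hom (tensorCounit V)

theorem one_comul' (V : C) : η[tensorObject V] ≫ tensorComul V =
    (λ_ _).inv ≫ (η[tensorObject V] ⊗ₘ η[tensorObject V]) :=
  IsMonHom.one_hom (tensorComul V)

instance tensorBimonObj (V : C) : BimonObj (tensorObject V) where
  counit := tensorCounit V
  comul := tensorComul V
  counit_comul := by
    have : tensorComul V ≫ tensorCounit V ▷ tensorObject V ≫ (λ_ _).hom = 𝟙 (tensorObject V) := by
      refine mon_hom_ext ?_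
      rw [gen_comul_assoc, primitiveMap]
      simp only [Preadditive.add_comp, Preadditive.comp_add, Category.assoc]
      rw [whisker_exchange_assoc, ← comp_whiskerRight_assoc, one_counit',
        rightUnitor_inv_naturality_assoc, ← comp_whiskerRight_assoc, gen_counit]
      simp
    rw [← cancel_mono (λ_ _).hom]
    simpa using this
  comul_counit := by
    have : tensorComul V ≫ tensorObject V ◁ tensorCounit V ≫ (ρ_ _).hom = 𝟙 (tensorObject V) := by
      refine mon_hom_ext ?_
      rw [gen_comul_assoc, primitiveMap]
      simp only [Preadditive.add_comp, Preadditive.comp_add, Category.assoc]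
      rw [← whisker_exchange_assoc, ← whiskerLeft_comp_assoc, one_counit',
        leftUnitor_inv_naturality_assoc, ← whiskerLeft_comp_assoc, gen_counit]
      simp
    rw [← cancel_mono (ρ_ _).hom]
    simpa using this
  comul_assoc := by
    refine mon_hom_ext ?_
    have e₁ : gen V ≫ (λ_ _).inv ≫ η[tensorObject V] ▷ tensorObject V ≫
        tensorObject V ◁ tensorComul V =
        gen V ≫ primitiveMap (tensorObject V) ≫ (λ_ _).inv ≫ η[tensorObject V] ▷ _ := by
      rw [← whisker_exchange, ← leftUnitor_inv_naturality_assoc, gen_comul_assoc]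
    have e₂ : gen V ≫ (ρ_ _).inv ≫ tensorObject V ◁ η[tensorObject V] ≫
        tensorComul V ▷ tensorObject V =
        gen V ≫ primitiveMap (tensorObject V) ≫ (ρ_ _).inv ≫ _ ◁ η[tensorObject V] := by
      rw [whisker_exchange, ← rightUnitor_inv_naturality_assoc, gen_comul_assoc]
    rw [gen_comul_assoc, gen_comul_assoc]
    rw [primitiveMap] at e₁ e₂ ⊢
    simp only [Preadditive.add_comp, Preadditive.comp_add, Category.assoc] at e₁ e₂ ⊢
    rw [e₁, reassoc_of% e₂, ← whiskerLeft_comp, one_comul', ← comp_whiskerRight_assoc, one_comul']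
    have f₁ : (λ_ (𝟙_ C)).inv ≫ (η[tensorObject V] ⊗ₘ η[tensorObject V]) =
        η ≫ (ρ_ _).inv ≫ _ ◁ η[tensorObject V] := by
      rw [MonoidalCategory.tensorHom_def, unitors_inv_equal, rightUnitor_inv_naturality_assoc]
    have f₂ : (λ_ (𝟙_ C)).inv ≫ (η[tensorObject V] ⊗ₘ η[tensorObject V]) =
        η ≫ (λ_ _).inv ≫ η[tensorObject V] ▷ _ := by
      rw [tensorHom_def', leftUnitor_inv_naturality_assoc]
    nth_rw 1 [f₁]
    rw [f₂]
    simp only [Preadditive.add_comp, Category.assoc]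
    rw [add_assoc]
    congr 1
    · simp only [whiskerLeft_comp, Category.assoc, rightUnitor_tensor_inv,
        associator_naturality_right, Iso.inv_hom_id_assoc]
    · congr 1
      · simp only [Category.assoc, rightUnitor_tensor_inv, associator_naturality_right,
          Iso.inv_hom_id_assoc]
        rw [← whiskerLeft_comp, ← whisker_exchange, ← leftUnitor_inv_naturality_assoc,
          Category.assoc]
      · simp only [comp_whiskerRight, Category.assoc, leftUnitor_tensor_inv,
          associator_naturality_left]
  mul_comul := IsMonHom.mul_hom (tensorComul V)
  one_comul := IsMonHom.one_hom (tensorComul V)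
  mul_counit := IsMonHom.mul_hom (tensorCounit V)
  one_counit := IsMonHom.one_hom (tensorCounit V)

end Bialgebra

end TensorAlgebra

/-! ### The tensor bialgebra in a category of vector spaces -/

section FiberFunctor

variable {k : Type u} [Field k] {C : Type u₁} [Category.{v₁} C] [Abelian C] [MonoidalCategory C]
  [MonoidalPreadditive C] [BraidedCategory C] [HasColimitsOfShape (Discrete ℕ) C]

theorem preserves_tensorLeft (F : C ⥤ ModuleCat.{u} k) [F.Monoidal] [F.Faithful]
    [PreservesColimitsOfShape (Discrete ℕ) F] (X : C) :
    PreservesColimitsOfShape (Discrete ℕ) (tensorLeft X) := by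
  have : ReflectsColimitsOfShape (Discrete ℕ) F := reflectsColimitsOfShape_of_reflectsIsomorphisms
  have : PreservesColimitsOfShape (Discrete ℕ) (tensorLeft X ⋙ F) :=
    preservesColimitsOfShape_of_natIso (F := F ⋙ tensorLeft (F.obj X))
      (Functor.Monoidal.commTensorLeft F X)
  exact preservesColimitsOfShape_of_reflects_of_preserves _ F

theorem preserves_tensorRight (F : C ⥤ ModuleCat.{u} k) [F.Monoidal] [F.Faithful]
    [PreservesColimitsOfShape (Discrete ℕ) F] (X : C) :
    PreservesColimitsOfShape (Discrete ℕ) (tensorRight X) := by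
  have := preserves_tensorLeft F X
  exact preservesColimitsOfShape_of_natIso (BraidedCategory.tensorLeftIsoTensorRight X)

/-- The tensor bialgebra `T(V)`. The functor `F`, which sends an object to its underlying vector
space, enters only through the fact that `⊗` distributes over countable direct sums. -/
def tensorBialgebra (_F : C ⥤ ModuleCat.{u} k) (V : C) : C := tensorObject V

instance (F : C ⥤ ModuleCat.{u} k) [F.Monoidal] [F.Faithful]
    [PreservesColimitsOfShape (Discrete ℕ) F] (V : C) : BimonObj (tensorBialgebra F V) :=
  haveI := preserves_tensorLeft F
  haveI := preserves_tensorRight F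
  tensorBimonObj V

end FiberFunctor

/-! ### Gradings and homogeneous morphisms -/

section Grading

variable {C : Type u₁} [Category.{v₁} C] [Preadditive C]

/-- A grading of `X` over the non-negative integers: a decomposition `X = ⨁ₙ Xₙ` in the
category. -/
structure Grading (X : C) where
  /-- The component `Xₙ`. -/
  piece : ℕ → C
  /-- The inclusion `Xₙ → X`. -/
  inj : ∀ n, piece n ⟶ X
  /-- `X` is the direct sum of the components. -/
  isColimit : IsColimit (Cofan.mk X inj)

/-- The projection of `X` onto its component of degree `n`, as an endomorphism of `X`. -/
def Grading.proj {X : C} (g : Grading X) (n : ℕ) : X ⟶ X :=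
  Cofan.IsColimit.desc g.isColimit fun m => if m = n then g.inj m else 0

/-- The grading of `T(V)` by the tensor powers of `V`. -/
def tensorGrading [MonoidalCategory C] [HasColimitsOfShape (Discrete ℕ) C]
    {k : Type u} [Field k] (F : C ⥤ ModuleCat.{u} k) (V : C) : Grading (tensorBialgebra F V) where
  piece := tpow V
  inj := incl V
  isColimit := inclIsColimit V

/-- The projections of `X ⊗ Y` onto its components `⨁_{i + j = n} Xᵢ ⊗ Yⱼ`, where `p` and `q` are
the projections of `X` and `Y`. -/
def tensorProj [MonoidalCategory C] {X Y : C} (p : ℕ → (X ⟶ X)) (q : ℕ → (Y ⟶ Y)) (n : ℕ) :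
    X ⊗ Y ⟶ X ⊗ Y :=
  ∑ ij ∈ Finset.HasAntidiagonal.antidiagonal n, (p ij.1 ⊗ₘ q ij.2)

/-- The projections of the unit object, which is of degree zero. -/
def unitProj (C : Type u₁) [Category.{v₁} C] [Preadditive C] [MonoidalCategory C] (n : ℕ) :
    𝟙_ C ⟶ 𝟙_ C :=
  if n = 0 then 𝟙 _ else 0

/-- The space `Hom(X, Y)_ℓ` of homogeneous morphisms of degree `ℓ`: those that map the component
`Xₘ` into `Y_{m + ℓ}` for all `m`, i.e. whose components `Xₘ → Yₙ` vanish for `n ≠ m + ℓ`.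
Here `p` and `q` are the projections of `X` and `Y` onto their components. -/
def homDeg (k : Type u) [Field k] [Linear k C] {X Y : C} (p : ℕ → (X ⟶ X)) (q : ℕ → (Y ⟶ Y))
    (ℓ : ℤ) : Submodule k (X ⟶ Y) where
  carrier := {f | ∀ m n : ℕ, (n : ℤ) ≠ m + ℓ → p m ≫ f ≫ q n = 0}
  zero_mem' := by simp
  add_mem' hf hg m n h := by
    rw [Preadditive.add_comp, Preadditive.comp_add, hf m n h, hg m n h, add_zero]
  smul_mem' c f hf m n h := by
    rw [Linear.smul_comp, Linear.comp_smul, hf m n h, smul_zero]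

end Grading

/-! ### Ideals, biideals and primitive elements -/

section Ideals

variable {C : Type u₁} [Category.{v₁} C] [Abelian C] [MonoidalCategory C]

/-- The two-sided ideal `⟨R⟩ = A R A` generated by a subobject `R` of an algebra `A`. -/
def generatedIdeal {A : C} [MonObj A] (R : Subobject A) : Subobject A :=
  imageSubobject ((A ◁ R.arrow) ▷ A ≫ μ[A] ▷ A ≫ μ[A])

/-- A biideal: a two-sided ideal `I` with `Δ(I) ⊆ I ⊗ A + A ⊗ I` and `ε(I) = 0`. -/
structure IsBiideal [BraidedCategory C] {A : C} [BimonObj A] (I : Subobject A) : Prop where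
  mul_right : I.Factors (I.arrow ▷ A ≫ μ[A])
  mul_left : I.Factors (A ◁ I.arrow ≫ μ[A])
  comul : (imageSubobject (I.arrow ▷ A) ⊔ imageSubobject (A ◁ I.arrow)).Factors (I.arrow ≫ Δ[A])
  counit : I.arrow ≫ ε[A] = 0

/-- The subobject `P(A)` of primitive elements. -/
def primitives [BraidedCategory C] (A : C) [BimonObj A] : Subobject A :=
  kernelSubobject (Δ[A] - primitiveMap A)

/-- The space `Hom(R, P(A))_ℓ` of morphisms from a graded object `R` to `P(A) ⊆ A` that are
homogeneous of degree `ℓ`. -/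
def homPrimitivesDeg (k : Type u) [Field k] [Linear k C] [BraidedCategory C] {R A : C} [BimonObj A]
    (gR : Grading R) (gA : Grading A) (ℓ : ℤ) : Submodule k (R ⟶ (primitives A : C)) :=
  (homDeg k gR.proj gA.proj ℓ).comap (Linear.rightComp k R (primitives A).arrow)

end Ideals

/-! ### The tensor square of the augmentation ideal over the algebra -/

section Augmentation

variable {C : Type u₁} [Category.{v₁} C] [Abelian C] [MonoidalCategory C] [MonoidalPreadditive C]
  [BraidedCategory C] (B : C) [BimonObj B]

/-- The augmentation ideal `B⁺ = ker ε`. -/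
def augIdeal : C := kernel ε[B]

/-- The inclusion `B⁺ → B`. -/
def augIncl : augIdeal B ⟶ B := kernel.ι ε[B]

theorem augIncl_counit : augIncl B ≫ ε[B] = 0 := kernel.condition _

/-- The right action `B⁺ ⊗ B → B⁺`. -/
def augRightAct : augIdeal B ⊗ B ⟶ augIdeal B :=
  kernel.lift ε[B] (augIncl B ▷ B ≫ μ[B]) (by
    rw [Category.assoc, Bimon.mul_counit, ← tensorHom_id, tensorHom_comp_tensorHom_assoc,
      augIncl_counit]
    simp)

/-- The left action `B ⊗ B⁺ → B⁺`. -/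
def augLeftAct : B ⊗ augIdeal B ⟶ augIdeal B :=
  kernel.lift ε[B] (B ◁ augIncl B ≫ μ[B]) (by
    rw [Category.assoc, Bimon.mul_counit, ← id_tensorHom, tensorHom_comp_tensorHom_assoc,
      augIncl_counit]
    simp)

/-- The morphism `a ⊗ b ⊗ c ↦ ab ⊗ c - a ⊗ bc` from `B⁺ ⊗ B ⊗ B⁺` to `B⁺ ⊗ B⁺`. -/
def augBalancing : (augIdeal B ⊗ B) ⊗ augIdeal B ⟶ augIdeal B ⊗ augIdeal B :=
  augRightAct B ▷ augIdeal B - (α_ _ _ _).hom ≫ augIdeal B ◁ augLeftAct B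

/-- The tensor product `B⁺ ⊗_B B⁺`. -/
def augTensor : C := cokernel (augBalancing B)

/-- The morphism `B⁺ ⊗_B B⁺ → B` induced by the multiplication. -/
def augMul : augTensor B ⟶ B :=
  cokernel.desc (augBalancing B) ((augIncl B ⊗ₘ augIncl B) ≫ μ[B]) (by
    have h₁ : augRightAct B ≫ augIncl B = augIncl B ▷ B ≫ μ[B] := kernel.lift_ι _ _ _
    have h₂ : augLeftAct B ≫ augIncl B = B ◁ augIncl B ≫ μ[B] := kernel.lift_ι _ _ _
    rw [augBalancing, Preadditive.sub_comp, sub_eq_zero, ← tensorHom_id, Category.assoc,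
      ← id_tensorHom, tensorHom_comp_tensorHom_assoc, tensorHom_comp_tensorHom_assoc, h₁, h₂,
      Category.id_comp]
    have e₁ : ((augIncl B ▷ B ≫ μ[B]) ⊗ₘ augIncl B) =
        ((augIncl B ⊗ₘ 𝟙 B) ⊗ₘ augIncl B) ≫ μ[B] ▷ B := by
      rw [← tensorHom_id, ← tensorHom_id, tensorHom_comp_tensorHom, Category.comp_id]
    have e₂ : (augIncl B ⊗ₘ (B ◁ augIncl B ≫ μ[B])) =
        (augIncl B ⊗ₘ (𝟙 B ⊗ₘ augIncl B)) ≫ B ◁ μ[B] := by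
      rw [← id_tensorHom, ← id_tensorHom, tensorHom_comp_tensorHom, Category.comp_id]
    rw [e₁, e₂, Category.assoc, Category.assoc, MonObj.mul_assoc, associator_naturality_assoc])

/-- The multiplication `B⁺ ⊗_B B⁺ → (B⁺)²` onto its image `(B⁺)²` is a split epimorphism. -/
def AugMulSplits : Prop := IsSplitEpi (factorThruImage (augMul B))

end Augmentation

/-! ### Truncated bialgebra cohomology in degree two -/

section Cohomology

variable (k : Type u) [Field k] {C : Type u₁} [Category.{v₁} C] [Preadditive C] [Linear k C]
  [MonoidalCategory C] [MonoidalPreadditive C] [MonoidalLinear k C] [BraidedCategory C]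
  (B : C) [BimonObj B]

/-- The horizontal (Hochschild) differential `Hom(B, B) → Hom(B², B)`,
`(a, b) ↦ a h(b) - h(ab) + h(a) b`. -/
def dh₁₁ : (B ⟶ B) →ₗ[k] (B ⊗ B ⟶ B) where
  toFun h := B ◁ h ≫ μ[B] - μ[B] ≫ h + h ▷ B ≫ μ[B]
  map_add' _ _ := by simp; abel
  map_smul' _ _ := by simp [smul_sub]

/-- The vertical (Cartier) differential `Hom(B, B) → Hom(B, B²)`,
`c ↦ c₁ ⊗ h(c₂) - Δ(h(c)) + h(c₁) ⊗ c₂`. -/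
def dc₁₁ : (B ⟶ B) →ₗ[k] (B ⟶ B ⊗ B) where
  toFun h := Δ[B] ≫ B ◁ h - h ≫ Δ[B] + Δ[B] ≫ h ▷ B
  map_add' _ _ := by simp; abel
  map_smul' _ _ := by simp [smul_sub]

/-- The horizontal differential `Hom(B², B) → Hom(B³, B)`,
`(a, b, c) ↦ a f(b, c) - f(ab, c) + f(a, bc) - f(a, b) c`. -/
def dh₂₁ : (B ⊗ B ⟶ B) →ₗ[k] ((B ⊗ B) ⊗ B ⟶ B) where
  toFun f := (α_ B B B).hom ≫ B ◁ f ≫ μ[B] - μ[B] ▷ B ≫ f + (α_ B B B).hom ≫ B ◁ μ[B] ≫ f -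
    f ▷ B ≫ μ[B]
  map_add' _ _ := by simp; abel
  map_smul' _ _ := by simp [smul_sub]

/-- The vertical differential `Hom(B², B) → Hom(B², B²)`,
`(m ⊗ f) Δ(a ⊗ b) - Δ(f(a, b)) + (f ⊗ m) Δ(a ⊗ b)`, where `Δ(a ⊗ b)` is the coproduct of the
braided tensor square `B ⊗ B`. -/
def dc₂₁ : (B ⊗ B ⟶ B) →ₗ[k] (B ⊗ B ⟶ B ⊗ B) where
  toFun f := (Δ[B] ⊗ₘ Δ[B]) ≫ tensorμ B B B B ≫ (μ[B] ⊗ₘ f) - f ≫ Δ[B] +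
    (Δ[B] ⊗ₘ Δ[B]) ≫ tensorμ B B B B ≫ (f ⊗ₘ μ[B])
  map_add' _ _ := by simp [MonoidalPreadditive.tensor_add, MonoidalPreadditive.add_tensor]; abel
  map_smul' _ _ := by simp [smul_sub, MonoidalCategory.tensorHom_def]

/-- The horizontal differential `Hom(B, B²) → Hom(B², B²)`,
`(a, b) ↦ Δ(a) g(b) - g(ab) + g(a) Δ(b)`, with the product of the braided tensor square
`B ⊗ B`. -/
def dh₁₂ : (B ⟶ B ⊗ B) →ₗ[k] (B ⊗ B ⟶ B ⊗ B) where
  toFun g := (Δ[B] ⊗ₘ g) ≫ tensorμ B B B B ≫ (μ[B] ⊗ₘ μ[B]) - μ[B] ≫ g +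
    (g ⊗ₘ Δ[B]) ≫ tensorμ B B B B ≫ (μ[B] ⊗ₘ μ[B])
  map_add' _ _ := by simp [MonoidalPreadditive.tensor_add, MonoidalPreadditive.add_tensor]; abel
  map_smul' _ _ := by simp [smul_sub, MonoidalCategory.tensorHom_def]

/-- The vertical differential `Hom(B, B²) → Hom(B, B³)`,
`c ↦ c₁ ⊗ g(c₂) - (Δ ⊗ id) g(c) + (id ⊗ Δ) g(c) - g(c₁) ⊗ c₂`. -/
def dc₁₂ : (B ⟶ B ⊗ B) →ₗ[k] (B ⟶ B ⊗ (B ⊗ B)) where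
  toFun g := Δ[B] ≫ B ◁ g - g ≫ Δ[B] ▷ B ≫ (α_ B B B).hom + g ≫ B ◁ Δ[B] -
    Δ[B] ≫ g ▷ B ≫ (α_ B B B).hom
  map_add' _ _ := by simp; abel
  map_smul' _ _ := by simp [smul_sub]

/-- The differential of the truncated total complex from `Hom(B, B)` to
`Hom(B², B) ⊕ Hom(B, B²)`; the vertical differential carries the sign `(-1)^p` on
`Hom(B^p, B^q)`. -/
def dTot₁ : (B ⟶ B) →ₗ[k] (B ⊗ B ⟶ B) × (B ⟶ B ⊗ B) :=
  (dh₁₁ k B).prod (-dc₁₁ k B)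

/-- The differential of the truncated total complex from `Hom(B², B) ⊕ Hom(B, B²)` to
`Hom(B³, B) ⊕ Hom(B², B²) ⊕ Hom(B, B³)`. -/
def dTot₂ : (B ⊗ B ⟶ B) × (B ⟶ B ⊗ B) →ₗ[k]
    ((B ⊗ B) ⊗ B ⟶ B) × (B ⊗ B ⟶ B ⊗ B) × (B ⟶ B ⊗ (B ⊗ B)) :=
  ((dh₂₁ k B).comp (.fst k _ _)).prod
    (((dc₂₁ k B).coprod (dh₁₂ k B)).prod (-(dc₁₂ k B).comp (.snd k _ _)))

variable {B}

/-- The two-cocycles `(f, g)` that are homogeneous of degree `ℓ`. -/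
def cocycles₂ (gB : Grading B) (ℓ : ℤ) : Submodule k ((B ⊗ B ⟶ B) × (B ⟶ B ⊗ B)) :=
  (homDeg k (tensorProj gB.proj gB.proj) gB.proj ℓ).prod
    (homDeg k gB.proj (tensorProj gB.proj gB.proj) ℓ) ⊓ LinearMap.ker (dTot₂ k B)

/-- The coboundaries of the morphisms `B → B` that are homogeneous of degree `ℓ`. -/
def coboundaries₂ (gB : Grading B) (ℓ : ℤ) : Submodule k ((B ⊗ B ⟶ B) × (B ⟶ B ⊗ B)) :=
  (homDeg k gB.proj gB.proj ℓ).map (dTot₁ k B)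

/-- The component of degree `ℓ` of the second truncated bialgebra cohomology of `B`. -/
abbrev truncatedH₂ (gB : Grading B) (ℓ : ℤ) : Type _ :=
  cocycles₂ k gB ℓ ⧸ (coboundaries₂ k gB ℓ).submoduleOf (cocycles₂ k gB ℓ)

end Cohomology

/-! ### Graded deformations

For graded objects `X` and `Y`, a morphism `X[t] → Y[t]` over `k[t]` that is homogeneous of degree
zero (where `t` has degree one) is determined by its restriction to `X`, which has the form
`∑ᵢ fᵢ tⁱ` with `fᵢ : X → Y` homogeneous of degree `-i`; conversely, any such sequence of morphisms
defines a morphism over `k[t]`, as the components of negative degree of `Y` are zero. -/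

section Deformations

variable {C : Type u₁} [Category.{v₁} C] [Preadditive C]

/-- Sequences of morphisms `fᵢ : X → Y`, thought of as `∑ᵢ fᵢ tⁱ`. -/
abbrev Series (X Y : C) : Type _ := ℕ → (X ⟶ Y)

namespace Series

/-- The extension of a morphism to a morphism over `k[t]`. -/
def const {X Y : C} (f : X ⟶ Y) : Series X Y := fun n => if n = 0 then f else 0

/-- The composition of morphisms over `k[t]` (first `f`, then `g`). -/
def comp {X Y Z : C} (f : Series X Y) (g : Series Y Z) : Series X Z :=
  fun n => ∑ ij ∈ Finset.HasAntidiagonal.antidiagonal n, f ij.1 ≫ g ij.2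

/-- The tensor product over `k[t]` of morphisms over `k[t]`. -/
def tensor [MonoidalCategory C] {X Y X' Y' : C} (f : Series X Y) (g : Series X' Y') :
    Series (X ⊗ X') (Y ⊗ Y') :=
  fun n => ∑ ij ∈ Finset.HasAntidiagonal.antidiagonal n, (f ij.1 ⊗ₘ g ij.2)

/-- A morphism over `k[t]` is graded if the coefficient of `tⁱ` is homogeneous of degree `-i`. -/
def IsGraded (k : Type u) [Field k] [Linear k C] {X Y : C} (p : ℕ → (X ⟶ X)) (q : ℕ → (Y ⟶ Y))
    (f : Series X Y) : Prop :=
  ∀ i : ℕ, f i ∈ homDeg k p q (-(i : ℤ))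

end Series

open Series

variable [MonoidalCategory C]

/-- The structure morphisms over `k[t]` of a bialgebra with underlying object `B[t]`. -/
structure DeformationData (B : C) where
  /-- The multiplication. -/
  mul : Series (B ⊗ B) B
  /-- The unit. -/
  one : Series (𝟙_ C) B
  /-- The comultiplication. -/
  comul : Series B (B ⊗ B)
  /-- The counit. -/
  counit : Series B (𝟙_ C)

/-- Equivalence of deformations: there is an isomorphism of graded bialgebras over `k[t]`. -/
def AreEquivalent (k : Type u) [Field k] [Linear k C] {B : C} (gB : Grading B) (D D' : DeformationData B) : Prop :=
  ∃ φ ψ : Series B B, φ.IsGraded k gB.proj gB.proj ∧ ψ.IsGraded k gB.proj gB.proj ∧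
    φ.comp ψ = const (𝟙 B) ∧ ψ.comp φ = const (𝟙 B) ∧
    D.mul.comp φ = (φ.tensor φ).comp D'.mul ∧ D.one.comp φ = D'.one ∧
    φ.comp D'.comul = D.comul.comp (φ.tensor φ) ∧ φ.comp D'.counit = D.counit

variable [BraidedCategory C] {B : C}

/-- The trivial deformation, with the structure morphisms of `B` extended to `B[t]`. -/
def DeformationData.trivial (B : C) [BimonObj B] : DeformationData B where
  mul := const μ[B]
  one := const η[B]
  comul := const Δ[B]
  counit := const ε[B]

/-- The structure morphisms make `B[t]` a bialgebra over `k[t]`. -/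
structure DeformationData.IsBialgebra (D : DeformationData B) : Prop where
  one_mul : (D.one.tensor (const (𝟙 B))).comp D.mul = const (λ_ B).hom
  mul_one : ((const (𝟙 B)).tensor D.one).comp D.mul = const (ρ_ B).hom
  mul_assoc : (D.mul.tensor (const (𝟙 B))).comp D.mul =
    (const (α_ B B B).hom).comp (((const (𝟙 B)).tensor D.mul).comp D.mul)
  counit_comul : D.comul.comp (D.counit.tensor (const (𝟙 B))) = const (λ_ B).inv
  comul_counit : D.comul.comp ((const (𝟙 B)).tensor D.counit) = const (ρ_ B).inv
  comul_assoc : D.comul.comp ((const (𝟙 B)).tensor D.comul) =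
    (D.comul.comp (D.comul.tensor (const (𝟙 B)))).comp (const (α_ B B B).hom)
  mul_comul : D.mul.comp D.comul =
    (D.comul.tensor D.comul).comp ((const (tensorμ B B B B)).comp (D.mul.tensor D.mul))
  one_comul : D.one.comp D.comul = (const (λ_ (𝟙_ C)).inv).comp (D.one.tensor D.one)
  mul_counit : D.mul.comp D.counit = (D.counit.tensor D.counit).comp (const (λ_ (𝟙_ C)).hom)
  one_counit : D.one.comp D.counit = const (𝟙 (𝟙_ C))

variable (k : Type u) [Field k] [Linear k C] [BimonObj B]

/-- A graded deformation of the graded bialgebra `B`: the structure of a graded bialgebra over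
`k[t]` on `B[t]` that specializes to the given structure at `t = 0`. -/
structure IsGradedDeformation (gB : Grading B) (D : DeformationData B) : Prop where
  isBialgebra : D.IsBialgebra
  mul_graded : D.mul.IsGraded k (tensorProj gB.proj gB.proj) gB.proj
  one_graded : D.one.IsGraded k (unitProj C) gB.proj
  comul_graded : D.comul.IsGraded k gB.proj (tensorProj gB.proj gB.proj)
  counit_graded : D.counit.IsGraded k gB.proj (unitProj C)
  mul_zero : D.mul 0 = μ[B]
  comul_zero : D.comul 0 = Δ[B]

/-- `B` is rigid: every graded deformation is equivalent to the trivial one. -/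
def IsRigid (gB : Grading B) : Prop :=
  ∀ D : DeformationData B, IsGradedDeformation k gB D →
    AreEquivalent k gB D (DeformationData.trivial B)

end Deformations

end

end BraidedRigidity

/-! A graded deformation of `B` is a bialgebra over power series in t with t of degree 1. A
two-cocycle (f, g) of degree ℓ < 0 is, once a counit is found, a bialgebra (μ + f t, Δ + g t) modulo
t² with t of degree -ℓ. Both are bialgebras on the object `⟨B⟩` of the braided category `TruncSeries
N C`, for N = ⊤ and N = 1. The common statement is `exists_trivialization`: let t have degree L ≥ 1
and let Hom(R, P(B)) vanish in the degrees -L i with 1 ≤ i ≤ N; then there is a graded bialgebra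
morphism ψ from the constant bialgebra B to the deformed one with ψ ≡ id modulo t.

To construct ψ, lift π : T(V) → B to the deformation. The generators go to s(v) = π(v) - ε_t(π(v)).
The coefficients of positive order of the defect δ = Δ_t s - s ⊗ 1 - 1 ⊗ s have degree at most 0 on
V, so they lie in B₀ ⊗ B₀, which is spanned by 1 ⊗ 1. Since ε_t ⊗ id kills δ, the element s(v) is
primitive (`generatorLift_comul`), and s extends to a bialgebra morphism Φ from T(V) to the
deformation (`lift_comul`, `lift_counit`).

It remains to see that Φ kills R (`lift_relation_eq_zero`), by induction on the degree n. For r in R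
of degree n, the element Δ(r) - r ⊗ 1 - 1 ⊗ r involves only degrees strictly between 0 and n, and
the biideal condition together with the induction hypothesis shows that Φ ⊗ Φ kills it
(`relation_comul_eq`). So Φ(r) is primitive in the deformation. Its lowest nonzero coefficient, at
tⁱ say, is then primitive in B for the undeformed structure and depends on r homogeneously in degree
-L i. Here i ≥ 1 because π(r) = 0, so this coefficient vanishes by hypothesis. Hence Φ factors
through π and gives ψ.

For N = ⊤ the series ψ is invertible and its inverse is the required equivalence. For N = 1 the
coefficient of t in the compatibility of ψ with products and coproducts says that (f, g) is the
coboundary of -ψ₁. -/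

namespace BraidedRigidity

open MonObj ComonObj
open Finset.HasAntidiagonal (antidiagonal mem_antidiagonal)

noncomputable section

/-! ### Truncated power series with coefficients in a monoidal category -/

/-- A copy of `C`, whose morphisms are the power series `∑ fᵢ tⁱ` modulo `t ^ (N + 1)` with
coefficients in the morphisms of `C`. -/
structure TruncSeries (N : ℕ∞) (C : Type u₁) : Type u₁ where
  /-- The underlying object. -/
  as : C

namespace TruncSeries

/-! ### Reindexing of convolution sums -/

section Sums

variable {M : Type*} [AddCommMonoid M]

/-- Both sides run over the triples with sum n; this gives associativity of the composition of
series. -/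
theorem sum_antidiagonal_assoc (n : ℕ) (f : ℕ → ℕ → ℕ → M) :
    ∑ p ∈ antidiagonal n, ∑ q ∈ antidiagonal p.1, f q.1 q.2 p.2 =
      ∑ p ∈ antidiagonal n, ∑ q ∈ antidiagonal p.2, f p.1 q.1 q.2 := by
  rw [Finset.sum_sigma', Finset.sum_sigma']
  refine Finset.sum_nbij' (fun x => ⟨(x.2.1, x.2.2 + x.1.2), (x.2.2, x.1.2)⟩)
    (fun x => ⟨(x.1.1 + x.2.1, x.2.2), (x.1.1, x.2.1)⟩) ?_ ?_ ?_ ?_ ?_ <;>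
  · simp only [Finset.mem_sigma, mem_antidiagonal]
    rintro ⟨⟨a, b⟩, ⟨c, d⟩⟩ ⟨h, h'⟩
    dsimp only at h h' ⊢
    all_goals first | rfl | (subst h'; first | rfl | exact ⟨by omega, trivial⟩)

theorem sum_antidiagonal_swap (n : ℕ) (f : ℕ → ℕ → M) :
    ∑ p ∈ antidiagonal n, f p.1 p.2 = ∑ p ∈ antidiagonal n, f p.2 p.1 :=
  (Finset.Nat.sum_antidiagonal_swap (f := fun p => f p.1 p.2)).symm

theorem sum_antidiagonal_eq_left (n : ℕ) (f : ℕ → ℕ → M) (h : ∀ i j, i ≠ 0 → f i j = 0) :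
    ∑ p ∈ antidiagonal n, f p.1 p.2 = f 0 n := by
  refine Finset.sum_eq_single_of_mem (0, n) (by simp) ?_
  rintro ⟨i, j⟩ hij hne
  refine h i j fun hi => hne ?_
  simp only [mem_antidiagonal] at hij
  ext <;> simp_all

theorem sum_antidiagonal_eq_right (n : ℕ) (f : ℕ → ℕ → M) (h : ∀ i j, j ≠ 0 → f i j = 0) :
    ∑ p ∈ antidiagonal n, f p.1 p.2 = f n 0 := by
  rw [sum_antidiagonal_swap]
  exact sum_antidiagonal_eq_left n (fun i j => f j i) fun i j => h j i

end Sums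

variable {N : ℕ∞} {C : Type u₁} [Category.{v₁} C] [Preadditive C]

/-- The power series modulo `t ^ (N + 1)` with coefficients in `A`. -/
def coeffs (N : ℕ∞) (A : Type*) [AddCommGroup A] : AddSubgroup (ℕ → A) where
  carrier := {f | ∀ n : ℕ, ¬ (n : ℕ∞) ≤ N → f n = 0}
  zero_mem' _ _ := rfl
  add_mem' hf hg n h := by simp [hf n h, hg n h]
  neg_mem' hf n h := by simp [hf n h]

instance : Quiver (TruncSeries N C) where
  Hom X Y := coeffs N (X.as ⟶ Y.as)

/-- The coefficient of `tⁿ`. -/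
def coeff {X Y : TruncSeries N C} (f : X ⟶ Y) (n : ℕ) : X.as ⟶ Y.as := f.1 n

/-- The morphism with given coefficients. -/
def ofCoeffs {X Y : TruncSeries N C} (f : ℕ → (X.as ⟶ Y.as))
    (hf : ∀ n : ℕ, ¬ (n : ℕ∞) ≤ N → f n = 0) : X ⟶ Y :=
  ⟨f, hf⟩

@[simp] theorem coeff_ofCoeffs {X Y : TruncSeries N C} (f : ℕ → (X.as ⟶ Y.as))
    (hf : ∀ n : ℕ, ¬ (n : ℕ∞) ≤ N → f n = 0) (n : ℕ) : coeff (ofCoeffs f hf) n = f n := rfl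

theorem coeff_eq_zero {X Y : TruncSeries N C} (f : X ⟶ Y) {n : ℕ} (h : ¬ (n : ℕ∞) ≤ N) :
    coeff f n = 0 := f.2 n h

theorem hom_ext {X Y : TruncSeries N C} {f g : X ⟶ Y}
    (h : ∀ n : ℕ, (n : ℕ∞) ≤ N → coeff f n = coeff g n) : f = g := by
  refine Subtype.ext (funext fun n => ?_)
  by_cases hn : (n : ℕ∞) ≤ N
  · exact h n hn
  · exact (coeff_eq_zero f hn).trans (coeff_eq_zero g hn).symm

theorem le_of_le {m n : ℕ} (h : (n : ℕ∞) ≤ N) (hm : m ≤ n) : (m : ℕ∞) ≤ N :=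
  le_trans (by exact_mod_cast hm) h

theorem fst_le {n : ℕ} (h : (n : ℕ∞) ≤ N) {p : ℕ × ℕ} (hp : p ∈ antidiagonal n) :
    (p.1 : ℕ∞) ≤ N :=
  le_of_le h (by rw [mem_antidiagonal] at hp; omega)

theorem snd_le {n : ℕ} (h : (n : ℕ∞) ≤ N) {p : ℕ × ℕ} (hp : p ∈ antidiagonal n) :
    (p.2 : ℕ∞) ≤ N :=
  le_of_le h (by rw [mem_antidiagonal] at hp; omega)

theorem zero_le' (N : ℕ∞) : ((0 : ℕ) : ℕ∞) ≤ N := by simp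

open Classical in
instance : CategoryStruct (TruncSeries N C) where
  id X := ofCoeffs (fun n => if n = 0 then 𝟙 X.as else 0) fun n h =>
    if_neg (by rintro rfl; exact h (zero_le' N))
  -- The Cauchy product can have nonzero coefficients beyond order N, so it is cut off explicitly.
  comp f g := ofCoeffs (fun n => if (n : ℕ∞) ≤ N then
    ∑ p ∈ antidiagonal n, coeff f p.1 ≫ coeff g p.2 else 0) fun _ h => if_neg h

@[simp] theorem coeff_id (X : TruncSeries N C) (n : ℕ) :
    coeff (𝟙 X) n = if n = 0 then 𝟙 X.as else 0 := rfl

theorem coeff_comp {X Y Z : TruncSeries N C} (f : X ⟶ Y) (g : Y ⟶ Z) {n : ℕ}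
    (h : (n : ℕ∞) ≤ N) :
    coeff (f ≫ g) n = ∑ p ∈ antidiagonal n, coeff f p.1 ≫ coeff g p.2 := if_pos h

@[simp] theorem coeff_comp_zero {X Y Z : TruncSeries N C} (f : X ⟶ Y) (g : Y ⟶ Z) :
    coeff (f ≫ g) 0 = coeff f 0 ≫ coeff g 0 := by
  rw [coeff_comp f g (zero_le' N)]; simp

instance : Category (TruncSeries N C) where
  id_comp f := hom_ext fun n hn => by
    rw [coeff_comp _ _ hn, sum_antidiagonal_eq_left n fun i j => coeff (𝟙 _) i ≫ coeff f j]
    · simp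
    · intro i j hi; simp [hi]
  comp_id f := hom_ext fun n hn => by
    rw [coeff_comp _ _ hn, sum_antidiagonal_eq_right n fun i j => coeff f i ≫ coeff (𝟙 _) j]
    · simp
    · intro i j hi; simp [hi]
  assoc f g h := hom_ext fun n hn => by
    rw [coeff_comp _ _ hn, coeff_comp _ _ hn]
    have h₁ := sum_antidiagonal_assoc n fun i j l => (coeff f i ≫ coeff g j) ≫ coeff h l
    refine Eq.trans ?_ (h₁.trans ?_)
    · refine Finset.sum_congr rfl fun p hp => ?_
      rw [coeff_comp _ _ (fst_le hn hp), Preadditive.sum_comp]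
    · refine Finset.sum_congr rfl fun p hp => ?_
      rw [coeff_comp _ _ (snd_le hn hp), Preadditive.comp_sum]
      exact Finset.sum_congr rfl fun q _ => Category.assoc _ _ _

instance (X Y : TruncSeries N C) : AddCommGroup (X ⟶ Y) :=
  inferInstanceAs (AddCommGroup (coeffs N (X.as ⟶ Y.as)))

@[simp] theorem coeff_add {X Y : TruncSeries N C} (f g : X ⟶ Y) (n : ℕ) :
    coeff (f + g) n = coeff f n + coeff g n := rfl

@[simp] theorem coeff_zero {X Y : TruncSeries N C} (n : ℕ) : coeff (0 : X ⟶ Y) n = 0 := rfl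

@[simp] theorem coeff_sub {X Y : TruncSeries N C} (f g : X ⟶ Y) (n : ℕ) :
    coeff (f - g) n = coeff f n - coeff g n := rfl

instance : Preadditive (TruncSeries N C) where
  add_comp _ _ _ f f' g := hom_ext fun n hn => by
    simp only [coeff_comp _ _ hn, coeff_add, Preadditive.add_comp, Finset.sum_add_distrib]
  comp_add _ _ _ f g g' := hom_ext fun n hn => by
    simp only [coeff_comp _ _ hn, coeff_add, Preadditive.comp_add, Finset.sum_add_distrib]

variable (N) in
/-- The morphisms of `C` as constant series. -/
def const {X Y : C} (f : X ⟶ Y) : (⟨X⟩ : TruncSeries N C) ⟶ ⟨Y⟩ :=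
  ofCoeffs (fun n => if n = 0 then f else 0) fun n h => if_neg (by rintro rfl; exact h (zero_le' N))

theorem coeff_const {X Y : C} (f : X ⟶ Y) (n : ℕ) :
    coeff (const N f) n = if n = 0 then f else 0 := rfl

@[simp] theorem coeff_const_zero {X Y : C} (f : X ⟶ Y) :
    coeff (const N f) 0 = f := rfl

theorem coeff_const_of_ne {X Y : C} (f : X ⟶ Y) {n : ℕ} (h : n ≠ 0) :
    coeff (const N f) n = 0 := if_neg h

-- Beyond order N both sides vanish, so no bound on n is needed; the same holds for
-- `coeff_comp_const`.
@[simp] theorem coeff_const_comp {X Y : C} (f : X ⟶ Y) {Z : TruncSeries N C}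
    (g : (⟨Y⟩ : TruncSeries N C) ⟶ Z) (n : ℕ) : coeff (const N f ≫ g) n = f ≫ coeff g n := by
  by_cases hn : (n : ℕ∞) ≤ N
  · rw [coeff_comp _ _ hn,
      sum_antidiagonal_eq_left n fun i j => coeff (const N f) i ≫ coeff g j]
    · rfl
    · intro i j hi; rw [coeff_const_of_ne _ hi, zero_comp]
  · rw [coeff_eq_zero _ hn, coeff_eq_zero _ hn, comp_zero]

@[simp] theorem coeff_comp_const {Y Z : C} {X : TruncSeries N C} (f : X ⟶ ⟨Y⟩)
    (g : Y ⟶ Z) (n : ℕ) : coeff (f ≫ const N g) n = coeff f n ≫ g := by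
  by_cases hn : (n : ℕ∞) ≤ N
  · rw [coeff_comp _ _ hn,
      sum_antidiagonal_eq_right n fun i j => coeff f i ≫ coeff (const N g) j]
    · rfl
    · intro i j hi; rw [coeff_const_of_ne _ hi, comp_zero]
  · rw [coeff_eq_zero _ hn, coeff_eq_zero _ hn, zero_comp]

@[simp] theorem const_id (X : C) : const N (𝟙 X) = 𝟙 _ := rfl

theorem const_comp {X Y Z : C} (f : X ⟶ Y) (g : Y ⟶ Z) :
    const N (f ≫ g) = const N f ≫ const N g := hom_ext fun n _ => by
  rw [coeff_const_comp, coeff_const, coeff_const]; split_ifs <;> simp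

theorem const_add {X Y : C} (f g : X ⟶ Y) : const N (f + g) = const N f + const N g :=
  hom_ext fun n _ => by
    simp only [coeff_add, coeff_const]; split_ifs <;> simp

@[simp] theorem const_zero {X Y : C} : const N (0 : X ⟶ Y) = 0 :=
  hom_ext fun n _ => by simp [coeff_const]

variable (N) in
/-- The isomorphisms of `C` as constant series. -/
def constIso {X Y : C} (e : X ≅ Y) : (⟨X⟩ : TruncSeries N C) ≅ ⟨Y⟩ where
  hom := const N e.hom
  inv := const N e.inv
  hom_inv_id := by rw [← const_comp, e.hom_inv_id, const_id]
  inv_hom_id := by rw [← const_comp, e.inv_hom_id, const_id]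

variable [MonoidalCategory C] [MonoidalPreadditive C]

instance : MonoidalCategoryStruct (TruncSeries N C) where
  tensorObj X Y := ⟨X.as ⊗ Y.as⟩
  whiskerLeft X _ _ f := ofCoeffs (fun n => X.as ◁ coeff f n) fun n h => by simp [coeff_eq_zero f h]
  whiskerRight f Y := ofCoeffs (fun n => coeff f n ▷ Y.as) fun n h => by simp [coeff_eq_zero f h]
  -- Taking the composite of whiskerings as definition makes `tensorHom_def` hold by `rfl`; the
  -- convolution formula is recovered in `coeff_tensorHom`.
  tensorHom {X₁ Y₁ X₂ Y₂} f g :=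
    (ofCoeffs (X := ⟨X₁.as ⊗ X₂.as⟩) (Y := ⟨Y₁.as ⊗ X₂.as⟩) (fun n => coeff f n ▷ X₂.as)
      fun n h => by simp [coeff_eq_zero f h]) ≫
    (ofCoeffs (X := ⟨Y₁.as ⊗ X₂.as⟩) (Y := ⟨Y₁.as ⊗ Y₂.as⟩) (fun n => Y₁.as ◁ coeff g n)
      fun n h => by simp [coeff_eq_zero g h])
  tensorUnit := ⟨𝟙_ C⟩
  associator X Y Z := constIso N (α_ X.as Y.as Z.as)
  leftUnitor X := constIso N (λ_ X.as)
  rightUnitor X := constIso N (ρ_ X.as)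

section

variable (X Y Z : TruncSeries N C)

@[simp] theorem coeff_whiskerLeft {Y Z : TruncSeries N C} (f : Y ⟶ Z) (n : ℕ) :
    coeff (X ◁ f) n = X.as ◁ coeff f n := rfl
@[simp] theorem coeff_whiskerRight {X Y : TruncSeries N C} (f : X ⟶ Y) (n : ℕ) :
    coeff (f ▷ Z) n = coeff f n ▷ Z.as := rfl

theorem tensorHom_eq {X₁ Y₁ X₂ Y₂ : TruncSeries N C} (f : X₁ ⟶ Y₁) (g : X₂ ⟶ Y₂) :
    f ⊗ₘ g = f ▷ X₂ ≫ Y₁ ◁ g := rfl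

theorem associator_hom : (α_ X Y Z).hom = const N (α_ X.as Y.as Z.as).hom := rfl
theorem leftUnitor_hom : (λ_ X).hom = const N (λ_ X.as).hom := rfl
theorem leftUnitor_inv : (λ_ X).inv = const N (λ_ X.as).inv := rfl

end

theorem const_whiskerLeft (X : C) {Y Z : C} (f : Y ⟶ Z) :
    const N (X ◁ f) = (⟨X⟩ : TruncSeries N C) ◁ const N f := hom_ext fun n _ => by
  rw [coeff_whiskerLeft, coeff_const, coeff_const]; split_ifs <;> simp

theorem const_whiskerRight {X Y : C} (f : X ⟶ Y) (Z : C) :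
    const N (f ▷ Z) = const N f ▷ (⟨Z⟩ : TruncSeries N C) := hom_ext fun n _ => by
  rw [coeff_whiskerRight, coeff_const, coeff_const]; split_ifs <;> simp

theorem const_tensorHom {X Y X' Y' : C} (f : X ⟶ Y) (g : X' ⟶ Y') :
    const N (f ⊗ₘ g) = const N f ⊗ₘ const N g := by
  rw [tensorHom_eq, MonoidalCategory.tensorHom_def, const_comp, const_whiskerLeft,
    const_whiskerRight]

theorem whiskerLeft_comp' (X : TruncSeries N C) {Y Z W : TruncSeries N C} (f : Y ⟶ Z)
    (g : Z ⟶ W) : X ◁ (f ≫ g) = X ◁ f ≫ X ◁ g := hom_ext fun n hn => by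
  rw [coeff_whiskerLeft, coeff_comp _ _ hn, coeff_comp _ _ hn, whiskerLeft_sum]
  exact Finset.sum_congr rfl fun p _ => MonoidalCategory.whiskerLeft_comp _ _ _

theorem comp_whiskerRight' {Y Z W : TruncSeries N C} (f : Y ⟶ Z) (g : Z ⟶ W)
    (X : TruncSeries N C) : (f ≫ g) ▷ X = f ▷ X ≫ g ▷ X := hom_ext fun n hn => by
  rw [coeff_whiskerRight, coeff_comp _ _ hn, coeff_comp _ _ hn, sum_whiskerRight]
  exact Finset.sum_congr rfl fun p _ => MonoidalCategory.comp_whiskerRight _ _ _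

theorem whisker_exchange' {W X Y Z : TruncSeries N C} (f : W ⟶ X) (g : Y ⟶ Z) :
    W ◁ g ≫ f ▷ Z = f ▷ Y ≫ X ◁ g := hom_ext fun n hn => by
  -- The two composites list the coefficients of `f` and `g` in opposite orders, so one convolution
  -- sum is reversed.
  rw [coeff_comp _ _ hn, coeff_comp _ _ hn,
    sum_antidiagonal_swap n fun i j => coeff (W ◁ g) i ≫ coeff (f ▷ Z) j]
  exact Finset.sum_congr rfl fun p _ => MonoidalCategory.whisker_exchange _ _

theorem associator_naturality_left' {X X' : TruncSeries N C} (f : X ⟶ X')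
    (Y Z : TruncSeries N C) :
    (f ▷ Y) ▷ Z ≫ (α_ X' Y Z).hom = (α_ X Y Z).hom ≫ f ▷ (Y ⊗ Z) := hom_ext fun n _ =>
  ((coeff_comp_const ((f ▷ Y) ▷ Z) (α_ _ _ _).hom n).trans
    (MonoidalCategory.associator_naturality_left _ _ _)).trans
    (coeff_const_comp (α_ _ _ _).hom (f ▷ (Y ⊗ Z)) n).symm

theorem associator_naturality_middle' (X : TruncSeries N C) {Y Y' : TruncSeries N C}
    (f : Y ⟶ Y') (Z : TruncSeries N C) :
    (X ◁ f) ▷ Z ≫ (α_ X Y' Z).hom = (α_ X Y Z).hom ≫ X ◁ f ▷ Z := hom_ext fun n _ =>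
  ((coeff_comp_const ((X ◁ f) ▷ Z) (α_ _ _ _).hom n).trans
    (MonoidalCategory.associator_naturality_middle _ _ _)).trans
    (coeff_const_comp (α_ _ _ _).hom (X ◁ f ▷ Z) n).symm

theorem associator_naturality_right' (X Y : TruncSeries N C) {Z Z' : TruncSeries N C}
    (f : Z ⟶ Z') :
    (X ⊗ Y) ◁ f ≫ (α_ X Y Z').hom = (α_ X Y Z).hom ≫ X ◁ Y ◁ f := hom_ext fun n _ =>
  ((coeff_comp_const ((X ⊗ Y) ◁ f) (α_ _ _ _).hom n).trans
    (MonoidalCategory.associator_naturality_right _ _ _)).trans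
    (coeff_const_comp (α_ _ _ _).hom (X ◁ Y ◁ f) n).symm

theorem const_congr_whiskerRight {X Y : C} {f : X ⟶ Y} (Z : TruncSeries N C) :
    const N f ▷ Z = const N (f ▷ Z.as) := (const_whiskerRight f Z.as).symm

theorem const_congr_whiskerLeft {X Y : C} {f : X ⟶ Y} (Z : TruncSeries N C) :
    Z ◁ const N f = const N (Z.as ◁ f) := (const_whiskerLeft Z.as f).symm

theorem const_eq {X Y : C} {f g : X ⟶ Y} (h : f = g) : const N f = const N g := by rw [h]

instance : MonoidalCategory (TruncSeries N C) where
  tensorHom_def _ _ := rfl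
  id_tensorHom_id X Y := by
    rw [tensorHom_eq, ← const_id, ← const_id, const_congr_whiskerRight, const_congr_whiskerLeft,
      ← const_comp]
    simp; rfl
  tensorHom_comp_tensorHom f₁ f₂ g₁ g₂ := by
    simp only [tensorHom_eq, whiskerLeft_comp', comp_whiskerRight', Category.assoc]
    congr 1
    rw [← Category.assoc, ← Category.assoc, whisker_exchange']
  whiskerLeft_id X Y := by
    rw [← const_id, const_congr_whiskerLeft]; simp; rfl
  id_whiskerRight X Y := by
    rw [← const_id, const_congr_whiskerRight]; simp; rfl
  associator_naturality {_ X₂ X₃ Y₁ _ _} f₁ f₂ f₃ := by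
    simp only [tensorHom_eq, whiskerLeft_comp', comp_whiskerRight', Category.assoc]
    rw [associator_naturality_right', reassoc_of% associator_naturality_middle' Y₁ f₂ X₃,
      reassoc_of% associator_naturality_left' f₁ X₂ X₃]
  leftUnitor_naturality {X Y} f := hom_ext fun n _ =>
    ((coeff_comp_const (𝟙_ _ ◁ f) (λ_ Y.as).hom n).trans
      (MonoidalCategory.leftUnitor_naturality _)).trans
      (coeff_const_comp (λ_ X.as).hom f n).symm
  rightUnitor_naturality {X Y} f := hom_ext fun n _ =>
    ((coeff_comp_const (f ▷ 𝟙_ _) (ρ_ Y.as).hom n).trans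
      (MonoidalCategory.rightUnitor_naturality _)).trans
      (coeff_const_comp (ρ_ X.as).hom f n).symm
  pentagon W X Y Z := by
    have h := const_eq (N := N) (MonoidalCategory.pentagon W.as X.as Y.as Z.as)
    rw [const_comp, const_comp, const_comp, const_whiskerLeft, const_whiskerRight] at h
    exact h
  triangle X Y := by
    have h := const_eq (N := N) (MonoidalCategory.triangle X.as Y.as)
    rw [const_comp, const_whiskerLeft, const_whiskerRight] at h
    exact h

theorem coeff_tensorHom {X X' Y Y' : TruncSeries N C} (f : X ⟶ Y) (g : X' ⟶ Y') {n : ℕ}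
    (hn : (n : ℕ∞) ≤ N) :
    coeff (f ⊗ₘ g) n = ∑ p ∈ antidiagonal n, (coeff f p.1 ⊗ₘ coeff g p.2) := by
  rw [tensorHom_eq, coeff_comp _ _ hn]
  exact Finset.sum_congr rfl fun p _ => (MonoidalCategory.tensorHom_def _ _).symm

@[simp] theorem coeff_tensorHom_zero {X X' Y Y' : TruncSeries N C} (f : X ⟶ Y) (g : X' ⟶ Y') :
    coeff (f ⊗ₘ g) 0 = coeff f 0 ⊗ₘ coeff g 0 := by
  rw [coeff_tensorHom _ _ (zero_le' N)]; simp

instance : MonoidalPreadditive (TruncSeries N C) where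
  whiskerLeft_zero := hom_ext fun n _ => by simp
  zero_whiskerRight := hom_ext fun n _ => by simp
  whiskerLeft_add f g := hom_ext fun n _ => by simp
  add_whiskerRight f g := hom_ext fun n _ => by simp

/-! ### The braiding on series and constant bialgebras -/

section Braided

variable [BraidedCategory C]

instance : BraidedCategory (TruncSeries N C) where
  braiding X Y := constIso N (β_ X.as Y.as)
  braiding_naturality_right X Y Z f := hom_ext fun n _ =>
    ((coeff_comp_const (X ◁ f) (β_ X.as Z.as).hom n).trans
      (BraidedCategory.braiding_naturality_right _ _)).trans
      (coeff_const_comp (β_ X.as Y.as).hom (f ▷ X) n).symm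
  braiding_naturality_left {X Y} f Z := hom_ext fun n _ =>
    ((coeff_comp_const (f ▷ Z) (β_ Y.as Z.as).hom n).trans
      (BraidedCategory.braiding_naturality_left _ _)).trans
      (coeff_const_comp (β_ X.as Z.as).hom (Z ◁ f) n).symm
  hexagon_forward X Y Z := by
    have h := const_eq (N := N) (BraidedCategory.hexagon_forward X.as Y.as Z.as)
    rw [const_comp, const_comp, const_comp, const_comp, const_whiskerLeft,
      const_whiskerRight] at h
    exact h
  hexagon_reverse X Y Z := by
    have h := const_eq (N := N) (BraidedCategory.hexagon_reverse X.as Y.as Z.as)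
    rw [const_comp, const_comp, const_comp, const_comp, const_whiskerLeft,
      const_whiskerRight] at h
    exact h

theorem tensorμ_eq (X₁ X₂ Y₁ Y₂ : TruncSeries N C) :
    tensorμ X₁ X₂ Y₁ Y₂ = const N (tensorμ X₁.as X₂.as Y₁.as Y₂.as) := by
  rw [tensorμ, tensorμ]
  simp only [const_comp, const_whiskerLeft, const_whiskerRight]
  rfl

/-- A bialgebra in `C` is a bialgebra over the truncated power series. -/
@[reducible] def constBimonObj (A : C) [BimonObj A] : BimonObj (⟨A⟩ : TruncSeries N C) where
  one := const N η[A]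
  mul := const N μ[A]
  counit := const N ε[A]
  comul := const N Δ[A]
  one_mul := by
    have h := const_eq (N := N) (MonObj.one_mul A)
    rw [const_comp, const_whiskerRight] at h
    exact h
  mul_one := by
    have h := const_eq (N := N) (MonObj.mul_one A)
    rw [const_comp, const_whiskerLeft] at h
    exact h
  mul_assoc := by
    have h := const_eq (N := N) (MonObj.mul_assoc A)
    rw [const_comp, const_comp, const_comp, const_whiskerLeft, const_whiskerRight] at h
    exact h
  counit_comul := by
    have h := const_eq (N := N) (ComonObj.counit_comul A)
    rw [const_comp, const_whiskerRight] at h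
    exact h
  comul_counit := by
    have h := const_eq (N := N) (ComonObj.comul_counit A)
    rw [const_comp, const_whiskerLeft] at h
    exact h
  comul_assoc := by
    have h := const_eq (N := N) (ComonObj.comul_assoc A)
    rw [const_comp, const_comp, const_comp, const_whiskerLeft, const_whiskerRight] at h
    exact h
  mul_comul := by
    have h := const_eq (N := N) (BimonObj.mul_comul A)
    rw [const_comp, const_comp, const_comp, const_tensorHom, const_tensorHom] at h
    rw [tensorμ_eq]
    exact h
  one_comul := by
    have h := const_eq (N := N) (BimonObj.one_comul A)
    rw [MonObj.tensorObj.one_def, const_comp, const_comp, const_tensorHom] at h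
    exact h
  mul_counit := by
    have h := const_eq (N := N) (BimonObj.mul_counit A)
    rw [Comon.tensorObj_counit, const_comp, const_comp, const_tensorHom] at h
    exact h
  one_counit := by
    have h := const_eq (N := N) (BimonObj.one_counit A)
    rw [const_comp] at h
    exact h

end Braided

/-! ### Bialgebra maps from the tensor bialgebra to bialgebras over truncated power series -/

section Lift

variable {N : ℕ∞} {C : Type u₁} [Category.{v₁} C] [Preadditive C] [MonoidalCategory C]
  [MonoidalPreadditive C] [BraidedCategory C] [HasColimitsOfShape (Discrete ℕ) C]
  [∀ X : C, PreservesColimitsOfShape (Discrete ℕ) (tensorLeft X)]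
  [∀ X : C, PreservesColimitsOfShape (Discrete ℕ) (tensorRight X)]

instance (V : C) : BimonObj (⟨tensorObject V⟩ : TruncSeries N C) :=
  constBimonObj (tensorObject V)

theorem tensorObject_comul (V : C) :
    Δ[(⟨tensorObject V⟩ : TruncSeries N C)] = const N (tensorComul V) := rfl

variable {V : C} {X Y A : TruncSeries N C}

theorem coeff_whiskerRight_const_comp {P Q : C} (i : P ⟶ Q)
    (f : (⟨Q⟩ : TruncSeries N C) ⊗ X ⟶ Y) (n : ℕ) :
    coeff (const N i ▷ X ≫ f) n = i ▷ X.as ≫ coeff f n := by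
  rw [const_congr_whiskerRight]
  exact coeff_const_comp _ _ _

theorem coeff_whiskerLeft_const_comp {P Q : C} (i : P ⟶ Q)
    (f : X ⊗ (⟨Q⟩ : TruncSeries N C) ⟶ Y) (n : ℕ) :
    coeff (X ◁ const N i ≫ f) n = X.as ◁ i ≫ coeff f n := by
  rw [const_congr_whiskerLeft]
  exact coeff_const_comp _ _ _

/-- The universal property of T(V) persists for series because it can be applied to each coefficient
separately. No colimits in the category of series are needed. -/
theorem tensorObject_hom_ext {f g : (⟨tensorObject V⟩ : TruncSeries N C) ⟶ Y}
    (h : ∀ n, const N (incl V n) ≫ f = const N (incl V n) ≫ g) : f = g :=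
  hom_ext fun i _ => Cofan.IsColimit.hom_ext (inclIsColimit V) _ _ fun n => by
    have := congrArg (fun φ => coeff φ i) (h n)
    simp only [coeff_const_comp] at this
    exact this

theorem tensorObject_ext_right {f g : (⟨tensorObject V⟩ : TruncSeries N C) ⊗ X ⟶ Y}
    (h : ∀ n, const N (incl V n) ▷ X ≫ f = const N (incl V n) ▷ X ≫ g) : f = g :=
  hom_ext fun i _ => ext_right fun n => by
    have := congrArg (fun φ => coeff φ i) (h n)
    simpa only [coeff_whiskerRight_const_comp] using this

theorem tensorObject_ext_left {f g : X ⊗ (⟨tensorObject V⟩ : TruncSeries N C) ⟶ Y}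
    (h : ∀ n, X ◁ const N (incl V n) ≫ f = X ◁ const N (incl V n) ≫ g) : f = g :=
  hom_ext fun i _ => ext_left fun n => by
    have := congrArg (fun φ => coeff φ i) (h n)
    simpa only [coeff_whiskerLeft_const_comp] using this

/-- Extension of a morphism from `V` to a monoid on the tensor powers of `V`. -/
def liftPow [MonObj A] (s : ⟨V⟩ ⟶ A) : ∀ n, (⟨tpow V n⟩ : TruncSeries N C) ⟶ A
  | 0 => η[A]
  | n + 1 => (s ⊗ₘ liftPow s n) ≫ μ[A]

/-- The monoid morphism `T(V) → A` that extends a morphism `V → A`. -/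
def lift [MonObj A] (s : ⟨V⟩ ⟶ A) : (⟨tensorObject V⟩ : TruncSeries N C) ⟶ A :=
  ofCoeffs (fun i => Cofan.IsColimit.desc (inclIsColimit V) fun n => coeff (liftPow s n) i)
    fun i hi => Cofan.IsColimit.hom_ext (inclIsColimit V) _ _ fun n => by
      rw [Cofan.IsColimit.fac, coeff_eq_zero _ hi, comp_zero]

theorem incl_coeff_lift [MonObj A] (s : ⟨V⟩ ⟶ A) (n i : ℕ) :
    incl V n ≫ coeff (lift s) i = coeff (liftPow s n) i :=
  Cofan.IsColimit.fac (inclIsColimit V) _ n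

theorem const_incl_lift [MonObj A] (s : ⟨V⟩ ⟶ A) (n : ℕ) :
    const N (incl V n) ≫ lift s = liftPow s n :=
  hom_ext fun i _ => by rw [coeff_const_comp, incl_coeff_lift]

theorem const_incl_cons (V : C) (n : ℕ) :
    (⟨V⟩ : TruncSeries N C) ◁ const N (incl V n) ≫ const N (cons V) =
      const N (incl V (n + 1)) := by
  rw [← const_whiskerLeft]
  exact (const_comp _ _).symm.trans (const_eq (incl_cons V n))

theorem const_incl_mul (V : C) (n : ℕ) :
    const N (incl V n) ▷ ⟨tensorObject V⟩ ≫ μ[(⟨tensorObject V⟩ : TruncSeries N C)] =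
      const N (mulPow V n) := by
  rw [← const_whiskerRight]
  exact (const_comp _ _).symm.trans (const_eq (incl_mul V n))

theorem const_cons_lift [MonObj A] (s : ⟨V⟩ ⟶ A) :
    const N (cons V) ≫ lift s = ((s ⊗ₘ lift s) ≫ μ : ⟨V⟩ ⊗ ⟨tensorObject V⟩ ⟶ A) := by
  refine tensorObject_ext_left (X := ⟨V⟩) fun n => ?_
  rw [reassoc_of% const_incl_cons (N := N) V n, const_incl_lift, liftPow, tensorHom_def',
    tensorHom_def']
  simp only [Category.assoc]
  rw [← MonoidalCategory.whiskerLeft_comp_assoc, const_incl_lift]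

theorem liftPow_mul_succ {P : TruncSeries N C} [MonObj A] (s : ⟨V⟩ ⟶ A) {l : P ⟶ A}
    {m : P ⊗ ⟨tensorObject V⟩ ⟶ ⟨tensorObject V⟩} (h : m ≫ lift s = (l ⊗ₘ lift s) ≫ μ) :
    ((α_ ⟨V⟩ P ⟨tensorObject V⟩).hom ≫ (⟨V⟩ : TruncSeries N C) ◁ m ≫ const N (cons V)) ≫ lift s =
      (((s ⊗ₘ l) ≫ μ) ⊗ₘ lift s) ≫ μ := by
  have e : (⟨V⟩ : TruncSeries N C) ◁ m ≫ (s ⊗ₘ lift s) = (s ⊗ₘ (l ⊗ₘ lift s)) ≫ A ◁ μ := by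
    rw [← id_tensorHom, ← id_tensorHom, tensorHom_comp_tensorHom, tensorHom_comp_tensorHom, h]
    simp
  have e2 : (((s ⊗ₘ l) ≫ μ) ⊗ₘ lift s) = ((s ⊗ₘ l) ⊗ₘ lift s) ≫ μ ▷ A := by
    rw [← tensorHom_id, tensorHom_comp_tensorHom, Category.comp_id]
  rw [e2]
  simp only [Category.assoc, const_cons_lift]
  rw [reassoc_of% e, MonObj.mul_assoc, associator_naturality_assoc]

theorem const_mulPow_lift [MonObj A] (s : ⟨V⟩ ⟶ A) : ∀ n, const N (mulPow V n) ≫ lift s =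
    ((liftPow s n ⊗ₘ lift s) ≫ μ : ⟨tpow V n⟩ ⊗ ⟨tensorObject V⟩ ⟶ A)
  | 0 => (one_mul_hom _).symm
  | n + 1 => by
    refine Eq.trans ?_ (liftPow_mul_succ s (const_mulPow_lift s n))
    refine congrArg (· ≫ lift s) ?_
    refine (const_comp _ _).trans (congrArg₂ (· ≫ ·) rfl ((const_comp _ _).trans ?_))
    exact congrArg (· ≫ const N (cons V)) (const_whiskerLeft _ _)

instance lift_isMonHom [MonObj A] (s : ⟨V⟩ ⟶ A) : IsMonHom (lift s) where
  one_hom := const_incl_lift s 0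
  mul_hom := tensorObject_ext_right fun n => by
    rw [← Category.assoc, const_incl_mul, const_mulPow_lift, ← tensorHom_id,
      tensorHom_comp_tensorHom_assoc, const_incl_lift, Category.id_comp]

theorem const_gen_lift [MonObj A] (s : ⟨V⟩ ⟶ A) : const N (gen V) ≫ lift s = s := by
  rw [gen, const_comp, Category.assoc, const_incl_lift]
  refine (congrArg (const N (ρ_ V).inv ≫ ·) (mul_one_hom s)).trans ?_
  exact (Iso.inv_hom_id_assoc (ρ_ (⟨V⟩ : TruncSeries N C)) s)

/-- The component of degree n + 1 is the product of the generators with the component of degree n,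
so agreement on V propagates by induction. -/
theorem tensorObject_mon_hom_ext [MonObj A] {f g : (⟨tensorObject V⟩ : TruncSeries N C) ⟶ A}
    [IsMonHom f] [IsMonHom g] (h : const N (gen V) ≫ f = const N (gen V) ≫ g) : f = g := by
  refine tensorObject_hom_ext fun n => ?_
  induction n with
  | zero => exact (IsMonHom.one_hom f).trans (IsMonHom.one_hom g).symm
  | succ n ih =>
    have e : (const N (cons V) : ⟨V⟩ ⊗ ⟨tensorObject V⟩ ⟶ _) =
        const N (gen V) ▷ ⟨tensorObject V⟩ ≫ μ[(⟨tensorObject V⟩ : TruncSeries N C)] := by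
      rw [← const_whiskerRight]
      exact (const_eq (gen_mul V)).symm.trans (const_comp _ _)
    have key : ∀ (φ : (⟨tensorObject V⟩ : TruncSeries N C) ⟶ A) [IsMonHom φ],
        const N (incl V (n + 1)) ≫ φ =
          ((const N (gen V) ≫ φ) ⊗ₘ (const N (incl V n) ≫ φ)) ≫ μ := fun φ _ => by
      rw [← const_incl_cons, e]
      simp only [Category.assoc, IsMonHom.mul_hom]
      rw [← Category.assoc, ← Category.assoc, ← tensorHom_def', tensorHom_comp_tensorHom]
    rw [key f, key g, h, ih]

theorem const_gen_comul (V : C) :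
    const N (gen V) ≫ Δ[(⟨tensorObject V⟩ : TruncSeries N C)] =
      const N (gen V) ≫ primitiveMap (⟨tensorObject V⟩ : TruncSeries N C) := by
  have h := const_eq (N := N) (gen_comul V)
  rw [const_comp, const_comp, primitiveMap, const_add, const_comp, const_comp, const_whiskerLeft,
    const_whiskerRight] at h
  exact h

theorem const_gen_counit (V : C) :
    const N (gen V) ≫ ε[(⟨tensorObject V⟩ : TruncSeries N C)] = 0 :=
  (const_comp _ _).symm.trans ((const_eq (gen_counit V)).trans const_zero)

end Lift

/-! ### Primitive elements and structure morphisms of bialgebras -/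

section Monoidal

variable {D : Type u₁} [Category.{v₁} D] [Preadditive D] [MonoidalCategory D]
  [MonoidalPreadditive D] [BraidedCategory D]

/-- Only compatibility with the units is needed, so this applies also to projections such as ηε. -/
theorem primitiveMap_tensorHom {A B : D} [MonObj A] [MonObj B] (f : A ⟶ B) (hf : η ≫ f = η) :
    primitiveMap A ≫ (f ⊗ₘ f) = f ≫ primitiveMap B := by
  simp only [primitiveMap, Preadditive.add_comp, Preadditive.comp_add, Category.assoc]
  congr 1
  · rw [MonoidalCategory.tensorHom_def', ← MonoidalCategory.whiskerLeft_comp_assoc,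
      hf, whisker_exchange, rightUnitor_inv_naturality_assoc]
  · rw [MonoidalCategory.tensorHom_def, ← comp_whiskerRight_assoc,
      hf, ← whisker_exchange, leftUnitor_inv_naturality_assoc]

instance comul_isMonHom (A : D) [BimonObj A] : IsMonHom Δ[A] where
  one_hom := BimonObj.one_comul A
  mul_hom := by
    rw [BimonObj.mul_comul]; rfl

instance counit_isMonHom (A : D) [BimonObj A] : IsMonHom ε[A] where
  one_hom := BimonObj.one_counit A
  mul_hom := BimonObj.mul_counit A

end Monoidal

/-! ### Compatibility of the lift with comultiplication and counit -/

section LiftComul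

variable {N : ℕ∞} {C : Type u₁} [Category.{v₁} C] [Preadditive C] [MonoidalCategory C]
  [MonoidalPreadditive C] [BraidedCategory C] [HasColimitsOfShape (Discrete ℕ) C]
  [∀ X : C, PreservesColimitsOfShape (Discrete ℕ) (tensorLeft X)]
  [∀ X : C, PreservesColimitsOfShape (Discrete ℕ) (tensorRight X)]
  {V : C} {A : TruncSeries N C} [BimonObj A]

/-- Both sides are algebra morphisms to the braided tensor square of A, so it suffices to compare
them on V, where s has primitive values. -/
theorem lift_comul {s : ⟨V⟩ ⟶ A} (hs : s ≫ Δ[A] = s ≫ primitiveMap A) :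
    lift s ≫ Δ[A] = Δ[(⟨tensorObject V⟩ : TruncSeries N C)] ≫ (lift s ⊗ₘ lift s) := by
  refine tensorObject_mon_hom_ext ?_
  rw [reassoc_of% const_gen_lift s, reassoc_of% const_gen_comul (N := N) V,
    primitiveMap_tensorHom _ (IsMonHom.one_hom _), reassoc_of% const_gen_lift s, hs]

theorem lift_counit {s : ⟨V⟩ ⟶ A} (hs : s ≫ ε[A] = 0) :
    lift s ≫ ε[A] = ε[(⟨tensorObject V⟩ : TruncSeries N C)] := by
  refine tensorObject_mon_hom_ext ?_
  rw [reassoc_of% const_gen_lift s, hs, const_gen_counit]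

end LiftComul

end TruncSeries

/-! ### The grading of the tensor bialgebra -/

section TensorDegree

variable {C : Type u₁} [Category.{v₁} C] [Preadditive C]

theorem Grading.inj_proj {X : C} (g : Grading X) (m n : ℕ) :
    g.inj m ≫ g.proj n = if m = n then g.inj m else 0 :=
  Cofan.IsColimit.fac g.isColimit _ m

theorem Grading.hom_ext {X Y : C} (g : Grading X) {f f' : X ⟶ Y}
    (h : ∀ n, g.inj n ≫ f = g.inj n ≫ f') : f = f' :=
  Cofan.IsColimit.hom_ext g.isColimit _ _ h

variable [MonoidalCategory C] [MonoidalPreadditive C] [BraidedCategory C]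
  [HasColimitsOfShape (Discrete ℕ) C]

/-- The projection of `T(V)` onto `V^{⊗n}`, as an endomorphism of `T(V)`. -/
def tproj (V : C) (n : ℕ) : tensorObject V ⟶ tensorObject V :=
  Cofan.IsColimit.desc (inclIsColimit V) fun m => if m = n then incl V m else 0

theorem incl_tproj (V : C) (m n : ℕ) : incl V m ≫ tproj V n = if m = n then incl V m else 0 :=
  Cofan.IsColimit.fac (inclIsColimit V) _ m

theorem tensorObject_hom_ext {V Y : C} {f g : tensorObject V ⟶ Y}
    (h : ∀ n, incl V n ≫ f = incl V n ≫ g) : f = g :=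
  Cofan.IsColimit.hom_ext (inclIsColimit V) _ _ h

variable [∀ X : C, PreservesColimitsOfShape (Discrete ℕ) (tensorLeft X)]
  [∀ X : C, PreservesColimitsOfShape (Discrete ℕ) (tensorRight X)]

theorem gen_incl_mul (V : C) (n : ℕ) : (gen V ⊗ₘ incl V n) ≫ tensorMul V = incl V (n + 1) := by
  rw [tensorHom_def', Category.assoc]
  exact (congrArg (V ◁ incl V n ≫ ·) (gen_mul V)).trans (incl_cons V n)

/-- The degree-zero component is the unit object, and the counit vanishes on every other component.
-/
theorem tproj_zero (V : C) : tproj V 0 = tensorCounit V ≫ tensorOne V := by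
  refine tensorObject_hom_ext fun n => ?_
  rw [incl_tproj]
  cases n with
  | zero =>
    rw [if_pos rfl]
    exact (Category.id_comp _).symm.trans ((congrArg (· ≫ tensorOne V)
      (one_counit' V).symm).trans (Category.assoc _ _ _))
  | succ n =>
    have h : incl V (n + 1) ≫ tensorCounit V = 0 := by
      refine (incl_lift (0 : V ⟶ 𝟙_ C) (n + 1)).trans ?_
      rw [liftPow, MonoidalPreadditive.zero_tensor, zero_comp]
    rw [if_neg n.succ_ne_zero, ← Category.assoc, h, zero_comp]

namespace TruncSeries

/-- The morphism `v ↦ v t`. -/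
def degreeGen (V : C) : (⟨V⟩ : TruncSeries ⊤ C) ⟶ ⟨tensorObject V⟩ :=
  ofCoeffs (fun n => if n = 1 then gen V else 0) fun _ h => absurd le_top h

/-- The algebra endomorphism of T(V)[[t]] extending v ↦ v t multiplies degree m by tᵐ; its
coefficients are therefore the degree projections. It encodes the grading as a single morphism. -/
theorem coeff_liftPow_degreeGen (V : C) : ∀ m n,
    coeff (liftPow (degreeGen V) m) n = if m = n then incl V m else 0
  | 0, n => by
    refine (coeff_const (N := ⊤) (tensorOne V) n).trans ?_
    simp only [eq_comm]; rfl
  | m + 1, n => by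
    refine (coeff_comp_const (degreeGen V ⊗ₘ liftPow (degreeGen V) m) (tensorMul V) n).trans ?_
    rw [coeff_tensorHom _ _ le_top]
    cases n with
    | zero =>
      simp [degreeGen, MonoidalPreadditive.zero_tensor]
    | succ n =>
      -- `degreeGen` is concentrated at t¹, so a single term of the convolution survives.
      rw [Finset.sum_eq_single_of_mem (1, n) (by simp [add_comm])]
      · have e : coeff (degreeGen V) 1 = gen V := by simp [degreeGen]
        refine (congrArg (· ≫ tensorMul V)
          (congrArg₂ (· ⊗ₘ ·) e (coeff_liftPow_degreeGen V m n))).trans ?_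
        simp only [add_left_inj]
        split_ifs with h
        · exact gen_incl_mul V m
        · exact (congrArg (· ≫ _) (MonoidalPreadditive.tensor_zero _)).trans zero_comp
      · rintro ⟨i, j⟩ hij hne
        have : i ≠ 1 := by
          rintro rfl
          rw [mem_antidiagonal] at hij
          exact hne (by ext <;> simp at hij ⊢; omega)
        simp only [degreeGen, coeff_ofCoeffs, if_neg this]
        exact MonoidalPreadditive.zero_tensor _

theorem coeff_lift_degreeGen (V : C) (n : ℕ) : coeff (lift (degreeGen V)) n = tproj V n :=
  BraidedRigidity.tensorObject_hom_ext fun m => by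
    rw [incl_coeff_lift, coeff_liftPow_degreeGen, incl_tproj]

theorem degreeGen_comul (V : C) : degreeGen V ≫ Δ[(⟨tensorObject V⟩ : TruncSeries ⊤ C)] =
    degreeGen V ≫ primitiveMap _ := hom_ext fun n hn => by
  have e : primitiveMap (⟨tensorObject V⟩ : TruncSeries ⊤ C) =
      const ⊤ (primitiveMap (tensorObject V)) := by
    rw [primitiveMap, primitiveMap, const_add, const_comp, const_comp, const_whiskerLeft,
      const_whiskerRight]
    rfl
  rw [e]
  refine (coeff_comp_const (degreeGen V) (tensorComul V) n).trans
    (Eq.trans ?_ (coeff_comp_const (degreeGen V) (primitiveMap (tensorObject V)) n).symm)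
  simp only [degreeGen, coeff_ofCoeffs]
  split_ifs
  · exact gen_comul V
  · rw [zero_comp, zero_comp]

end TruncSeries

open TruncSeries

/-- This is the coefficient of tⁿ in the multiplicativity of the series ∑ `tproj V n` tⁿ. Likewise
`tproj_comul` is the coefficient of tⁿ in its comultiplicativity, which holds because v t is
primitive. -/
theorem mul_tproj (V : C) (n : ℕ) :
    tensorMul V ≫ tproj V n = tensorProj (tproj V) (tproj V) n ≫ tensorMul V := by
  have h := congrArg (fun φ => coeff φ n)
    (IsMonHom.mul_hom (TruncSeries.lift (N := ⊤) (degreeGen V)))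
  have h₁ := coeff_const_comp (tensorMul V) (TruncSeries.lift (N := ⊤) (degreeGen V)) n
  have h₂ := coeff_comp_const (TruncSeries.lift (N := ⊤) (degreeGen V) ⊗ₘ
    TruncSeries.lift (N := ⊤) (degreeGen V)) (tensorMul V) n
  rw [coeff_lift_degreeGen] at h₁
  rw [coeff_tensorHom _ _ le_top] at h₂
  simp only [coeff_lift_degreeGen] at h₂
  exact h₁.symm.trans (h.trans h₂)

theorem tproj_comul (V : C) (n : ℕ) :
    tproj V n ≫ tensorComul V = tensorComul V ≫ tensorProj (tproj V) (tproj V) n := by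
  have h := congrArg (fun φ => coeff φ n) (lift_comul (degreeGen_comul V))
  have h₁ := coeff_comp_const (TruncSeries.lift (N := ⊤) (degreeGen V)) (tensorComul V) n
  have h₂ := coeff_const_comp (tensorComul V) (TruncSeries.lift (N := ⊤) (degreeGen V) ⊗ₘ
    TruncSeries.lift (N := ⊤) (degreeGen V)) n
  rw [coeff_lift_degreeGen] at h₁
  rw [coeff_tensorHom _ _ le_top] at h₂
  simp only [coeff_lift_degreeGen] at h₂
  exact h₁.symm.trans (h.trans h₂)

end TensorDegree

/-! ### Decompositions of objects and homogeneous morphisms -/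

section Decomposition

variable {k : Type u} [Field k] {C : Type u₁} [Category.{v₁} C] [Preadditive C]
  (F : C ⥤ ModuleCat.{u} k)

/-- The endomorphisms `pₙ` are orthogonal idempotents, and the underlying vector space is the
(direct) sum of their images. -/
structure IsDecomposition {X : C} (p : ℕ → (X ⟶ X)) : Prop where
  idem : ∀ n, p n ≫ p n = p n
  orth : ∀ m n, m ≠ n → p m ≫ p n = 0
  span : ⨆ n, LinearMap.range (F.map (p n)).hom = ⊤

variable {F} {X Y Z : C} {p : ℕ → (X ⟶ X)} {q : ℕ → (Y ⟶ Y)} {r : ℕ → (Z ⟶ Z)}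

theorem IsDecomposition.exists_sum [F.Additive] (hp : IsDecomposition F p) (x : F.obj X) :
    ∃ s : Finset ℕ, ∀ t, s ⊆ t → ∑ n ∈ t, (F.map (p n)).hom x = x := by
  have hx : x ∈ ⨆ n, LinearMap.range (F.map (p n)).hom := by rw [hp.span]; trivial
  refine Submodule.iSup_induction _ (motive := fun x => ∃ s : Finset ℕ, ∀ t, s ⊆ t →
    ∑ n ∈ t, (F.map (p n)).hom x = x) hx ?_ ?_ ?_
  · rintro m y hy
    obtain ⟨z, rfl⟩ := hy
    have e : ∀ n, (F.map (p n)).hom ((F.map (p m)).hom z) = (F.map (p m ≫ p n)).hom z := by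
      intro n; rw [F.map_comp]; rfl
    refine ⟨{m}, fun t ht => ?_⟩
    rw [Finset.sum_eq_single_of_mem m (ht (Finset.mem_singleton_self m))]
    · rw [e, hp.idem]
    · intro n _ hn
      rw [e, hp.orth m n hn.symm, F.map_zero]; rfl
  · exact ⟨∅, fun t _ => by simp⟩
  · rintro x y ⟨s, hs⟩ ⟨s', hs'⟩
    classical
    refine ⟨s ∪ s', fun t ht => ?_⟩
    simp only [map_add, Finset.sum_add_distrib]
    rw [hs t (Finset.union_subset_left ht), hs' t (Finset.union_subset_right ht)]

/-- Faithfulness reduces the claim to elements of the underlying space, each of which is a finite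
sum of its components. -/
theorem IsDecomposition.comp_eq_zero [F.Additive] [F.Faithful] (hp : IsDecomposition F p)
    {u : Y ⟶ X} {v : X ⟶ Z} (h : ∀ n, u ≫ p n ≫ v = 0) : u ≫ v = 0 := by
  refine F.map_injective ?_
  ext y
  obtain ⟨s, hs⟩ := hp.exists_sum ((F.map u).hom y)
  have e : (F.map (u ≫ v)).hom y = ∑ n ∈ s, (F.map (u ≫ p n ≫ v)).hom y := by
    simp only [F.map_comp, ModuleCat.hom_comp, LinearMap.comp_apply]
    rw [← map_sum, hs s subset_rfl]
  simp only [h] at e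
  rw [e]
  simp

theorem IsDecomposition.hom_ext [F.Additive] [F.Faithful] (hp : IsDecomposition F p)
    {f g : X ⟶ Y} (h : ∀ n, p n ≫ f = p n ≫ g) : f = g := by
  rw [← sub_eq_zero, ← Category.id_comp (f - g)]
  exact hp.comp_eq_zero fun n => by rw [Preadditive.comp_sub, h, sub_self, comp_zero]

theorem IsDecomposition.hom_ext_right [F.Additive] [F.Faithful] (hp : IsDecomposition F p)
    {f g : Y ⟶ X} (h : ∀ n, f ≫ p n = g ≫ p n) : f = g := by
  rw [← sub_eq_zero, ← Category.comp_id (f - g)]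
  exact hp.comp_eq_zero fun n => by
    rw [Category.comp_id, Preadditive.sub_comp, h, sub_self]

theorem isDecomposition_single [F.Additive] (X : C) (d : ℕ) :
    IsDecomposition F (fun n => if n = d then 𝟙 X else 0) where
  idem n := by split_ifs <;> simp
  orth m n h := by
    split_ifs with h₁ h₂
    · exact absurd (h₁.trans h₂.symm) h
    all_goals simp
  span := by
    rw [eq_top_iff]
    refine le_trans ?_ (le_iSup _ d)
    simp

/-- `IsDecomposition` retains from a grading only what survives in the underlying vector space,
which makes it easy to pass to tensor products. -/
theorem Grading.isDecomposition [F.Additive] [PreservesColimitsOfShape (Discrete ℕ) F]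
    (g : Grading X) : IsDecomposition F g.proj where
  idem n := g.hom_ext fun m => by
    rw [← Category.assoc, g.inj_proj]
    split_ifs with h
    · rw [g.inj_proj, if_pos h]
    · rw [zero_comp]
  orth m n hmn := g.hom_ext fun l => by
    rw [← Category.assoc, g.inj_proj]
    split_ifs with h
    · rw [g.inj_proj, if_neg (h ▸ hmn), comp_zero]
    · rw [zero_comp, comp_zero]
  span := by
    set W := ⨆ n, LinearMap.range (F.map (g.proj n)).hom
    -- The quotient by the span W of the images is zero on every component, hence zero because F
    -- preserves the coproduct.
    have h : ModuleCat.ofHom W.mkQ = 0 := by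
      refine Cofan.IsColimit.hom_ext (isColimitCofanMkObjOfIsColimit F _ _ g.isColimit) _ _
        fun n => ?_
      change F.map (g.inj n) ≫ _ = F.map (g.inj n) ≫ _
      rw [comp_zero]
      have e : g.inj n ≫ g.proj n = g.inj n := by rw [g.inj_proj, if_pos rfl]
      ext x
      change W.mkQ ((F.map (g.inj n)).hom x) = 0
      rw [← e, F.map_comp]
      refine (Submodule.Quotient.mk_eq_zero W).2 ?_
      exact (le_iSup (fun n => LinearMap.range (F.map (g.proj n)).hom) n) ⟨_, rfl⟩
    rw [← Submodule.ker_mkQ W, LinearMap.ker_eq_top]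
    exact congrArg ModuleCat.Hom.hom h

theorem IsDecomposition.comp_eq_ite (hp : IsDecomposition F p) (m n : ℕ) :
    p m ≫ p n = if m = n then p m else 0 := by
  split_ifs with h
  · rw [← h, hp.idem]
  · exact hp.orth m n h

section Homogeneous

variable [Linear k C]

theorem comp_mem_homDeg [F.Additive] [F.Faithful] (hq : IsDecomposition F q) {a b c : ℤ}
    {f : X ⟶ Y} {g : Y ⟶ Z} (hf : f ∈ homDeg k p q a) (hg : g ∈ homDeg k q r b)
    (hc : c = a + b) : f ≫ g ∈ homDeg k p r c := by
  intro m n hn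
  -- Insert the projections of the middle object: in each degree j either the component of f into j
  -- or the component of g out of j vanishes.
  have h : (p m ≫ f) ≫ (g ≫ r n) = 0 := hq.comp_eq_zero fun j => by
    by_cases hj : (j : ℤ) = m + a
    · have := hg j n (by omega)
      rw [this, comp_zero]
    · have := hf m j hj
      rw [← Category.assoc, Category.assoc (p m), this, zero_comp]
  simpa only [Category.assoc] using h

/-- Together with `mem_homDeg_zero_of_comm`, this turns homogeneity of degree zero into equations
that can be cancelled along epimorphisms. -/
theorem comm_of_mem_homDeg_zero [F.Additive] [F.Faithful] (hp : IsDecomposition F p)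
    (hq : IsDecomposition F q) {f : X ⟶ Y} (hf : f ∈ homDeg k p q 0) (n : ℕ) :
    p n ≫ f = f ≫ q n := by
  refine hp.hom_ext fun m => ?_
  rw [← Category.assoc, hp.comp_eq_ite]
  split_ifs with h
  · subst h
    refine hq.hom_ext_right fun j => ?_
    simp only [Category.assoc]
    rw [hq.comp_eq_ite]
    split_ifs with h'
    · rw [h']
    · rw [comp_zero, comp_zero]
      exact hf m j fun h => h' (by omega)
  · rw [zero_comp, hf m n (by omega)]

theorem mem_homDeg_zero_of_comm (hq : IsDecomposition F q) {f : X ⟶ Y}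
    (hf : ∀ n, p n ≫ f = f ≫ q n) : f ∈ homDeg k p q 0 := by
  intro m n hmn
  rw [← Category.assoc, hf, Category.assoc, hq.orth m n (by omega), comp_zero]

theorem id_mem_homDeg (hp : IsDecomposition F p) : 𝟙 X ∈ homDeg k p p 0 :=
  mem_homDeg_zero_of_comm hp fun n => by rw [Category.comp_id, Category.id_comp]

end Homogeneous

variable [MonoidalCategory C] [MonoidalPreadditive C]

theorem tensorHom_comp_tensorProj
    (hp : ∀ m n, p m ≫ p n = if m = n then p m else 0)
    (hq : ∀ m n, q m ≫ q n = if m = n then q m else 0) (i j n : ℕ) :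
    (p i ⊗ₘ q j) ≫ tensorProj p q n = if i + j = n then (p i ⊗ₘ q j) else 0 := by
  rw [tensorProj, Preadditive.comp_sum]
  simp only [tensorHom_comp_tensorHom, hp, hq]
  split_ifs with h
  · rw [Finset.sum_eq_single_of_mem (i, j) (by simpa using h)]
    · simp
    · rintro ⟨a, b⟩ _ hne
      by_cases ha : i = a
      · have hb : j ≠ b := fun hb => hne (by rw [ha, hb])
        simp only [if_neg hb, MonoidalPreadditive.tensor_zero]
      · simp only [if_neg ha, MonoidalPreadditive.zero_tensor]
  · refine Finset.sum_eq_zero ?_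
    rintro ⟨a, b⟩ hab
    by_cases ha : i = a
    · have hb : j ≠ b := by rintro rfl; subst ha; exact h (by simpa using hab)
      simp only [if_neg hb, MonoidalPreadditive.tensor_zero]
    · simp only [if_neg ha, MonoidalPreadditive.zero_tensor]

theorem map_tensorHom_μ [F.Monoidal] (f : X ⟶ X) (g : Y ⟶ Y) (x : F.obj X) (y : F.obj Y) :
    (F.map (f ⊗ₘ g)).hom ((Functor.LaxMonoidal.μ F X Y).hom (x ⊗ₜ[k] y)) =
      (Functor.LaxMonoidal.μ F X Y).hom ((F.map f).hom x ⊗ₜ[k] (F.map g).hom y) :=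
  (congrArg (fun φ => φ.hom (x ⊗ₜ[k] y)) (Functor.LaxMonoidal.μ_natural F f g)).symm

theorem IsDecomposition.tensor [F.Additive] [F.Monoidal] (hp : IsDecomposition F p)
    (hq : IsDecomposition F q) : IsDecomposition F (tensorProj p q) where
  idem n := by
    nth_rw 1 [tensorProj]
    rw [Preadditive.sum_comp]
    refine Finset.sum_congr rfl fun ij h => ?_
    rw [tensorHom_comp_tensorProj hp.comp_eq_ite hq.comp_eq_ite, if_pos (by simpa using h)]
  orth m n hmn := by
    nth_rw 1 [tensorProj]
    rw [Preadditive.sum_comp]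
    refine Finset.sum_eq_zero fun ij h => ?_
    rw [tensorHom_comp_tensorProj hp.comp_eq_ite hq.comp_eq_ite, if_neg]
    rw [mem_antidiagonal] at h
    omega
  span := by
    rw [eq_top_iff]
    rintro z -
    -- The monoidal structure of F identifies the underlying space with a tensor product of vector
    -- spaces, spanned by tensors of homogeneous elements.
    have hz : (Functor.LaxMonoidal.μ F X Y).hom ((Functor.OplaxMonoidal.δ F X Y).hom z) = z :=
      congrArg (fun φ => φ.hom z) (Functor.Monoidal.δ_μ F X Y)
    rw [← hz]
    generalize (Functor.OplaxMonoidal.δ F X Y).hom z = w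
    induction w using TensorProduct.induction_on with
    | zero => rw [map_zero]; exact zero_mem _
    | add w w' h h' => rw [map_add]; exact add_mem h h'
    | tmul x y =>
      obtain ⟨s, hs⟩ := hp.exists_sum x
      obtain ⟨t, ht⟩ := hq.exists_sum y
      rw [← hs s subset_rfl, ← ht t subset_rfl, TensorProduct.sum_tmul, map_sum]
      refine sum_mem fun i _ => ?_
      rw [TensorProduct.tmul_sum, map_sum]
      refine sum_mem fun j _ => ?_
      rw [← map_tensorHom_μ]
      refine (le_iSup (fun n => LinearMap.range (F.map (tensorProj p q n)).hom) (i + j)) ?_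
      refine ⟨(F.map (p i ⊗ₘ q j)).hom ((Functor.LaxMonoidal.μ F X Y).hom (x ⊗ₜ[k] y)), ?_⟩
      have e : (p i ⊗ₘ q j) ≫ tensorProj p q (i + j) = (p i ⊗ₘ q j) := by
        rw [tensorHom_comp_tensorProj hp.comp_eq_ite hq.comp_eq_ite, if_pos rfl]
      nth_rw 2 [← e]
      rw [F.map_comp]
      rfl

variable [Linear k C]

/-- If the total degree does not change by a + b, then in one of the two factors the degree does not
change by the expected amount. -/
theorem tensorHom_mem_homDeg {X' Y' : C} {p' : ℕ → (X' ⟶ X')} {q' : ℕ → (Y' ⟶ Y')}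
    {a b c : ℤ} {f : X ⟶ Y} {g : X' ⟶ Y'} (hf : f ∈ homDeg k p q a) (hg : g ∈ homDeg k p' q' b)
    (hc : c = a + b) : (f ⊗ₘ g) ∈ homDeg k (tensorProj p p') (tensorProj q q') c := by
  intro m n hn
  simp only [tensorProj, Preadditive.sum_comp, Preadditive.comp_sum, tensorHom_comp_tensorHom]
  refine Finset.sum_eq_zero fun ij h => Finset.sum_eq_zero fun ij' h' => ?_
  rw [mem_antidiagonal] at h h'
  by_cases h₁ : (ij.1 : ℤ) = ij'.1 + a
  · rw [hg ij'.2 ij.2 (by omega), MonoidalPreadditive.tensor_zero]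
  · rw [hf ij'.1 ij.1 h₁, MonoidalPreadditive.zero_tensor]

end Decomposition

/-! ### Series that are homogeneous when t has degree L -/

section SeriesDegree

open TruncSeries

variable {k : Type u} [Field k] {C : Type u₁} [Category.{v₁} C] [Preadditive C]
  [Linear k C] {F : C ⥤ ModuleCat.{u} k} {N : ℕ∞}

/-- A series is graded with respect to a parameter `t` of degree `L` if the coefficient of `tⁱ` is
homogeneous of degree `-L i`. -/
def TruncSeries.IsGraded (k : Type u) [Field k] [Linear k C] (L : ℤ) {X Y : TruncSeries N C}
    (p : ℕ → (X.as ⟶ X.as)) (q : ℕ → (Y.as ⟶ Y.as)) (f : X ⟶ Y) : Prop :=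
  ∀ i : ℕ, coeff f i ∈ homDeg k p q (-(L * i))

variable {L : ℤ} {X Y Z : TruncSeries N C} {p : ℕ → (X.as ⟶ X.as)} {q : ℕ → (Y.as ⟶ Y.as)}
  {r : ℕ → (Z.as ⟶ Z.as)}

theorem TruncSeries.IsGraded.comp [F.Additive] [F.Faithful] (hq : IsDecomposition F q)
    {f : X ⟶ Y} {g : Y ⟶ Z} (hf : IsGraded k L p q f) (hg : IsGraded k L q r g) :
    IsGraded k L p r (f ≫ g) := fun i => by
  by_cases hi : (i : ℕ∞) ≤ N
  · rw [coeff_comp _ _ hi]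
    refine sum_mem fun ab hab => comp_mem_homDeg hq (hf ab.1) (hg ab.2) ?_
    rw [mem_antidiagonal] at hab
    subst hab
    push_cast
    ring
  · rw [coeff_eq_zero _ hi]
    exact zero_mem _

theorem TruncSeries.IsGraded.sub {f g : X ⟶ Y} (hf : IsGraded k L p q f)
    (hg : IsGraded k L p q g) : IsGraded k L p q (f - g) := fun i => sub_mem (hf i) (hg i)

theorem TruncSeries.isGraded_const {X Y : C} {p : ℕ → (X ⟶ X)} {q : ℕ → (Y ⟶ Y)} {f : X ⟶ Y}
    (hf : f ∈ homDeg k p q 0) : IsGraded k L p q (const N f) := fun i => by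
  rw [coeff_const]
  split_ifs with h
  · subst h; simpa using hf
  · exact zero_mem _

theorem TruncSeries.IsGraded.tensorHom [MonoidalCategory C] [MonoidalPreadditive C]
    {X' Y' : TruncSeries N C}
    {p' : ℕ → (X'.as ⟶ X'.as)} {q' : ℕ → (Y'.as ⟶ Y'.as)} {f : X ⟶ Y} {g : X' ⟶ Y'}
    (hf : IsGraded k L p q f) (hg : IsGraded k L p' q' g) :
    IsGraded k L (X := X ⊗ X') (Y := Y ⊗ Y') (tensorProj p p') (tensorProj q q') (f ⊗ₘ g) :=
  fun i => by
  by_cases hi : (i : ℕ∞) ≤ N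
  · rw [coeff_tensorHom _ _ hi]
    refine sum_mem fun ab hab => tensorHom_mem_homDeg (hf ab.1) (hg ab.2) ?_
    rw [mem_antidiagonal] at hab
    subst hab
    push_cast
    ring
  · rw [coeff_eq_zero _ hi]
    exact zero_mem _

end SeriesDegree

/-! ### Lifting a quotient map of the tensor bialgebra to a deformation -/

section LiftDegree

open TruncSeries

variable {k : Type u} [Field k] {C : Type u₁} [Category.{v₁} C] [Preadditive C] [Linear k C]
  [MonoidalCategory C] [MonoidalPreadditive C] [BraidedCategory C]
  [HasColimitsOfShape (Discrete ℕ) C]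
  [∀ X : C, PreservesColimitsOfShape (Discrete ℕ) (tensorLeft X)]
  [∀ X : C, PreservesColimitsOfShape (Discrete ℕ) (tensorRight X)]
  {F : C ⥤ ModuleCat.{u} k} {N : ℕ∞}

/-- Used to see that the n-th tensor power of V, with V in degree 1, is concentrated in degree n. -/
theorem tensorProj_single (X Y : C) (a b : ℕ) :
    tensorProj (fun n => if n = a then 𝟙 X else 0) (fun n => if n = b then 𝟙 Y else 0) =
      fun n => if n = a + b then 𝟙 (X ⊗ Y) else 0 := by
  funext n
  rw [tensorProj]
  split_ifs with h
  · rw [Finset.sum_eq_single_of_mem (a, b) (by simp [h])]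
    · simp
    · rintro ⟨i, j⟩ _ hne
      by_cases hi : i = a
      · have hj : j ≠ b := fun hj => hne (by rw [hi, hj])
        simp only [if_neg hj, MonoidalPreadditive.tensor_zero]
      · simp only [if_neg hi, MonoidalPreadditive.zero_tensor]
  · refine Finset.sum_eq_zero ?_
    rintro ⟨i, j⟩ hij
    rw [mem_antidiagonal] at hij
    by_cases hi : i = a
    · have hj : j ≠ b := fun hj => h (by rw [← hij, hi, hj])
      simp only [if_neg hj, MonoidalPreadditive.tensor_zero]
    · simp only [if_neg hi, MonoidalPreadditive.zero_tensor]

variable {V : C} {A : TruncSeries N C} [MonObj A] {L : ℤ} {q : ℕ → (A.as ⟶ A.as)}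

theorem isGraded_liftPow [F.Additive] [F.Faithful] [F.Monoidal] (hq : IsDecomposition F q)
    (hμ : IsGraded k L (X := A ⊗ A) (tensorProj q q) q μ[A])
    (hη : IsGraded k L (X := 𝟙_ _) (unitProj C) q η[A]) {s : ⟨V⟩ ⟶ A}
    (hs : IsGraded k L (X := ⟨V⟩) (fun n => if n = 1 then 𝟙 V else 0) q s) : ∀ n,
    IsGraded k L (X := ⟨tpow V n⟩) (fun m => if m = n then 𝟙 (tpow V n) else 0) q
      (TruncSeries.liftPow s n)
  | 0 => hη
  | n + 1 => by
    have h := (hs.tensorHom (isGraded_liftPow hq hμ hη hs n)).comp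
      (hq.tensor hq) hμ
    rw [tensorProj_single, add_comm] at h
    exact h

/-- On each tensor power the lift is an iterated product of homogeneous series, by
`isGraded_liftPow`. -/
theorem isGraded_lift [F.Additive] [F.Faithful] [F.Monoidal] (hq : IsDecomposition F q)
    (hμ : IsGraded k L (X := A ⊗ A) (tensorProj q q) q μ[A])
    (hη : IsGraded k L (X := 𝟙_ _) (unitProj C) q η[A]) {s : ⟨V⟩ ⟶ A}
    (hs : IsGraded k L (X := ⟨V⟩) (fun n => if n = 1 then 𝟙 V else 0) q s) :
    IsGraded k L (X := ⟨tensorObject V⟩) (tproj V) q (TruncSeries.lift s) := by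
  intro i m n hmn
  refine BraidedRigidity.tensorObject_hom_ext fun l => ?_
  rw [← Category.assoc, incl_tproj]
  split_ifs with h
  · subst h
    have h := isGraded_liftPow hq hμ hη hs l i l n hmn
    simp only [if_true] at h
    rw [← incl_coeff_lift, Category.id_comp, Category.assoc] at h
    rw [h, comp_zero]
  · rw [zero_comp, comp_zero]

end LiftDegree

/-! ### The lift of the generators to a deformation -/

section Quotient

open TruncSeries

variable {k : Type u} [Field k] {C : Type u₁} [Category.{v₁} C] [Preadditive C] [Linear k C]
  {F : C ⥤ ModuleCat.{u} k} [F.Additive] [F.Faithful]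

/-- V sits in degree 1 and degrees are non-negative, so a morphism of degree at most -1 can only
reach degree 0. -/
theorem comp_proj_zero {X V : C} {q : ℕ → (X ⟶ X)} (hq : IsDecomposition F q) {ℓ : ℤ}
    (hℓ : ℓ ≤ -1) {f : V ⟶ X} (hf : f ∈ homDeg k (fun n => if n = 1 then 𝟙 V else 0) q ℓ) :
    f ≫ q 0 = f := by
  refine hq.hom_ext_right fun n => ?_
  rw [Category.assoc, hq.comp_eq_ite]
  split_ifs with h
  · rw [h]
  · have := hf 1 n (by omega)
    simp only [if_true, Category.id_comp] at this
    rw [this, comp_zero]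

variable [MonoidalCategory C] [MonoidalPreadditive C] [BraidedCategory C]
  [HasColimitsOfShape (Discrete ℕ) C]
  [∀ X : C, PreservesColimitsOfShape (Discrete ℕ) (tensorLeft X)]
  [∀ X : C, PreservesColimitsOfShape (Discrete ℕ) (tensorRight X)]

theorem isDecomposition_tproj (F : C ⥤ ModuleCat.{u} k) [F.Additive]
    [PreservesColimitsOfShape (Discrete ℕ) F] (V : C) : IsDecomposition F (tproj V) :=
  Grading.isDecomposition ⟨tpow V, incl V, inclIsColimit V⟩

theorem gen_mem_homDeg (V : C) :
    gen V ∈ homDeg k (fun n => if n = 1 then 𝟙 V else 0) (tproj V) 0 := by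
  intro m n hmn
  have h : gen V ≫ tproj V n = if 1 = n then gen V else 0 := by
    rw [gen, Category.assoc, incl_tproj]
    split_ifs <;> simp
  rw [h]
  by_cases h₁ : 1 = n
  · have : m ≠ 1 := by omega
    simp only [if_neg this, zero_comp]
  · rw [if_neg h₁, comp_zero]

variable {V B : C} [BimonObj B] {q : ℕ → (B ⟶ B)} (π : tensorObject V ⟶ B) [IsBimonHom π]

theorem quotient_counit : π ≫ ε[B] = tensorCounit V := IsComonHom.hom_counit π

theorem quotient_one : tensorOne V ≫ π = η[B] := IsMonHom.one_hom π

theorem gen_quotient_counit : gen V ≫ π ≫ ε[B] = 0 := by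
  rw [quotient_counit, gen_counit]

theorem gen_quotient_comul : gen V ≫ π ≫ Δ[B] = gen V ≫ π ≫ primitiveMap B := by
  have h : π ≫ Δ[B] = tensorComul V ≫ (π ⊗ₘ π) := IsComonHom.hom_comul π
  rw [h, gen_comul_assoc, primitiveMap_tensorHom π (IsMonHom.one_hom π)]

variable {π}

/-- B is connected because T(V) is: π commutes with the projections, and on T(V) the projection to
degree 0 is the counit followed by the unit. -/
theorem proj_zero_of_quotient [F.Monoidal] [PreservesColimitsOfShape (Discrete ℕ) F]
    (hq : IsDecomposition F q) [Epi π] (hπ : π ∈ homDeg k (tproj V) q 0) :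
    q 0 = ε[B] ≫ η[B] := by
  rw [← cancel_epi π, ← comm_of_mem_homDeg_zero (isDecomposition_tproj F V) hq hπ, tproj_zero,
    Category.assoc, quotient_one, ← Category.assoc, quotient_counit]

theorem one_mem_homDeg (hq : IsDecomposition F q) (h₀ : q 0 = ε[B] ≫ η[B]) :
    η[B] ∈ homDeg k (unitProj C) q 0 := by
  have hη : η[B] ≫ q 0 = η[B] := by
    rw [h₀, ← Category.assoc, BimonObj.one_counit, Category.id_comp]
  intro m n hmn
  rw [unitProj]
  split_ifs with h
  · rw [Category.id_comp, ← hη, Category.assoc, hq.orth 0 n (by omega), comp_zero]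
  · rw [zero_comp]

variable (π) {N : ℕ∞} [BimonObj (⟨B⟩ : TruncSeries N C)]

/-- The lift `v ↦ π(v) - ε(π(v))` of the generators to a deformation. -/
def generatorLift : (⟨V⟩ : TruncSeries N C) ⟶ ⟨B⟩ :=
  const N (gen V ≫ π) - const N (gen V ≫ π) ≫ ε[(⟨B⟩ : TruncSeries N C)] ≫ η

/-- The deformed counit need not vanish on π(V); the correction term in `generatorLift` is there to
cancel it. -/
theorem generatorLift_counit :
    generatorLift π ≫ ε[(⟨B⟩ : TruncSeries N C)] = 0 := by
  rw [generatorLift, Preadditive.sub_comp, Category.assoc, Category.assoc, BimonObj.one_counit,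
    Category.comp_id, sub_self]

variable {π}

theorem isGraded_generatorLift [PreservesColimitsOfShape (Discrete ℕ) F]
    (hq : IsDecomposition F q) {L : ℤ} (hπ : π ∈ homDeg k (tproj V) q 0)
    (hη : IsGraded k L (X := 𝟙_ _) (Y := ⟨B⟩) (unitProj C) q η[(⟨B⟩ : TruncSeries N C)])
    (hε : IsGraded k L (X := ⟨B⟩) (Y := 𝟙_ _) q (unitProj C) ε[(⟨B⟩ : TruncSeries N C)]) :
    IsGraded k L (X := ⟨V⟩) (Y := ⟨B⟩) (fun n => if n = 1 then 𝟙 V else 0) q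
      (generatorLift (N := N) π) := by
  have h : IsGraded k L (X := ⟨V⟩) (Y := ⟨B⟩) (fun n => if n = 1 then 𝟙 V else 0) q
      (const N (gen V ≫ π)) :=
    isGraded_const (comp_mem_homDeg (isDecomposition_tproj F V) (gen_mem_homDeg V) hπ
      (add_zero 0).symm)
  exact h.sub (h.comp hq (hε.comp (isDecomposition_single (F := F) (𝟙_ C) 0) hη))

theorem coeff_generatorLift_zero (hε₀ : coeff ε[(⟨B⟩ : TruncSeries N C)] 0 = ε[B]) :
    coeff (generatorLift (N := N) π) 0 = gen V ≫ π := by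
  rw [generatorLift, coeff_sub, coeff_comp_zero, coeff_comp_zero, coeff_const_zero, hε₀,
    ← Category.assoc, Category.assoc (gen V), gen_quotient_counit, zero_comp, sub_zero]

theorem primitiveMap_eq_const (hη : η[(⟨B⟩ : TruncSeries N C)] = const N η[B]) :
    primitiveMap (⟨B⟩ : TruncSeries N C) = const N (primitiveMap B) := by
  rw [primitiveMap, primitiveMap, const_add, const_comp, const_comp, const_whiskerLeft,
    const_whiskerRight, hη]
  rfl

/-- The defect of primitivity lies in B₀ ⊗ B₀ for reasons of degree, and a multiple of 1 ⊗ 1 is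
detected by the counit. -/
theorem generatorLift_comul [F.Monoidal] [PreservesColimitsOfShape (Discrete ℕ) F]
    (hq : IsDecomposition F q) {L : ℤ} (hL : 1 ≤ L) [Epi π]
    (hπ : π ∈ homDeg k (tproj V) q 0)
    (hη : η[(⟨B⟩ : TruncSeries N C)] = const N η[B])
    (hε₀ : coeff ε[(⟨B⟩ : TruncSeries N C)] 0 = ε[B])
    (hΔ₀ : coeff Δ[(⟨B⟩ : TruncSeries N C)] 0 = Δ[B])
    (hε : IsGraded k L (X := ⟨B⟩) (Y := 𝟙_ _) q (unitProj C) ε[(⟨B⟩ : TruncSeries N C)])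
    (hΔ : IsGraded k L (X := ⟨B⟩) (Y := ⟨B⟩ ⊗ ⟨B⟩) q (tensorProj q q)
      Δ[(⟨B⟩ : TruncSeries N C)]) :
    generatorLift π ≫ Δ[(⟨B⟩ : TruncSeries N C)] = generatorLift π ≫ primitiveMap _ := by
  have h₀ := proj_zero_of_quotient hq hπ
  have hs := isGraded_generatorLift (N := N) hq hπ
    (hη ▸ isGraded_const (one_mem_homDeg hq h₀)) hε
  set s : (⟨V⟩ : TruncSeries N C) ⟶ ⟨B⟩ := generatorLift π with hs_def
  have hsε : s ≫ ε[(⟨B⟩ : TruncSeries N C)] = 0 := generatorLift_counit π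
  rw [← sub_eq_zero]
  set δ := s ≫ Δ[(⟨B⟩ : TruncSeries N C)] - s ≫ primitiveMap _ with hδ
  -- The constant coefficient of δ is zero since π(V) is primitive in B. The coefficient of order i
  -- + 1 has degree at most -1 on V, which is in degree 1.
  have hproj : δ = δ ≫ const N (q 0 ⊗ₘ q 0) := hom_ext fun i hi => by
    have e : coeff δ i = coeff (s ≫ Δ[(⟨B⟩ : TruncSeries N C)]) i -
        coeff s i ≫ primitiveMap B := by
      rw [hδ, coeff_sub, primitiveMap_eq_const hη]
      exact congrArg (_ - ·) (coeff_comp_const s (primitiveMap B) i)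
    refine Eq.trans ?_ (coeff_comp_const δ (q 0 ⊗ₘ q 0) i).symm
    rw [e]
    cases i with
    | zero =>
      rw [coeff_comp_zero, hΔ₀, hs_def, coeff_generatorLift_zero hε₀, Category.assoc,
        Category.assoc, gen_quotient_comul]
      exact (sub_self _).trans ((congrArg (· ≫ _) (sub_self _)).trans zero_comp).symm
    | succ i =>
      have hneg : -(L * ((i + 1 : ℕ) : ℤ)) ≤ -1 := by push_cast; nlinarith
      have h₁ := comp_proj_zero (hq.tensor hq) hneg ((hs.comp hq hΔ) (i + 1))
      have h₂ := comp_proj_zero hq hneg (hs (i + 1))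
      have h₃ : primitiveMap B ≫ (q 0 ⊗ₘ q 0) = q 0 ≫ primitiveMap B :=
        primitiveMap_tensorHom _ (by rw [h₀, ← Category.assoc, BimonObj.one_counit,
          Category.id_comp])
      have h₄ : tensorProj q q 0 = (q 0 ⊗ₘ q 0) := by simp [tensorProj]
      rw [h₄] at h₁
      refine Eq.trans ?_ (Preadditive.sub_comp _ _ _).symm
      refine congrArg₂ (· - ·) h₁.symm ?_
      rw [Category.assoc, h₃, ← Category.assoc, h₂]
  -- B₀ is the image of the unit, which is undeformed by `hη`, so the deformed ηε is the identity on
  -- it.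
  have hker : const N (q 0) ≫ (𝟙 _ - ε[(⟨B⟩ : TruncSeries N C)] ≫ η) = 0 := by
    rw [h₀, const_comp, Category.assoc, Preadditive.comp_sub, Category.comp_id]
    have h : η[(⟨B⟩ : TruncSeries N C)] ≫ ε[(⟨B⟩ : TruncSeries N C)] ≫
        η[(⟨B⟩ : TruncSeries N C)] = η := by
      rw [← Category.assoc, BimonObj.one_counit, Category.id_comp]
    have : const N η[B] ≫ ε[(⟨B⟩ : TruncSeries N C)] ≫ η[(⟨B⟩ : TruncSeries N C)] =
        const N η[B] :=
      (congrArg (· ≫ ε[(⟨B⟩ : TruncSeries N C)] ≫ η[(⟨B⟩ : TruncSeries N C)]) hη.symm).trans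
        (h.trans hη)
    rw [this, sub_self, comp_zero]
  have h₁ : δ ≫ (𝟙 _ - ε[(⟨B⟩ : TruncSeries N C)] ≫ η) ▷ ⟨B⟩ = 0 := by
    rw [hproj, const_tensorHom, MonoidalCategory.tensorHom_def']
    simp only [Category.assoc]
    rw [← comp_whiskerRight, hker]
    simp
  -- Both Δ_t s and s ⊗ 1 + 1 ⊗ s are sent to s, the former by the counit axiom and the latter
  -- because ε_t(s) = 0.
  have h₂ : δ ≫ ε[(⟨B⟩ : TruncSeries N C)] ▷ ⟨B⟩ = 0 := by
    rw [hδ, Preadditive.sub_comp, Category.assoc, Category.assoc, ComonObj.counit_comul,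
      primitiveMap]
    simp only [Preadditive.add_comp, Preadditive.comp_add, Category.assoc]
    rw [whisker_exchange, rightUnitor_inv_naturality_assoc, ← comp_whiskerRight_assoc s, hsε,
      ← comp_whiskerRight, BimonObj.one_counit]
    simp
  have h₃ : δ ≫ (𝟙 (⟨B⟩ : TruncSeries N C)) ▷ ⟨B⟩ =
      δ ≫ (𝟙 _ - ε[(⟨B⟩ : TruncSeries N C)] ≫ η) ▷ ⟨B⟩ +
        (δ ≫ ε[(⟨B⟩ : TruncSeries N C)] ▷ ⟨B⟩) ≫ η[(⟨B⟩ : TruncSeries N C)] ▷ ⟨B⟩ := by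
    rw [Category.assoc, ← comp_whiskerRight, ← Preadditive.comp_add,
      ← MonoidalPreadditive.add_whiskerRight, sub_add_cancel]
  rw [h₁, h₂, zero_comp, add_zero] at h₃
  simpa using h₃

end Quotient

/-! ### The lift vanishes on the ideal of relations -/

section Ideal

open TruncSeries

section Multiplicative

variable {C : Type u₁} [Category.{v₁} C] [Preadditive C]
  [MonoidalCategory C] [MonoidalPreadditive C] [BraidedCategory C]
  [HasColimitsOfShape (Discrete ℕ) C]
  [∀ X : C, PreservesColimitsOfShape (Discrete ℕ) (tensorLeft X)]
  [∀ X : C, PreservesColimitsOfShape (Discrete ℕ) (tensorRight X)]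
  {N : ℕ∞} {V : C} {A : TruncSeries N C} [MonObj A]
  (Φ : (⟨tensorObject V⟩ : TruncSeries N C) ⟶ A) [IsMonHom Φ]

theorem tproj_comp_tproj (V : C) (m n : ℕ) :
    tproj V m ≫ tproj V n = if m = n then tproj V m else 0 := by
  refine BraidedRigidity.tensorObject_hom_ext fun l => ?_
  rw [← Category.assoc, incl_tproj]
  by_cases h : l = m
  · rw [if_pos h, incl_tproj, ← h]
    split_ifs
    · rw [incl_tproj, if_pos rfl]
    · rw [comp_zero]
  · rw [if_neg h, zero_comp]
    split_ifs
    · rw [incl_tproj, if_neg h]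
    · rw [comp_zero]

theorem const_mul_comp {X Y : C} (a : X ⟶ tensorObject V) (b : Y ⟶ tensorObject V) :
    const N ((a ⊗ₘ b) ≫ tensorMul V) ≫ Φ =
      (((const N a ≫ Φ) ⊗ₘ (const N b ≫ Φ)) ≫ μ : ⟨X⟩ ⊗ ⟨Y⟩ ⟶ A) := by
  have h : const N (tensorMul V) ≫ Φ = (Φ ⊗ₘ Φ) ≫ μ := IsMonHom.mul_hom Φ
  rw [const_comp, Category.assoc, h, const_tensorHom]
  exact (tensorHom_comp_tensorHom_assoc (const N a) (const N b) Φ Φ μ)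

theorem const_sum {J : Type*} {X Y : C} (s : Finset J) (f : J → (X ⟶ Y)) :
    const N (∑ i ∈ s, f i) = ∑ i ∈ s, const N (f i) :=
  map_sum (AddMonoidHom.mk' (const N : (X ⟶ Y) → _) const_add) f s

theorem mul_comp_tproj {X Y : C} (a : X ⟶ tensorObject V) (b : Y ⟶ tensorObject V) (n : ℕ) :
    (a ⊗ₘ b) ≫ tensorMul V ≫ tproj V n =
      ∑ p ∈ antidiagonal n, ((a ≫ tproj V p.1) ⊗ₘ (b ≫ tproj V p.2)) ≫ tensorMul V := by
  rw [mul_tproj, tensorProj, Preadditive.sum_comp, Preadditive.comp_sum]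
  simp only [tensorHom_comp_tensorHom_assoc]

variable {Φ} {n : ℕ}

/-- A product of degree x < n only involves factors of degree at most x. -/
theorem mul_comp_tproj_eq_zero_left {X Y : C} {a : X ⟶ tensorObject V}
    (b : Y ⟶ tensorObject V) (ha : ∀ w < n, const N (a ≫ tproj V w) ≫ Φ = 0) :
    ∀ x < n, const N (((a ⊗ₘ b) ≫ tensorMul V) ≫ tproj V x) ≫ Φ = 0 := fun x hx => by
  rw [Category.assoc, mul_comp_tproj, const_sum, Preadditive.sum_comp]
  refine Finset.sum_eq_zero fun p hp => ?_
  rw [mem_antidiagonal] at hp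
  refine (const_mul_comp Φ (a ≫ tproj V p.1) (b ≫ tproj V p.2)).trans ?_
  rw [ha p.1 (by omega), MonoidalPreadditive.zero_tensor, zero_comp]

theorem mul_comp_tproj_eq_zero_right {X Y : C} (b : X ⟶ tensorObject V)
    {a : Y ⟶ tensorObject V} (ha : ∀ w < n, const N (a ≫ tproj V w) ≫ Φ = 0) :
    ∀ x < n, const N (((b ⊗ₘ a) ≫ tensorMul V) ≫ tproj V x) ≫ Φ = 0 := fun x hx => by
  rw [Category.assoc, mul_comp_tproj, const_sum, Preadditive.sum_comp]
  refine Finset.sum_eq_zero fun p hp => ?_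
  rw [mem_antidiagonal] at hp
  refine (const_mul_comp Φ (b ≫ tproj V p.1) (a ≫ tproj V p.2)).trans ?_
  rw [ha p.2 (by omega), MonoidalPreadditive.tensor_zero, zero_comp]

end Multiplicative

variable {C : Type u₁} [Category.{v₁} C] [Abelian C]
  [MonoidalCategory C] [MonoidalPreadditive C] [BraidedCategory C]

/-- The morphism `A ⊗ R ⊗ A → ⟨R⟩`. -/
def toGeneratedIdeal {A : C} [MonObj A] (R : Subobject A) :
    (A ⊗ (R : C)) ⊗ A ⟶ (generatedIdeal R : C) :=
  factorThruImageSubobject _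

theorem toGeneratedIdeal_arrow {A : C} [MonObj A] (R : Subobject A) :
    toGeneratedIdeal R ≫ (generatedIdeal R).arrow =
      (A ◁ R.arrow) ▷ A ≫ μ[A] ▷ A ≫ μ[A] :=
  imageSubobject_arrow_comp _

instance {A : C} [MonObj A] (R : Subobject A) : Epi (toGeneratedIdeal R) :=
  inferInstanceAs (Epi (factorThruImageSubobject _))

theorem exists_comp_generatedIdeal_arrow {A : C} [MonObj A] (R : Subobject A) :
    ∃ g : (R : C) ⟶ (generatedIdeal R : C), g ≫ (generatedIdeal R).arrow = R.arrow := by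
  -- The witness is r ↦ 1 ⊗ r ⊗ 1.
  refine ⟨((λ_ (R : C)).inv ≫ η[A] ▷ (R : C) ≫ (ρ_ _).inv ≫ (A ⊗ (R : C)) ◁ η[A]) ≫
    toGeneratedIdeal R, ?_⟩
  rw [Category.assoc, toGeneratedIdeal_arrow]
  simp only [Category.assoc]
  rw [whisker_exchange_assoc, whisker_exchange_assoc, MonObj.mul_one,
    rightUnitor_naturality, rightUnitor_naturality_assoc, Iso.inv_hom_id_assoc,
    ← whisker_exchange_assoc, MonObj.one_mul, leftUnitor_naturality, Iso.inv_hom_id_assoc]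

/-- Both I ⊗ A and A ⊗ I lie in the kernel of f ⊗ g. The morphisms f and g may differ, as is needed
for the separate coefficients of Φ ⊗ Φ. -/
theorem IsBiideal.comul_comp_eq_zero {A : C} [BimonObj A] {I : Subobject A} (hI : IsBiideal I)
    {Y Z : C} {f : A ⟶ Y} {g : A ⟶ Z} (hf : I.arrow ≫ f = 0) (hg : I.arrow ≫ g = 0) :
    I.arrow ≫ Δ[A] ≫ (f ⊗ₘ g) = 0 := by
  have h₁ : imageSubobject (I.arrow ▷ A) ≤ kernelSubobject (f ⊗ₘ g) := by
    refine le_kernelSubobject _ _ ?_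
    rw [← cancel_epi (factorThruImageSubobject (I.arrow ▷ A)), imageSubobject_arrow_comp_assoc,
      comp_zero, MonoidalCategory.tensorHom_def, ← comp_whiskerRight_assoc, hf]
    simp
  have h₂ : imageSubobject (A ◁ I.arrow) ≤ kernelSubobject (f ⊗ₘ g) := by
    refine le_kernelSubobject _ _ ?_
    rw [← cancel_epi (factorThruImageSubobject (A ◁ I.arrow)), imageSubobject_arrow_comp_assoc,
      comp_zero, MonoidalCategory.tensorHom_def', ← MonoidalCategory.whiskerLeft_comp_assoc, hg]
    simp
  have h := Subobject.factors_of_le _ (sup_le h₁ h₂) hI.comul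
  rw [← Category.assoc]
  exact (kernelSubobject_factors_iff _ _).1 h

/-! ### Vanishing of the lift on the relations -/

section Relations

variable {k : Type u} [Field k] [Linear k C] {F : C ⥤ ModuleCat.{u} k} [F.Additive] [F.Faithful]
  [F.Monoidal] [PreservesColimitsOfShape (Discrete ℕ) F] [HasColimitsOfShape (Discrete ℕ) C]
  [∀ X : C, PreservesColimitsOfShape (Discrete ℕ) (tensorLeft X)]
  [∀ X : C, PreservesColimitsOfShape (Discrete ℕ) (tensorRight X)]
  {N : ℕ∞} {V : C} {R : Subobject (tensorObject V)}

/-- The degree of a r b is at least that of r, so the ideal in degrees below n only involves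
relations in degrees below n, and Φ is multiplicative. -/
theorem generatedIdeal_comp_tproj_eq_zero {A : TruncSeries N C} [MonObj A]
    {Φ : (⟨tensorObject V⟩ : TruncSeries N C) ⟶ A} [IsMonHom Φ] {n : ℕ}
    (h : ∀ w < n, const N (R.arrow ≫ tproj V w) ≫ Φ = 0) (x : ℕ) (hx : x < n) :
    const N ((generatedIdeal R).arrow ≫ tproj V x) ≫ Φ = 0 := by
  have h₁ := mul_comp_tproj_eq_zero_left (𝟙 (tensorObject V))
    (mul_comp_tproj_eq_zero_right (𝟙 (tensorObject V)) h) x hx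
  have e : ((𝟙 (tensorObject V) ⊗ₘ R.arrow) ≫ tensorMul V ⊗ₘ 𝟙 (tensorObject V)) ≫ tensorMul V =
      toGeneratedIdeal R ≫ (generatedIdeal R).arrow := by
    rw [toGeneratedIdeal_arrow, id_tensorHom, tensorHom_id, comp_whiskerRight, Category.assoc]
    rfl
  rw [e, Category.assoc, const_comp, Category.assoc] at h₁
  refine hom_ext fun i _ => ?_
  have h₂ := congrArg (fun φ => coeff φ i) h₁
  simp only [coeff_const_comp, coeff_zero] at h₂
  rw [← cancel_epi (toGeneratedIdeal R), coeff_const_comp, h₂, coeff_zero, comp_zero]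

/-- Expanding (id - ηε) ⊗ (id - ηε) and using the counit axioms leaves an extra term ε(f) 1 ⊗ 1,
which is zero. -/
theorem comul_eq_primitive_of_relation {A : C} [BimonObj A] {X : C} {f : X ⟶ A}
    (hf : f ≫ ε[A] = 0) :
    f ≫ Δ[A] ≫ ((𝟙 A - ε[A] ≫ η[A]) ⊗ₘ (𝟙 A - ε[A] ≫ η[A])) =
      f ≫ Δ[A] - f ≫ primitiveMap A := by
  have e₁ : f ≫ Δ[A] ≫ (ε[A] ≫ η[A]) ▷ A = f ≫ (λ_ A).inv ≫ η[A] ▷ A := by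
    rw [comp_whiskerRight, ComonObj.counit_comul_assoc]
  have e₂ : f ≫ Δ[A] ≫ A ◁ (ε[A] ≫ η[A]) = f ≫ (ρ_ A).inv ≫ A ◁ η[A] := by
    rw [MonoidalCategory.whiskerLeft_comp, ComonObj.comul_counit_assoc]
  have e₃ : f ≫ Δ[A] ≫ (ε[A] ≫ η[A]) ▷ A ≫ A ◁ (ε[A] ≫ η[A]) = 0 := by
    rw [reassoc_of% e₁, ← whisker_exchange, ← leftUnitor_inv_naturality_assoc,
      ← Category.assoc, ← Category.assoc f, hf, zero_comp, zero_comp]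
  have e₄ : ((𝟙 A - ε[A] ≫ η[A]) ⊗ₘ (𝟙 A - ε[A] ≫ η[A])) =
      𝟙 _ - (ε[A] ≫ η[A]) ▷ A - A ◁ (ε[A] ≫ η[A]) +
        (ε[A] ≫ η[A]) ▷ A ≫ A ◁ (ε[A] ≫ η[A]) := by
    have s₁ : (𝟙 A - ε[A] ≫ η[A]) ▷ A = 𝟙 _ - (ε[A] ≫ η[A]) ▷ A := by
      rw [eq_sub_iff_add_eq, ← MonoidalPreadditive.add_whiskerRight, sub_add_cancel,
        id_whiskerRight]
    have s₂ : A ◁ (𝟙 A - ε[A] ≫ η[A]) = 𝟙 _ - A ◁ (ε[A] ≫ η[A]) := by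
      rw [eq_sub_iff_add_eq, ← MonoidalPreadditive.whiskerLeft_add, sub_add_cancel,
        MonoidalCategory.whiskerLeft_id]
    rw [MonoidalCategory.tensorHom_def, s₁, s₂]
    simp only [Preadditive.sub_comp, Preadditive.comp_sub, Category.id_comp, Category.comp_id]
    abel
  rw [e₄, primitiveMap]
  simp only [Preadditive.comp_add, Preadditive.comp_sub, Category.comp_id]
  rw [e₁, e₂, e₃]
  abel

/-- For a relation of degree n, the non-primitive part of the coproduct lies in bidegrees (x, y)
with x + y = n and x, y ≥ 1. Then x, y < n, and the biideal condition applies to f and g in these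
degrees. -/
theorem relation_comul_eq (hI : IsBiideal (generatedIdeal R)) {n : ℕ} {Y Z : C}
    {f : tensorObject V ⟶ Y} {g : tensorObject V ⟶ Z}
    (hf : ∀ x < n, (generatedIdeal R).arrow ≫ tproj V x ≫ f = 0)
    (hg : ∀ x < n, (generatedIdeal R).arrow ≫ tproj V x ≫ g = 0) :
    R.arrow ≫ tproj V n ≫ tensorComul V ≫ (f ⊗ₘ g) =
      R.arrow ≫ tproj V n ≫ primitiveMap (tensorObject V) ≫ (f ⊗ₘ g) := by
  obtain ⟨r, hr⟩ := exists_comp_generatedIdeal_arrow R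
  have hε : (R.arrow ≫ tproj V n) ≫ ε[tensorObject V] = 0 := by
    cases n with
    | zero =>
      have : R.arrow ≫ tensorCounit V = 0 := by
        rw [← hr, Category.assoc]
        exact (congrArg (r ≫ ·) hI.counit).trans comp_zero
      rw [tproj_zero, ← Category.assoc, this, zero_comp, zero_comp]
    | succ n =>
      have h : tproj V (n + 1) ≫ tproj V 0 ≫ ε[tensorObject V] = tproj V (n + 1) ≫ ε := by
        rw [tproj_zero, Category.assoc]
        refine congrArg (tproj V (n + 1) ≫ ·) ?_
        exact (congrArg (tensorCounit V ≫ ·) (one_counit' V)).trans (Category.comp_id _)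
      rw [Category.assoc, ← h, ← Category.assoc (tproj V (n + 1)), tproj_comp_tproj,
        if_neg n.succ_ne_zero,
        zero_comp, comp_zero]
  have h := comul_eq_primitive_of_relation hε
  have e : ε[tensorObject V] ≫ η[tensorObject V] = tproj V 0 := (tproj_zero V).symm
  -- If x = 0 or y = 0, the factor 1 - `tproj V 0` kills the term; otherwise both degrees are below
  -- n.
  have hz : ∀ x y, x + y = n → R.arrow ≫ tensorComul V ≫
      ((tproj V x ≫ (𝟙 _ - tproj V 0) ≫ f) ⊗ₘ (tproj V y ≫ (𝟙 _ - tproj V 0) ≫ g)) = 0 := by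
    have h₀ : ∀ x {Z : C} (f : tensorObject V ⟶ Z), tproj V x ≫ (𝟙 _ - tproj V 0) ≫ f =
        if x = 0 then 0 else tproj V x ≫ f := fun x Z f => by
      rw [Preadditive.sub_comp, Preadditive.comp_sub, ← Category.assoc _ (tproj V 0),
        tproj_comp_tproj, Category.id_comp]
      split_ifs <;> simp
    intro x y hxy
    rw [h₀, h₀]
    split_ifs with hx hy
    · rw [MonoidalPreadditive.zero_tensor, comp_zero, comp_zero]
    · rw [MonoidalPreadditive.zero_tensor, comp_zero, comp_zero]
    · rw [MonoidalPreadditive.tensor_zero, comp_zero, comp_zero]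
    · rw [← hr, Category.assoc]
      exact (congrArg (r ≫ ·) (hI.comul_comp_eq_zero (hf x (by omega)) (hg y (by omega)))).trans
        comp_zero
  have h₂ : R.arrow ≫ tproj V n ≫ tensorComul V ≫
      ((𝟙 _ - tproj V 0) ⊗ₘ (𝟙 _ - tproj V 0)) ≫ (f ⊗ₘ g) = 0 := by
    rw [reassoc_of% tproj_comul V n, tensorProj, Preadditive.sum_comp, Preadditive.comp_sum,
      Preadditive.comp_sum]
    refine Finset.sum_eq_zero fun p hp => ?_
    rw [tensorHom_comp_tensorHom, tensorHom_comp_tensorHom]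
    exact hz _ _ (mem_antidiagonal.1 hp)
  rw [e] at h
  have h₃ := congrArg (· ≫ (f ⊗ₘ g)) h
  simp only [Category.assoc, Preadditive.sub_comp] at h₃
  rw [← sub_eq_zero]
  exact h₃.symm.trans h₂

theorem eq_zero_of_homPrimitivesDeg_eq_bot {X B : C} {gX : Grading X} [BimonObj B]
    {gB : Grading B} {ℓ : ℤ} (hP : homPrimitivesDeg k gX gB ℓ = ⊥) {f : X ⟶ B}
    (h : f ≫ (Δ[B] - primitiveMap B) = 0) (hf : f ∈ homDeg k gX.proj gB.proj ℓ) : f = 0 := by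
  let φ : X ⟶ (primitives B : C) := factorThruKernelSubobject _ f h
  have hφ : φ ≫ (primitives B).arrow = f := factorThruKernelSubobject_comp_arrow _ _ _
  have h₀ : φ ∈ homPrimitivesDeg k gX gB ℓ :=
    Submodule.mem_comap.2 ((congrArg (· ∈ homDeg k gX.proj gB.proj ℓ) hφ).mpr hf)
  rw [hP, Submodule.mem_bot] at h₀
  rw [← hφ, h₀, zero_comp]

/-- Strong induction on the degree n of the relation, and inside it on the power of t. The outer one
makes the image of a relation primitive, the inner one makes its leading coefficient primitive for
the undeformed structure. -/
theorem lift_relation_eq_zero (hI : IsBiideal (generatedIdeal R)) {gR : Grading (R : C)}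
    (hR : R.arrow ∈ homDeg k gR.proj (tproj V) 0) {B : C} [BimonObj B] {gB : Grading B}
    [BimonObj (⟨B⟩ : TruncSeries N C)] {L : ℤ}
    (hη : η[(⟨B⟩ : TruncSeries N C)] = const N η[B])
    (hΔ₀ : coeff Δ[(⟨B⟩ : TruncSeries N C)] 0 = Δ[B])
    (hP : ∀ i : ℕ, 1 ≤ i → (i : ℕ∞) ≤ N → homPrimitivesDeg k gR gB (-(L * i)) = ⊥)
    {Φ : (⟨tensorObject V⟩ : TruncSeries N C) ⟶ ⟨B⟩} [IsMonHom Φ]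
    (hΦΔ : Φ ≫ Δ[(⟨B⟩ : TruncSeries N C)] = Δ[(⟨tensorObject V⟩ : TruncSeries N C)] ≫ (Φ ⊗ₘ Φ))
    (hΦ : IsGraded k L (X := ⟨tensorObject V⟩) (Y := ⟨B⟩) (tproj V) gB.proj Φ)
    (hΦ₀ : R.arrow ≫ coeff Φ 0 = 0) (hT : IsDecomposition F (tproj V))
    (hRd : IsDecomposition F gR.proj) (n : ℕ) :
    const N (R.arrow ≫ tproj V n) ≫ Φ = 0 := by
  induction n using Nat.strong_induction_on with
  | _ n ih =>
  have hcomm := comm_of_mem_homDeg_zero hRd hT hR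
  have hΦI : ∀ x < n, ∀ a, (generatedIdeal R).arrow ≫ tproj V x ≫ coeff Φ a = 0 :=
    fun x hx a => by
      have h := congrArg (fun φ => coeff φ a) (generatedIdeal_comp_tproj_eq_zero ih x hx)
      simp only [coeff_const_comp, coeff_zero, Category.assoc] at h
      exact h
  set y : (⟨(R : C)⟩ : TruncSeries N C) ⟶ ⟨B⟩ := const N (R.arrow ≫ tproj V n) ≫ Φ with hy
  -- Expanding Φ ⊗ Φ into coefficients reduces the claim to `relation_comul_eq` for each pair of
  -- coefficients of Φ.
  have hyΔ : y ≫ (Δ[(⟨B⟩ : TruncSeries N C)] - primitiveMap _) = 0 := by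
    rw [Preadditive.comp_sub, sub_eq_zero, hy, Category.assoc, Category.assoc, hΦΔ,
      ← primitiveMap_tensorHom Φ (IsMonHom.one_hom Φ)]
    refine hom_ext fun i hi => ?_
    rw [coeff_const_comp, coeff_const_comp]
    have e : primitiveMap (⟨tensorObject V⟩ : TruncSeries N C) =
        const N (primitiveMap (tensorObject V)) := primitiveMap_eq_const rfl
    rw [e, tensorObject_comul]
    have h₁ := coeff_const_comp (tensorComul V) (Φ ⊗ₘ Φ) i
    have h₂ := coeff_const_comp (primitiveMap (tensorObject V)) (Φ ⊗ₘ Φ) i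
    refine (congrArg (_ ≫ ·) h₁).trans (Eq.trans ?_ (congrArg (_ ≫ ·) h₂).symm)
    rw [coeff_tensorHom _ _ hi, Preadditive.comp_sum, Preadditive.comp_sum, Preadditive.comp_sum,
      Preadditive.comp_sum]
    refine Finset.sum_congr rfl fun p _ => ?_
    rw [Category.assoc, Category.assoc]
    exact relation_comul_eq hI (fun x hx => hΦI x hx _) (fun x hx => hΦI x hx _)
  have hyi : ∀ i, coeff y i = (R.arrow ≫ tproj V n) ≫ coeff Φ i := fun i => coeff_const_comp _ _ _
  refine hom_ext fun i hi => ?_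
  rw [coeff_zero]
  induction i using Nat.strong_induction_on with
  | _ i ihi =>
  rcases Nat.eq_zero_or_pos i with rfl | hpos
  · rw [hyi, ← hcomm, Category.assoc, hΦ₀, comp_zero]
  -- Since the lower coefficients of y vanish, the coefficient of tⁱ only involves Δ_t at t = 0.
  · have h := congrArg (fun φ => coeff φ i) hyΔ
    simp only [coeff_zero] at h
    rw [coeff_comp _ _ hi, Finset.sum_eq_single_of_mem (i, 0) (by simp)] at h
    · have e : coeff (Δ[(⟨B⟩ : TruncSeries N C)] - primitiveMap _) 0 =
          Δ[B] - primitiveMap B := by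
        rw [coeff_sub, hΔ₀, primitiveMap_eq_const hη]
        rfl
      have h₁ : coeff y i ≫ (Δ[B] - primitiveMap B) = 0 := e ▸ h
      have h₂ : coeff y i ∈ homDeg k gR.proj gB.proj (-(L * i)) := by
        rw [hyi]
        refine comp_mem_homDeg hT (a := 0) ?_ (hΦ i) (zero_add _).symm
        exact comp_mem_homDeg hT hR (mem_homDeg_zero_of_comm hT fun m => by
          rw [tproj_comp_tproj, tproj_comp_tproj]
          by_cases h : m = n
          · rw [if_pos h, if_pos h.symm, h]
          · rw [if_neg h, if_neg (Ne.symm h)]) (zero_add _).symm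
      exact eq_zero_of_homPrimitivesDeg_eq_bot (hP i hpos hi) h₁ h₂
    · rintro ⟨a, b⟩ hab hne
      rw [mem_antidiagonal] at hab
      have ha : a < i := by
        rcases Nat.eq_zero_or_pos b with rfl | hb
        · exact absurd (by ext <;> simp at hab ⊢; omega) hne
        · simp only at hab; omega
      rw [ihi a ha (le_of_le hi ha.le), zero_comp]

end Relations

end Ideal

/-! ### Trivializing a deformation -/

section Trivialization

open TruncSeries

variable {k : Type u} [Field k] {C : Type u₁} [Category.{v₁} C] [Abelian C] [Linear k C]
  [MonoidalCategory C] [MonoidalPreadditive C] [BraidedCategory C]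
  {F : C ⥤ ModuleCat.{u} k} {N : ℕ∞}

/-- Tensor products of surjections of vector spaces are surjective, and the faithful functor F
reflects epimorphisms. -/
theorem epi_tensorHom (F : C ⥤ ModuleCat.{u} k) [F.Faithful] [F.Monoidal]
    [PreservesFiniteColimits F] {X Y X' Y' : C} (f : X ⟶ Y) (g : X' ⟶ Y') [Epi f] [Epi g] :
    Epi (f ⊗ₘ g) := by
  refine F.epi_of_epi_map ?_
  have : Epi (F.map f ⊗ₘ F.map g) := by
    rw [ModuleCat.epi_iff_surjective]
    exact TensorProduct.map_surjective
      ((ModuleCat.epi_iff_surjective _).1 inferInstance)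
      ((ModuleCat.epi_iff_surjective _).1 inferInstance)
  rw [Functor.Monoidal.map_tensor]
  infer_instance

theorem const_cancel_epi {X Y : C} (f : X ⟶ Y) [Epi f] {Z : TruncSeries N C}
    {g h : (⟨Y⟩ : TruncSeries N C) ⟶ Z} (e : const N f ≫ g = const N f ≫ h) : g = h :=
  hom_ext fun i _ => by
    have := congrArg (fun φ => coeff φ i) e
    simp only [coeff_const_comp] at this
    exact (cancel_epi f).1 this

variable [HasColimitsOfShape (Discrete ℕ) C]
  [∀ X : C, PreservesColimitsOfShape (Discrete ℕ) (tensorLeft X)]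
  [∀ X : C, PreservesColimitsOfShape (Discrete ℕ) (tensorRight X)]
  {V : C} {R : Subobject (tensorObject V)} {B : C} [BimonObj B]

/-- Reduction modulo t of an algebra morphism is an algebra morphism, so it is enough to compare
with π on V. -/
theorem coeff_lift_generatorLift_zero {π : tensorObject V ⟶ B} [IsBimonHom π]
    [BimonObj (⟨B⟩ : TruncSeries N C)] (hμ₀ : coeff μ[(⟨B⟩ : TruncSeries N C)] 0 = μ[B])
    (hη : η[(⟨B⟩ : TruncSeries N C)] = const N η[B])
    (hε₀ : coeff ε[(⟨B⟩ : TruncSeries N C)] 0 = ε[B]) :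
    coeff (TruncSeries.lift (N := N) (generatorLift π)) 0 = π := by
  have : IsMonHom (coeff (TruncSeries.lift (N := N) (generatorLift π)) 0) :=
    { one_hom := by
        have h := congrArg (fun φ => coeff φ 0)
          (IsMonHom.one_hom (TruncSeries.lift (N := N) (generatorLift π)))
        simp only [coeff_comp_zero, hη] at h
        exact h
      mul_hom := by
        have h := congrArg (fun φ => coeff φ 0)
          (IsMonHom.mul_hom (TruncSeries.lift (N := N) (generatorLift π)))
        simp only [coeff_comp_zero, hμ₀, coeff_tensorHom_zero] at h
        exact h }
  refine mon_hom_ext ?_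
  have h := congrArg (fun φ => coeff φ 0) (const_gen_lift (N := N) (generatorLift π))
  simp only [coeff_const_comp] at h
  exact h.trans (coeff_generatorLift_zero hε₀)

/-- The lift Φ of π kills the ideal of relations and descends to ψ. Each property of ψ follows from
that of Φ by cancelling π or π ⊗ π. -/
theorem exists_trivialization [F.Additive] [F.Faithful] [F.Monoidal]
    [PreservesFiniteColimits F] [PreservesColimitsOfShape (Discrete ℕ) F]
    (hI : IsBiideal (generatedIdeal R)) {gR : Grading (R : C)}
    (hR : R.arrow ∈ homDeg k gR.proj (tproj V) 0) {gB : Grading B}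
    {π : tensorObject V ⟶ B} [IsBimonHom π] [Epi π] (hker : kernelSubobject π = generatedIdeal R)
    (hπ : π ∈ homDeg k (tproj V) gB.proj 0) [BimonObj (⟨B⟩ : TruncSeries N C)]
    {L : ℤ} (hL : 1 ≤ L)
    (hP : ∀ i : ℕ, 1 ≤ i → (i : ℕ∞) ≤ N → homPrimitivesDeg k gR gB (-(L * i)) = ⊥)
    (hμ₀ : coeff μ[(⟨B⟩ : TruncSeries N C)] 0 = μ[B])
    (hη : η[(⟨B⟩ : TruncSeries N C)] = const N η[B])
    (hΔ₀ : coeff Δ[(⟨B⟩ : TruncSeries N C)] 0 = Δ[B])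
    (hε₀ : coeff ε[(⟨B⟩ : TruncSeries N C)] 0 = ε[B])
    (hμ : IsGraded k L (X := ⟨B⟩ ⊗ ⟨B⟩) (Y := ⟨B⟩) (tensorProj gB.proj gB.proj) gB.proj
      μ[(⟨B⟩ : TruncSeries N C)])
    (hΔ : IsGraded k L (X := ⟨B⟩) (Y := ⟨B⟩ ⊗ ⟨B⟩) gB.proj (tensorProj gB.proj gB.proj)
      Δ[(⟨B⟩ : TruncSeries N C)])
    (hε : IsGraded k L (X := ⟨B⟩) (Y := 𝟙_ _) gB.proj (unitProj C)
      ε[(⟨B⟩ : TruncSeries N C)]) :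
    ∃ ψ : (⟨B⟩ : TruncSeries N C) ⟶ ⟨B⟩, coeff ψ 0 = 𝟙 B ∧
      IsGraded k L (X := ⟨B⟩) (Y := ⟨B⟩) gB.proj gB.proj ψ ∧
      const N μ[B] ≫ ψ = (ψ ⊗ₘ ψ) ≫ μ[(⟨B⟩ : TruncSeries N C)] ∧
      const N η[B] ≫ ψ = η[(⟨B⟩ : TruncSeries N C)] ∧
      ψ ≫ Δ[(⟨B⟩ : TruncSeries N C)] = const N Δ[B] ≫ (ψ ⊗ₘ ψ) ∧
      ψ ≫ ε[(⟨B⟩ : TruncSeries N C)] = const N ε[B] := by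
  have hB : IsDecomposition F gB.proj := gB.isDecomposition
  have hT : IsDecomposition F (tproj V) := isDecomposition_tproj F V
  have hRd : IsDecomposition F gR.proj := gR.isDecomposition
  have hη' : IsGraded k L (X := 𝟙_ _) (Y := ⟨B⟩) (unitProj C) gB.proj
      η[(⟨B⟩ : TruncSeries N C)] :=
    hη ▸ isGraded_const (one_mem_homDeg hB (proj_zero_of_quotient hB hπ))
  obtain ⟨Φ, hΦ⟩ : ∃ Φ, Φ = TruncSeries.lift (N := N) (generatorLift π) := ⟨_, rfl⟩
  have hΦm : IsMonHom Φ := hΦ ▸ TruncSeries.lift_isMonHom _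
  have hΦΔ : Φ ≫ Δ[(⟨B⟩ : TruncSeries N C)] =
      Δ[(⟨tensorObject V⟩ : TruncSeries N C)] ≫ (Φ ⊗ₘ Φ) :=
    hΦ ▸ lift_comul (generatorLift_comul hB hL hπ hη hε₀ hΔ₀ hε hΔ)
  have hΦε : Φ ≫ ε[(⟨B⟩ : TruncSeries N C)] = ε[(⟨tensorObject V⟩ : TruncSeries N C)] :=
    hΦ ▸ lift_counit (generatorLift_counit π)
  have hΦg : IsGraded k L (X := ⟨tensorObject V⟩) (Y := ⟨B⟩) (tproj V) gB.proj Φ :=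
    hΦ ▸ isGraded_lift hB hμ hη' (isGraded_generatorLift hB hπ hη' hε)
  have hΦ₀ : coeff Φ 0 = π := hΦ ▸ coeff_lift_generatorLift_zero hμ₀ hη hε₀
  have hιπ : (generatedIdeal R).arrow ≫ π = 0 := by
    -- A general S avoids rewriting an equality of subobjects inside the type of an arrow.
    have : ∀ S, S = kernelSubobject π → S.arrow ≫ π = 0 := by
      rintro _ rfl
      exact kernelSubobject_arrow_comp π
    exact this _ hker.symm
  obtain ⟨r, hr⟩ := exists_comp_generatedIdeal_arrow R
  have hΦR := lift_relation_eq_zero hI hR hη hΔ₀ hP hΦΔ hΦg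
    (by rw [hΦ₀, ← hr, Category.assoc, hιπ, comp_zero]) hT hRd
  -- Degree by degree: the component of degree n of the ideal is reached with the strict bound n +
  -- 1.
  have hΦI : ∀ i, (generatedIdeal R).arrow ≫ coeff Φ i = 0 := fun i =>
    hT.comp_eq_zero fun n => by
      have h := congrArg (fun φ => coeff φ i)
        (generatedIdeal_comp_tproj_eq_zero (n := n + 1) (fun w _ => hΦR w) n n.lt_succ_self)
      simp only [coeff_const_comp, coeff_zero, Category.assoc] at h
      exact h
  have hΦk : ∀ i, kernel.ι π ≫ coeff Φ i = 0 := fun i => by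
    have : ∀ S, S = generatedIdeal R → S.arrow ≫ coeff Φ i = 0 := by
      rintro _ rfl
      exact hΦI i
    have h := this _ hker
    rw [← kernelSubobject_arrow, Category.assoc] at h
    exact (cancel_epi (kernelSubobjectIso π).hom).1 (h.trans comp_zero.symm)
  let ψ : (⟨B⟩ : TruncSeries N C) ⟶ ⟨B⟩ :=
    ofCoeffs (fun i => Abelian.epiDesc π (coeff Φ i) (hΦk i)) fun i hi => by
      rw [← cancel_epi π, Abelian.comp_epiDesc, coeff_eq_zero _ hi, comp_zero]
  have hψi : ∀ i, π ≫ coeff ψ i = coeff Φ i := fun i => Abelian.comp_epiDesc _ _ _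
  have hψ : const N π ≫ ψ = Φ := hom_ext fun i _ => by rw [coeff_const_comp, hψi]
  have hψψ : const N (π ⊗ₘ π) ≫ (ψ ⊗ₘ ψ) = (Φ ⊗ₘ Φ : (_ : TruncSeries N C) ⟶ _) := by
    rw [const_tensorHom]
    exact (tensorHom_comp_tensorHom _ _ _ _).trans (by rw [hψ])
  have hΦμ : const N (tensorMul V) ≫ Φ = (Φ ⊗ₘ Φ) ≫ μ := IsMonHom.mul_hom Φ
  have hΦη : const N (tensorOne V) ≫ Φ = η := IsMonHom.one_hom Φ
  have hπμ : (π ⊗ₘ π) ≫ μ[B] = tensorMul V ≫ π := (IsMonHom.mul_hom π).symm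
  have hπΔ : π ≫ Δ[B] = tensorComul V ≫ (π ⊗ₘ π) := IsComonHom.hom_comul π
  have := epi_tensorHom F π π
  refine ⟨ψ, ?_, ?_, ?_, ?_, ?_, ?_⟩
  · rw [← cancel_epi π, hψi, hΦ₀, Category.comp_id]
  · intro i m n hmn
    rw [← cancel_epi π, comp_zero, ← Category.assoc, ← comm_of_mem_homDeg_zero hT hB hπ,
      Category.assoc, ← Category.assoc π, hψi]
    exact hΦg i m n hmn
  · refine const_cancel_epi (π ⊗ₘ π) ?_
    rw [← Category.assoc, ← const_comp, hπμ, const_comp, Category.assoc, hψ, hΦμ, ← hψψ,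
      Category.assoc]
  · rw [← quotient_one π, const_comp, Category.assoc, hψ, hΦη]
  · refine const_cancel_epi π ?_
    rw [← Category.assoc, hψ, hΦΔ, ← Category.assoc, ← const_comp, hπΔ, const_comp,
      Category.assoc, hψψ]
    rfl
  · refine const_cancel_epi π ?_
    rw [← Category.assoc, hψ, hΦε, ← const_comp, quotient_counit]
    rfl

end Trivialization

/-! ### Rigidity -/

section OfSeries

variable {C : Type u₁} [Category.{v₁} C] [Preadditive C]

/-- A sequence of morphisms as a morphism of power series. -/
def ofSeries {X Y : C} (f : Series X Y) : (⟨X⟩ : TruncSeries ⊤ C) ⟶ ⟨Y⟩ :=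
  TruncSeries.ofCoeffs f fun _ h => absurd le_top h

theorem ofSeries_injective {X Y : C} : Function.Injective (ofSeries (X := X) (Y := Y)) :=
  fun _ _ h => congrArg TruncSeries.coeff h

theorem ofSeries_comp {X Y Z : C} (f : Series X Y) (g : Series Y Z) :
    ofSeries (f.comp g) = ofSeries f ≫ ofSeries g :=
  TruncSeries.hom_ext fun _ h => (TruncSeries.coeff_comp (ofSeries f) (ofSeries g) h).symm

theorem ofSeries_tensor [MonoidalCategory C] [MonoidalPreadditive C] {X Y X' Y' : C}
    (f : Series X Y) (g : Series X' Y') :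
    ofSeries (f.tensor g) = (ofSeries f ⊗ₘ ofSeries g) :=
  TruncSeries.hom_ext fun _ h => (TruncSeries.coeff_tensorHom (ofSeries f) (ofSeries g) h).symm

theorem Series.exists_left_inverse {X : C} (f : Series X X) (hf : f 0 = 𝟙 X) :
    ∃ g : Series X X, g 0 = 𝟙 X ∧ g.comp f = Series.const (𝟙 X) := by
  -- The coefficient of tⁿ in the equation g f = 1 is solved for gₙ, which is possible since f₀ = 1.
  let step : ∀ n, (∀ m < n, (X ⟶ X)) → (X ⟶ X) := fun n g =>
    if n = 0 then 𝟙 X else -∑ i : Fin n, g i i.2 ≫ f (n - i)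
  let g : Series X X := Nat.strongRec step
  have hg : ∀ n, g n = if n = 0 then 𝟙 X else -∑ i : Fin n, g i ≫ f (n - i) := fun n =>
    Nat.strongRec_eq step n
  have hg₀ : g 0 = 𝟙 X := by rw [hg, if_pos rfl]
  refine ⟨g, hg₀, funext fun n => ?_⟩
  rw [Series.comp, Series.const,
    Finset.Nat.sum_antidiagonal_eq_sum_range_succ fun i j => g i ≫ f j, Finset.sum_range_succ,
    Nat.sub_self, hf, Category.comp_id, hg n, ← Fin.sum_univ_eq_sum_range fun i => g i ≫ f (n - i)]
  split_ifs with h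
  · subst h; simp
  · simp

theorem Series.IsGraded.left_inverse {k : Type u} [Field k] [Linear k C]
    {F : C ⥤ ModuleCat.{u} k} [F.Additive] [F.Faithful] {X : C} {p : ℕ → (X ⟶ X)}
    (hp : IsDecomposition F p) {f g : Series X X} (hf : f.IsGraded k p p) (hf₀ : f 0 = 𝟙 X)
    (h : g.comp f = Series.const (𝟙 X)) : g.IsGraded k p p := by
  intro n
  induction n using Nat.strong_induction_on with
  | _ n ih =>
    have e := congrFun h n
    rw [Series.comp, Series.const,
      Finset.Nat.sum_antidiagonal_eq_sum_range_succ fun i j => g i ≫ f j, Finset.sum_range_succ,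
      Nat.sub_self, hf₀, Category.comp_id] at e
    rw [eq_sub_of_add_eq' e]
    refine sub_mem ?_ (sum_mem fun i hi => ?_)
    · split_ifs with h₀
      · subst h₀; simpa using id_mem_homDeg hp
      · exact zero_mem _
    · rw [Finset.mem_range] at hi
      refine comp_mem_homDeg hp (ih i hi) (hf (n - i)) ?_
      rw [Nat.cast_sub hi.le]
      ring

theorem TruncSeries.exists_inverse {X : C} (f : (⟨X⟩ : TruncSeries ⊤ C) ⟶ ⟨X⟩)
    (hf : TruncSeries.coeff f 0 = 𝟙 X) :
    ∃ g : (⟨X⟩ : TruncSeries ⊤ C) ⟶ ⟨X⟩, g ≫ f = 𝟙 _ ∧ f ≫ g = 𝟙 _ := by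
  obtain ⟨g, hg₀, hg⟩ := Series.exists_left_inverse (TruncSeries.coeff f) hf
  obtain ⟨f', -, hf'⟩ := Series.exists_left_inverse g hg₀
  have h : ofSeries g ≫ f = 𝟙 _ := by
    have := congrArg ofSeries hg
    rwa [ofSeries_comp] at this
  have h' : ofSeries f' ≫ ofSeries g = 𝟙 _ := by
    have := congrArg ofSeries hf'
    rwa [ofSeries_comp] at this
  -- A left inverse f' of g coincides with the right inverse f of g, so g is a two-sided inverse.
  have e : ofSeries f' = f := by
    rw [← Category.comp_id (ofSeries f'), ← h, ← Category.assoc, h', Category.id_comp]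
  exact ⟨ofSeries g, h, e ▸ h'⟩

variable [MonoidalCategory C] [MonoidalPreadditive C] [BraidedCategory C] {B : C}

/-- A deformation of `B` is a bialgebra over the power series. -/
@[reducible] def DeformationData.IsBialgebra.bimonObj {D : DeformationData B}
    (hD : D.IsBialgebra) : BimonObj (⟨B⟩ : TruncSeries ⊤ C) where
  one := ofSeries D.one
  mul := ofSeries D.mul
  counit := ofSeries D.counit
  comul := ofSeries D.comul
  one_mul := by
    have h := congrArg ofSeries hD.one_mul
    rw [ofSeries_comp, ofSeries_tensor] at h
    rw [← tensorHom_id]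
    exact h
  mul_one := by
    have h := congrArg ofSeries hD.mul_one
    rw [ofSeries_comp, ofSeries_tensor] at h
    rw [← id_tensorHom]
    exact h
  mul_assoc := by
    have h := congrArg ofSeries hD.mul_assoc
    rw [ofSeries_comp, ofSeries_comp, ofSeries_comp, ofSeries_tensor, ofSeries_tensor] at h
    rw [← id_tensorHom, ← tensorHom_id]
    exact h
  counit_comul := by
    have h := congrArg ofSeries hD.counit_comul
    rw [ofSeries_comp, ofSeries_tensor] at h
    rw [← tensorHom_id]
    exact h
  comul_counit := by
    have h := congrArg ofSeries hD.comul_counit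
    rw [ofSeries_comp, ofSeries_tensor] at h
    rw [← id_tensorHom]
    exact h
  comul_assoc := by
    have h := congrArg ofSeries hD.comul_assoc
    rw [ofSeries_comp, ofSeries_comp, ofSeries_comp, ofSeries_tensor, ofSeries_tensor,
      Category.assoc] at h
    rw [← id_tensorHom, ← tensorHom_id]
    exact h
  mul_comul := by
    have h := congrArg ofSeries hD.mul_comul
    rw [ofSeries_comp, ofSeries_comp, ofSeries_comp, ofSeries_tensor, ofSeries_tensor] at h
    rw [TruncSeries.tensorμ_eq]
    exact h
  one_comul := by
    have h := congrArg ofSeries hD.one_comul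
    rw [ofSeries_comp, ofSeries_comp, ofSeries_tensor] at h
    exact h
  mul_counit := by
    have h := congrArg ofSeries hD.mul_counit
    rw [ofSeries_comp, ofSeries_comp, ofSeries_tensor] at h
    exact h
  one_counit := by
    have h := congrArg ofSeries hD.one_counit
    rw [ofSeries_comp] at h
    exact h

end OfSeries

/-! ### Uniqueness of units and counits -/

section Uniqueness

variable {C : Type u₁} [Category.{v₁} C] [MonoidalCategory C] {A : C}

/-- Evaluate the left unit law at the unit: e = e · 1 = 1. The statement for counits is dual. -/
theorem eq_one_of_one_mul [MonObj A] {e : 𝟙_ C ⟶ A}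
    (h : (e ⊗ₘ 𝟙 A) ≫ μ[A] = (λ_ A).hom) : e = η[A] := by
  have h₁ : (e ⊗ₘ 𝟙 A) = (ρ_ _).inv ▷ A ≫ ((e ▷ 𝟙_ C) ≫ (ρ_ _).hom) ▷ A := by
    simp
  have h₂ := congrArg (fun φ => (ρ_ (𝟙_ C)).inv ≫ 𝟙_ C ◁ η[A] ≫ φ) h
  simp only [tensorHom_id, whisker_exchange_assoc, MonObj.mul_one, rightUnitor_naturality,
    Iso.inv_hom_id_assoc, leftUnitor_naturality, unitors_equal] at h₂
  simpa [← unitors_inv_equal] using h₂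

theorem eq_counit_of_counit_comul [ComonObj A] {e : A ⟶ 𝟙_ C}
    (h : Δ[A] ≫ (e ⊗ₘ 𝟙 A) = (λ_ A).inv) : e = ε[A] := by
  have h₂ := congrArg (fun φ => φ ≫ 𝟙_ C ◁ ε[A] ≫ (ρ_ (𝟙_ C)).hom) h
  simp only [tensorHom_id, Category.assoc, ← whisker_exchange_assoc, ComonObj.comul_counit_assoc,
    rightUnitor_naturality, ← leftUnitor_inv_naturality_assoc] at h₂
  simpa [unitors_inv_equal] using h₂

end Uniqueness

/-! ### From trivializations to rigidity -/

section Rigid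

open TruncSeries

variable {k : Type u} [Field k] {C : Type u₁} [Category.{v₁} C] [Abelian C] [Linear k C]
  [MonoidalCategory C] [MonoidalPreadditive C] [BraidedCategory C]
  {F : C ⥤ ModuleCat.{u} k}

theorem eq_zero_of_mem_homDeg_neg [F.Additive] [F.Faithful] {X Y : C} {q : ℕ → (Y ⟶ Y)}
    (hq : IsDecomposition F q) {ℓ : ℤ} (hℓ : ℓ < 0) {f : X ⟶ Y}
    (hf : f ∈ homDeg k (fun n => if n = 0 then 𝟙 X else 0) q ℓ) : f = 0 :=
  hq.hom_ext_right fun n => by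
    have h := hf 0 n (by omega)
    simp only [if_true, Category.id_comp] at h
    rw [h, zero_comp]

/-- At t = 0 the unit is determined by the multiplication. The higher coefficients would map the
unit object, of degree 0, to negative degrees. -/
theorem IsGradedDeformation.one_eq [F.Additive] [F.Faithful] {B : C} [BimonObj B] {gB : Grading B}
    (hB : IsDecomposition F gB.proj) {D : DeformationData B} (hD : IsGradedDeformation k gB D) :
    D.one = Series.const η[B] := by
  funext n
  rw [Series.const]
  split_ifs with h
  · subst h
    refine eq_one_of_one_mul ?_
    have h := congrFun hD.isBialgebra.one_mul 0
    simpa [Series.comp, Series.tensor, Series.const, hD.mul_zero] using h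
  · exact eq_zero_of_mem_homDeg_neg hB (by omega) (hD.one_graded n)

theorem IsGradedDeformation.counit_zero {B : C} [BimonObj B] {gB : Grading B}
    {D : DeformationData B} (hD : IsGradedDeformation k gB D) : D.counit 0 = ε[B] := by
  refine eq_counit_of_counit_comul ?_
  have h := congrFun hD.isBialgebra.counit_comul 0
  simpa [Series.comp, Series.tensor, Series.const, hD.comul_zero] using h

variable [HasColimitsOfShape (Discrete ℕ) C]
  [∀ X : C, PreservesColimitsOfShape (Discrete ℕ) (tensorLeft X)]
  [∀ X : C, PreservesColimitsOfShape (Discrete ℕ) (tensorRight X)]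
  {V : C} {R : Subobject (tensorObject V)} {B : C} [BimonObj B]

/-- The trivialization ψ goes from the trivial deformation to D, so the equivalence is given by its
inverse φ. -/
theorem isRigid_of_homPrimitivesDeg_eq_bot [F.Additive] [F.Faithful] [F.Monoidal]
    [PreservesFiniteColimits F] [PreservesColimitsOfShape (Discrete ℕ) F]
    (hI : IsBiideal (generatedIdeal R)) {gR : Grading (R : C)}
    (hR : R.arrow ∈ homDeg k gR.proj (tproj V) 0) {gB : Grading B}
    {π : tensorObject V ⟶ B} [IsBimonHom π] [Epi π] (hker : kernelSubobject π = generatedIdeal R)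
    (hπ : π ∈ homDeg k (tproj V) gB.proj 0)
    (hP : ∀ ℓ : ℤ, ℓ < 0 → homPrimitivesDeg k gR gB ℓ = ⊥) : IsRigid k gB := by
  intro D hD
  have hB : IsDecomposition F gB.proj := gB.isDecomposition
  let _ := hD.isBialgebra.bimonObj
  have hgr : ∀ {X Y : C} {p : ℕ → (X ⟶ X)} {q : ℕ → (Y ⟶ Y)} {f : Series X Y},
      f.IsGraded k p q → TruncSeries.IsGraded k 1 (X := ⟨X⟩) (Y := ⟨Y⟩) p q (ofSeries f) :=
    fun h i => by rw [_root_.one_mul]; exact h i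
  obtain ⟨ψ, hψ₀, hψg, hψμ, hψη, hψΔ, hψε⟩ := exists_trivialization (N := ⊤) (L := 1)
    (F := F) hI hR hker hπ le_rfl (fun i hi _ => hP _ (by omega)) hD.mul_zero
    (congrArg ofSeries (hD.one_eq hB)) hD.comul_zero hD.counit_zero (hgr hD.mul_graded)
    (hgr hD.comul_graded) (hgr hD.counit_graded)
  obtain ⟨φ, hφψ, hψφ⟩ := TruncSeries.exists_inverse ψ hψ₀
  have hψg' : Series.IsGraded k gB.proj gB.proj (coeff ψ) := fun i => by
    have := hψg i
    rwa [_root_.one_mul] at this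
  have hφψ' : Series.comp (coeff φ) (coeff ψ) = Series.const (𝟙 B) :=
    ofSeries_injective ((ofSeries_comp _ _).trans hφψ)
  have e : (φ ⊗ₘ φ) ≫ (ψ ⊗ₘ ψ) = 𝟙 ((⟨B⟩ : TruncSeries ⊤ C) ⊗ ⟨B⟩) := by
    rw [tensorHom_comp_tensorHom, hφψ, id_tensorHom_id]
  have e' : (ψ ⊗ₘ ψ) ≫ (φ ⊗ₘ φ) = 𝟙 ((⟨B⟩ : TruncSeries ⊤ C) ⊗ ⟨B⟩) := by
    rw [tensorHom_comp_tensorHom, hψφ, id_tensorHom_id]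
  refine ⟨coeff φ, coeff ψ, hψg'.left_inverse hB hψ₀ hφψ', hψg', hφψ', ?_, ?_, ?_, ?_, ?_⟩
  · exact ofSeries_injective ((ofSeries_comp _ _).trans hψφ)
  · refine ofSeries_injective ?_
    rw [ofSeries_comp, ofSeries_comp, ofSeries_tensor]
    change μ[(⟨B⟩ : TruncSeries ⊤ C)] ≫ φ = (φ ⊗ₘ φ) ≫ const ⊤ μ[B]
    -- Multiplicativity of φ is that of ψ conjugated by the inverse series.
    have h : (φ ⊗ₘ φ) ≫ const ⊤ μ[B] ≫ ψ = μ[(⟨B⟩ : TruncSeries ⊤ C)] := by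
      rw [hψμ]
      exact (Category.assoc _ _ _).symm.trans (by rw [e, Category.id_comp])
    rw [← h, Category.assoc, Category.assoc, hψφ, Category.comp_id]
  · refine ofSeries_injective ?_
    rw [ofSeries_comp]
    change η[(⟨B⟩ : TruncSeries ⊤ C)] ≫ φ = const ⊤ η[B]
    rw [← hψη, Category.assoc, hψφ, Category.comp_id]
  · refine ofSeries_injective ?_
    rw [ofSeries_comp, ofSeries_comp, ofSeries_tensor]
    change φ ≫ const ⊤ Δ[B] = Δ[(⟨B⟩ : TruncSeries ⊤ C)] ≫ (φ ⊗ₘ φ)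
    have h : Δ[(⟨B⟩ : TruncSeries ⊤ C)] = φ ≫ const ⊤ Δ[B] ≫ (ψ ⊗ₘ ψ) := by
      rw [← hψΔ, ← Category.assoc, hφψ, Category.id_comp]
    rw [h, Category.assoc, Category.assoc]
    exact congrArg (φ ≫ ·) ((Category.comp_id _).symm.trans (congrArg (const ⊤ Δ[B] ≫ ·) e'.symm))
  · refine ofSeries_injective ?_
    rw [ofSeries_comp]
    change φ ≫ const ⊤ ε[B] = ε[(⟨B⟩ : TruncSeries ⊤ C)]
    rw [← hψε, ← Category.assoc, hφψ, Category.id_comp]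

end Rigid

/-! ### First-order deformations -/

section FirstOrder

namespace TruncSeries

variable {C : Type u₁} [Category.{v₁} C] [Preadditive C]

theorem hom_ext_one {X Y : TruncSeries 1 C} {f g : X ⟶ Y} (h₀ : coeff f 0 = coeff g 0)
    (h₁ : coeff f 1 = coeff g 1) : f = g := hom_ext fun n hn => by
  have hn : n ≤ 1 := by exact_mod_cast hn
  interval_cases n
  · exact h₀
  · exact h₁

/-- The series `a + b t`. -/
def linear {X Y : C} (a b : X ⟶ Y) : (⟨X⟩ : TruncSeries 1 C) ⟶ ⟨Y⟩ :=
  ofCoeffs (fun n => if n = 0 then a else if n = 1 then b else 0) fun n hn => by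
    have hn : ¬ n ≤ 1 := fun h => hn (by exact_mod_cast h)
    rw [if_neg (by omega), if_neg (by omega)]

@[simp] theorem coeff_linear_zero {X Y : C} (a b : X ⟶ Y) : coeff (linear a b) 0 = a := rfl

@[simp] theorem coeff_linear_one {X Y : C} (a b : X ⟶ Y) : coeff (linear a b) 1 = b := rfl

theorem coeff_comp_one {X Y Z : TruncSeries 1 C} (f : X ⟶ Y) (g : Y ⟶ Z) :
    coeff (f ≫ g) 1 = coeff f 0 ≫ coeff g 1 + coeff f 1 ≫ coeff g 0 := by
  rw [coeff_comp f g (by simp)]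
  simp [Finset.Nat.antidiagonal_succ]

theorem coeff_tensorHom_one [MonoidalCategory C] [MonoidalPreadditive C]
    {X X' Y Y' : TruncSeries 1 C} (f : X ⟶ Y) (g : X' ⟶ Y') :
    coeff (f ⊗ₘ g) 1 = (coeff f 0 ⊗ₘ coeff g 1) + (coeff f 1 ⊗ₘ coeff g 0) := by
  rw [coeff_tensorHom f g (by simp)]
  simp [Finset.Nat.antidiagonal_succ]

end TruncSeries

theorem whiskerLeft_neg' {C : Type u₁} [Category.{v₁} C] [Preadditive C] [MonoidalCategory C]
    [MonoidalPreadditive C] (X : C) {Y Z : C} (f : Y ⟶ Z) : X ◁ (-f) = -(X ◁ f) :=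
  (tensorLeft X).map_neg

theorem neg_whiskerRight' {C : Type u₁} [Category.{v₁} C] [Preadditive C] [MonoidalCategory C]
    [MonoidalPreadditive C] {Y Z : C} (f : Y ⟶ Z) (X : C) : (-f) ▷ X = -(f ▷ X) :=
  (tensorRight X).map_neg

open TruncSeries

variable {k : Type u} [Field k] {C : Type u₁} [Category.{v₁} C] [Preadditive C] [Linear k C]
  [MonoidalCategory C] [MonoidalPreadditive C] [MonoidalLinear k C] [BraidedCategory C]
  {B : C} [BimonObj B] {f : B ⊗ B ⟶ B} {g : B ⟶ B ⊗ B}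

/-- Evaluate the Hochschild cocycle condition at (1, 1, b). Thus f(1, 1) = 0 suffices for the unit
of B to remain a left unit. -/
theorem one_whiskerRight_of_dh₂₁ (hf : dh₂₁ k B f = 0) (h₁ : (η[B] ⊗ₘ η[B]) ≫ f = 0) :
    η[B] ▷ B ≫ f = 0 := by
  have h : (α_ B B B).hom ≫ B ◁ f ≫ μ[B] - μ[B] ▷ B ≫ f + (α_ B B B).hom ≫ B ◁ μ[B] ≫ f -
    f ▷ B ≫ μ[B] = 0 := hf
  have h' := congrArg (fun φ => (λ_ (𝟙_ C)).inv ▷ B ≫ (η[B] ⊗ₘ η[B]) ▷ B ≫ φ) h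
  simp only [Preadditive.comp_sub, Preadditive.comp_add, comp_zero] at h'
  have e₁ : (λ_ (𝟙_ C)).inv ▷ B ≫ (η[B] ⊗ₘ η[B]) ▷ B ≫ f ▷ B ≫ μ[B] = 0 := by
    rw [← comp_whiskerRight_assoc (η[B] ⊗ₘ η[B]), h₁]; simp
  have e₂ : (λ_ (𝟙_ C)).inv ▷ B ≫ (η[B] ⊗ₘ η[B]) ▷ B ≫ μ[B] ▷ B ≫ f = η[B] ▷ B ≫ f := by
    rw [← comp_whiskerRight_assoc (η[B] ⊗ₘ η[B]), one_mul_hom, ← comp_whiskerRight_assoc,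
      Iso.inv_hom_id_assoc]
  have e₃ : (λ_ (𝟙_ C)).inv ▷ B ≫ (η[B] ⊗ₘ η[B]) ▷ B ≫ (α_ B B B).hom ≫ B ◁ f ≫ μ[B] =
      η[B] ▷ B ≫ f := by
    rw [tensorHom_def', comp_whiskerRight_assoc, associator_naturality_left_assoc,
      ← whisker_exchange_assoc, MonObj.one_mul]
    simp [-IsMonHom.one_hom, -IsMonHom.one_hom_assoc]
  have e₄ : (λ_ (𝟙_ C)).inv ▷ B ≫ (η[B] ⊗ₘ η[B]) ▷ B ≫ (α_ B B B).hom ≫ B ◁ μ[B] ≫ f =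
      η[B] ▷ B ≫ f := by
    rw [MonoidalCategory.tensorHom_def, comp_whiskerRight_assoc,
      associator_naturality_middle_assoc, ← whiskerLeft_comp_assoc, MonObj.one_mul]
    simp [-IsMonHom.one_hom, -IsMonHom.one_hom_assoc]
  rw [e₁, e₂, e₃, e₄] at h'
  simpa using h'

/-- Evaluate the cocycle condition at (b, 1, 1). -/
theorem whiskerLeft_one_of_dh₂₁ (hf : dh₂₁ k B f = 0) (h₁ : (η[B] ⊗ₘ η[B]) ≫ f = 0) :
    B ◁ η[B] ≫ f = 0 := by
  have h : (α_ B B B).hom ≫ B ◁ f ≫ μ[B] - μ[B] ▷ B ≫ f + (α_ B B B).hom ≫ B ◁ μ[B] ≫ f -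
    f ▷ B ≫ μ[B] = 0 := hf
  have h' := congrArg (fun φ => B ◁ (λ_ (𝟙_ C)).inv ≫ B ◁ (η[B] ⊗ₘ η[B]) ≫
    (α_ B B B).inv ≫ φ) h
  simp only [Preadditive.comp_sub, Preadditive.comp_add, comp_zero, Iso.inv_hom_id_assoc] at h'
  have e₁ : B ◁ (λ_ (𝟙_ C)).inv ≫ B ◁ (η[B] ⊗ₘ η[B]) ≫ B ◁ f ≫ μ[B] = 0 := by
    rw [← whiskerLeft_comp_assoc _ (η[B] ⊗ₘ η[B]), h₁]; simp
  have e₂ : B ◁ (λ_ (𝟙_ C)).inv ≫ B ◁ (η[B] ⊗ₘ η[B]) ≫ B ◁ μ[B] ≫ f = B ◁ η[B] ≫ f := by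
    rw [← whiskerLeft_comp_assoc _ (η[B] ⊗ₘ η[B]), one_mul_hom, ← whiskerLeft_comp_assoc,
      Iso.inv_hom_id_assoc]
  have e₃ : B ◁ (λ_ (𝟙_ C)).inv ≫ B ◁ (η[B] ⊗ₘ η[B]) ≫ (α_ B B B).inv ≫ f ▷ B ≫ μ[B] =
      B ◁ η[B] ≫ f := by
    rw [MonoidalCategory.tensorHom_def, whiskerLeft_comp_assoc,
      associator_inv_naturality_right_assoc, whisker_exchange_assoc, MonObj.mul_one]
    simp [unitors_inv_equal, -IsMonHom.one_hom, -IsMonHom.one_hom_assoc]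
  have e₄ : B ◁ (λ_ (𝟙_ C)).inv ≫ B ◁ (η[B] ⊗ₘ η[B]) ≫ (α_ B B B).inv ≫ μ[B] ▷ B ≫ f =
      B ◁ η[B] ≫ f := by
    rw [tensorHom_def', whiskerLeft_comp_assoc,
      associator_inv_naturality_middle_assoc, ← comp_whiskerRight_assoc, MonObj.mul_one]
    simp [unitors_inv_equal, -IsMonHom.one_hom, -IsMonHom.one_hom_assoc]
  rw [e₁, e₂, e₃, e₄] at h'
  simpa using h'

/-- The counit of the first-order deformation with comultiplication `Δ + g t` is `ε - γ t`. -/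
theorem counit_comul_of_dc₁₂ (hg : dc₁₂ k B g = 0) :
    Δ[B] ≫ (g ≫ (ε[B] ⊗ₘ ε[B]) ≫ (λ_ (𝟙_ C)).hom) ▷ B = g ≫ ε[B] ▷ B := by
  have h : Δ[B] ≫ B ◁ g - g ≫ Δ[B] ▷ B ≫ (α_ B B B).hom + g ≫ B ◁ Δ[B] -
    Δ[B] ≫ g ▷ B ≫ (α_ B B B).hom = 0 := hg
  -- After applying ε ⊗ ε ⊗ id, the first three terms of the cocycle condition become (ε ⊗ id) g
  -- with alternating signs, so one copy remains.
  have h' := congrArg (fun φ => φ ≫ (α_ B B B).inv ≫ (ε[B] ⊗ₘ ε[B]) ▷ B ≫ (λ_ (𝟙_ C)).hom ▷ B) h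
  simp only [Preadditive.sub_comp, Preadditive.add_comp, zero_comp, Category.assoc,
    Iso.hom_inv_id_assoc] at h'
  have e₁ : Δ[B] ≫ B ◁ g ≫ (α_ B B B).inv ≫ (ε[B] ⊗ₘ ε[B]) ▷ B ≫ (λ_ (𝟙_ C)).hom ▷ B =
      g ≫ ε[B] ▷ B := by
    rw [MonoidalCategory.tensorHom_def, comp_whiskerRight_assoc,
      ← associator_inv_naturality_left_assoc, whisker_exchange_assoc, ComonObj.counit_comul_assoc]
    simp
  have e₂ : g ≫ Δ[B] ▷ B ≫ (ε[B] ⊗ₘ ε[B]) ▷ B ≫ (λ_ (𝟙_ C)).hom ▷ B = g ≫ ε[B] ▷ B := by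
    rw [MonoidalCategory.tensorHom_def, comp_whiskerRight_assoc, ← comp_whiskerRight_assoc Δ[B],
      ComonObj.counit_comul]
    simp
  have e₃ : g ≫ B ◁ Δ[B] ≫ (α_ B B B).inv ≫ (ε[B] ⊗ₘ ε[B]) ▷ B ≫ (λ_ (𝟙_ C)).hom ▷ B =
      g ≫ ε[B] ▷ B := by
    rw [tensorHom_def', comp_whiskerRight_assoc,
      ← associator_inv_naturality_middle_assoc, ← whiskerLeft_comp_assoc, ComonObj.counit_comul]
    simp
  rw [e₁, e₂, e₃] at h'
  simp only [sub_self, zero_add, sub_eq_zero] at h'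
  simpa using h'.symm

/-- The mirror image of `counit_comul_of_dc₁₂`, obtained by applying id ⊗ ε ⊗ ε. -/
theorem comul_counit_of_dc₁₂ (hg : dc₁₂ k B g = 0) :
    Δ[B] ≫ B ◁ (g ≫ (ε[B] ⊗ₘ ε[B]) ≫ (λ_ (𝟙_ C)).hom) = g ≫ B ◁ ε[B] := by
  have h : Δ[B] ≫ B ◁ g - g ≫ Δ[B] ▷ B ≫ (α_ B B B).hom + g ≫ B ◁ Δ[B] -
    Δ[B] ≫ g ▷ B ≫ (α_ B B B).hom = 0 := hg
  have h' := congrArg (fun φ => φ ≫ B ◁ (ε[B] ⊗ₘ ε[B]) ≫ B ◁ (λ_ (𝟙_ C)).hom) h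
  simp only [Preadditive.sub_comp, Preadditive.add_comp, zero_comp, Category.assoc] at h'
  have e₁ : Δ[B] ≫ g ▷ B ≫ (α_ B B B).hom ≫ B ◁ (ε[B] ⊗ₘ ε[B]) ≫ B ◁ (λ_ (𝟙_ C)).hom =
      g ≫ B ◁ ε[B] := by
    rw [tensorHom_def', whiskerLeft_comp_assoc,
      ← associator_naturality_right_assoc, ← whisker_exchange_assoc, ComonObj.comul_counit_assoc]
    simp [unitors_equal]
  have e₂ : g ≫ B ◁ Δ[B] ≫ B ◁ (ε[B] ⊗ₘ ε[B]) ≫ B ◁ (λ_ (𝟙_ C)).hom = g ≫ B ◁ ε[B] := by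
    rw [tensorHom_def', whiskerLeft_comp_assoc, ← whiskerLeft_comp_assoc B Δ[B],
      ComonObj.comul_counit]
    simp [unitors_equal]
  have e₃ : g ≫ Δ[B] ▷ B ≫ (α_ B B B).hom ≫ B ◁ (ε[B] ⊗ₘ ε[B]) ≫ B ◁ (λ_ (𝟙_ C)).hom =
      g ≫ B ◁ ε[B] := by
    rw [MonoidalCategory.tensorHom_def, whiskerLeft_comp_assoc,
      ← associator_naturality_middle_assoc, ← comp_whiskerRight_assoc, ComonObj.comul_counit]
    simp [unitors_equal]
  rw [e₁, e₂, e₃] at h'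
  simp only [sub_add_cancel, sub_eq_zero] at h'
  simpa using h'

/-- Apply ε ⊗ ε to the mixed cocycle condition. With γ = (ε ⊗ ε) g, the result says that ε - γ t is
multiplicative for μ + f t modulo t². -/
theorem mul_counit_of_cocycle (h : dc₂₁ k B f + dh₁₂ k B g = 0) :
    μ[B] ≫ g ≫ (ε[B] ⊗ₘ ε[B]) ≫ (λ_ (𝟙_ C)).hom = f ≫ ε[B] +
      ((ε[B] ⊗ₘ (g ≫ (ε[B] ⊗ₘ ε[B]) ≫ (λ_ (𝟙_ C)).hom)) +
        ((g ≫ (ε[B] ⊗ₘ ε[B]) ≫ (λ_ (𝟙_ C)).hom) ⊗ₘ ε[B])) ≫ (λ_ (𝟙_ C)).hom := by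
  obtain ⟨e, he⟩ : ∃ e, e = (ε[B] ⊗ₘ ε[B]) ≫ (λ_ (𝟙_ C)).hom := ⟨_, rfl⟩
  have heB : ε[B ⊗ B] = e := he ▸ Comon.tensorObj_counit B B
  have hμe : μ[B] ≫ ε[B] = e := he ▸ BimonObj.mul_counit B
  have hΔe : Δ[B] ≫ e = ε[B] := by
    rw [he, tensorHom_def', Category.assoc, ComonObj.comul_counit_assoc,
      ← rightUnitor_inv_naturality_assoc]
    simp [unitors_equal]
  -- That is, ε ⊗ ε is an algebra morphism on the braided tensor square.
  have hm : tensorμ B B B B ≫ (μ[B] ⊗ₘ μ[B]) ≫ e = (e ⊗ₘ e) ≫ (λ_ (𝟙_ C)).hom := by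
    rw [he]
    have := IsMonHom.mul_hom ((ε[B] ⊗ₘ ε[B]) ≫ (λ_ (𝟙_ C)).hom)
    rw [MonObj.tensorObj.mul_def, Category.assoc] at this
    exact this
  have h' : (Δ[B] ⊗ₘ Δ[B]) ≫ tensorμ B B B B ≫ (μ[B] ⊗ₘ f) - f ≫ Δ[B] +
      (Δ[B] ⊗ₘ Δ[B]) ≫ tensorμ B B B B ≫ (f ⊗ₘ μ[B]) +
      ((Δ[B] ⊗ₘ g) ≫ tensorμ B B B B ≫ (μ[B] ⊗ₘ μ[B]) - μ[B] ≫ g +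
      (g ⊗ₘ Δ[B]) ≫ tensorμ B B B B ≫ (μ[B] ⊗ₘ μ[B])) = 0 := h
  have h'' := congrArg (fun φ => φ ≫ e) h'
  simp only [Preadditive.sub_comp, Preadditive.add_comp, zero_comp, Category.assoc, hm, hΔe] at h''
  have e₁ : (Δ[B] ⊗ₘ Δ[B]) ≫ tensorμ B B B B ≫ (μ[B] ⊗ₘ f) ≫ e = f ≫ ε[B] := by
    have : Δ[B ⊗ B] ≫ ε[B ⊗ B] ▷ (B ⊗ B) = (λ_ _).inv := ComonObj.counit_comul _
    rw [Comon.tensorObj_comul, heB] at this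
    rw [he, tensorHom_comp_tensorHom_assoc, hμe, MonoidalCategory.tensorHom_def e, Category.assoc,
      ← Category.assoc, ← Category.assoc, this]
    simp
  have e₂ : (Δ[B] ⊗ₘ Δ[B]) ≫ tensorμ B B B B ≫ (f ⊗ₘ μ[B]) ≫ e = f ≫ ε[B] := by
    have : Δ[B ⊗ B] ≫ (B ⊗ B) ◁ ε[B ⊗ B] = (ρ_ _).inv := ComonObj.comul_counit _
    rw [Comon.tensorObj_comul, heB] at this
    rw [he, tensorHom_comp_tensorHom_assoc, hμe, tensorHom_def' _ e, Category.assoc,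
      ← Category.assoc, ← Category.assoc, this]
    simp [unitors_equal]
  rw [e₁, e₂, tensorHom_comp_tensorHom_assoc, tensorHom_comp_tensorHom_assoc, hΔe] at h''
  rw [← he, Preadditive.add_comp]
  rw [← sub_eq_zero, ← neg_eq_zero, ← h'']
  abel

/-- The first-order deformation of a bialgebra `B` with multiplication `μ + f t` and
comultiplication `Δ + g t`, for a two-cocycle `(f, g)`. -/
@[reducible] def firstOrderBimonObj (k : Type u) [Field k] [Linear k C] [MonoidalLinear k C]
    (hf : dh₂₁ k B f = 0) (hfg : dc₂₁ k B f + dh₁₂ k B g = 0) (hg : dc₁₂ k B g = 0)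
    (hηf : (η[B] ⊗ₘ η[B]) ≫ f = 0) (hηg : η[B] ≫ g = 0) :
    BimonObj (⟨B⟩ : TruncSeries 1 C) where
  one := const 1 η[B]
  mul := linear μ[B] f
  counit := linear ε[B] (-(g ≫ (ε[B] ⊗ₘ ε[B]) ≫ (λ_ (𝟙_ C)).hom))
  comul := linear Δ[B] g
  one_mul := hom_ext_one ((coeff_comp_zero _ _).trans (MonObj.one_mul B)) <| by
    rw [coeff_comp_one]
    change η[B] ▷ B ≫ f + (0 : 𝟙_ C ⟶ B) ▷ B ≫ μ[B] = 0
    rw [one_whiskerRight_of_dh₂₁ hf hηf]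
    simp
  mul_one := hom_ext_one ((coeff_comp_zero _ _).trans (MonObj.mul_one B)) <| by
    rw [coeff_comp_one]
    change B ◁ η[B] ≫ f + B ◁ (0 : 𝟙_ C ⟶ B) ≫ μ[B] = 0
    rw [whiskerLeft_one_of_dh₂₁ hf hηf]
    simp
  mul_assoc := hom_ext_one (by
      simp only [coeff_comp_zero]
      exact MonObj.mul_assoc B) <| by
    rw [TruncSeries.associator_hom, coeff_const_comp, coeff_comp_one, coeff_comp_one]
    change μ[B] ▷ B ≫ f + f ▷ B ≫ μ[B] =
      (α_ B B B).hom ≫ (B ◁ μ[B] ≫ f + B ◁ f ≫ μ[B])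
    have h : (α_ B B B).hom ≫ B ◁ f ≫ μ[B] - μ[B] ▷ B ≫ f + (α_ B B B).hom ≫ B ◁ μ[B] ≫ f -
      f ▷ B ≫ μ[B] = 0 := hf
    rw [Preadditive.comp_add, eq_comm, ← sub_eq_zero, ← h]
    abel
  counit_comul := hom_ext_one ((coeff_comp_zero _ _).trans (ComonObj.counit_comul B)) <| by
    rw [coeff_comp_one]
    change Δ[B] ≫ (-(g ≫ (ε[B] ⊗ₘ ε[B]) ≫ (λ_ (𝟙_ C)).hom)) ▷ B + g ≫ ε[B] ▷ B = 0
    rw [← counit_comul_of_dc₁₂ hg, neg_whiskerRight', Preadditive.comp_neg, neg_add_cancel]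
  comul_counit := hom_ext_one ((coeff_comp_zero _ _).trans (ComonObj.comul_counit B)) <| by
    rw [coeff_comp_one]
    change Δ[B] ≫ B ◁ (-(g ≫ (ε[B] ⊗ₘ ε[B]) ≫ (λ_ (𝟙_ C)).hom)) + g ≫ B ◁ ε[B] = 0
    rw [← comul_counit_of_dc₁₂ hg, whiskerLeft_neg', Preadditive.comp_neg, neg_add_cancel]
  comul_assoc := hom_ext_one (by
      simp only [coeff_comp_zero]
      exact ComonObj.comul_assoc B) <| by
    rw [TruncSeries.associator_hom, ← Category.assoc, coeff_comp_const, coeff_comp_one,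
      coeff_comp_one]
    change Δ[B] ≫ B ◁ g + g ≫ B ◁ Δ[B] =
      (Δ[B] ≫ g ▷ B + g ≫ Δ[B] ▷ B) ≫ (α_ B B B).hom
    have h : Δ[B] ≫ B ◁ g - g ≫ Δ[B] ▷ B ≫ (α_ B B B).hom + g ≫ B ◁ Δ[B] -
      Δ[B] ≫ g ▷ B ≫ (α_ B B B).hom = 0 := hg
    rw [Preadditive.add_comp, Category.assoc, Category.assoc, ← sub_eq_zero, ← h]
    abel
  mul_comul := hom_ext_one (by
      simp only [coeff_comp_zero, coeff_tensorHom_zero, tensorμ_eq]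
      exact BimonObj.mul_comul B) <| by
    rw [tensorμ_eq, coeff_comp_one, coeff_comp_one, coeff_const_comp, coeff_const_comp,
      coeff_tensorHom_one, coeff_tensorHom_one, coeff_tensorHom_zero, coeff_tensorHom_zero]
    change μ[B] ≫ g + f ≫ Δ[B] = (Δ[B] ⊗ₘ Δ[B]) ≫ tensorμ B B B B ≫ ((μ[B] ⊗ₘ f) + (f ⊗ₘ μ[B])) +
      ((Δ[B] ⊗ₘ g) + (g ⊗ₘ Δ[B])) ≫ tensorμ B B B B ≫ (μ[B] ⊗ₘ μ[B])
    have h : (Δ[B] ⊗ₘ Δ[B]) ≫ tensorμ B B B B ≫ (μ[B] ⊗ₘ f) - f ≫ Δ[B] +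
      (Δ[B] ⊗ₘ Δ[B]) ≫ tensorμ B B B B ≫ (f ⊗ₘ μ[B]) +
      ((Δ[B] ⊗ₘ g) ≫ tensorμ B B B B ≫ (μ[B] ⊗ₘ μ[B]) - μ[B] ≫ g +
      (g ⊗ₘ Δ[B]) ≫ tensorμ B B B B ≫ (μ[B] ⊗ₘ μ[B])) = 0 := hfg
    rw [Preadditive.comp_add, Preadditive.comp_add, Preadditive.add_comp, eq_comm, ← sub_eq_zero,
      ← h]
    abel
  one_comul := hom_ext_one (by
      change coeff (const 1 η[B] ≫ linear Δ[B] g) 0 =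
        coeff ((λ_ _).inv ≫ (const 1 η[B] ⊗ₘ const 1 η[B])) 0
      simp only [coeff_comp_zero, coeff_tensorHom_zero]
      exact (BimonObj.one_comul B).trans MonObj.tensorObj.one_def) <| by
    change coeff (const 1 η[B] ≫ linear Δ[B] g) 1 =
      coeff ((λ_ _).inv ≫ (const 1 η[B] ⊗ₘ const 1 η[B])) 1
    rw [leftUnitor_inv, coeff_const_comp, coeff_const_comp,
      coeff_tensorHom_one]
    change η[B] ≫ g = (λ_ (𝟙_ C)).inv ≫ ((η[B] ⊗ₘ 0) + (0 ⊗ₘ η[B]))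
    rw [hηg]
    simp
  mul_counit := hom_ext_one (by
      change coeff (linear μ[B] f ≫ linear ε[B] _) 0 =
        coeff ((linear ε[B] _ ⊗ₘ linear ε[B] _) ≫ (λ_ _).hom) 0
      simp only [coeff_comp_zero, coeff_tensorHom_zero]
      exact (BimonObj.mul_counit B).trans (Comon.tensorObj_counit _ _)) <| by
    change coeff (linear μ[B] f ≫ linear ε[B] _) 1 =
      coeff ((linear ε[B] _ ⊗ₘ linear ε[B] _) ≫ (λ_ _).hom) 1
    rw [leftUnitor_hom, coeff_comp_const, coeff_comp_one,
      coeff_tensorHom_one]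
    obtain ⟨c, hc⟩ : ∃ c, c = g ≫ (ε[B] ⊗ₘ ε[B]) ≫ (λ_ (𝟙_ C)).hom := ⟨_, rfl⟩
    rw [← hc]
    change μ[B] ≫ (-c) + f ≫ ε[B] = ((ε[B] ⊗ₘ (-c)) + ((-c) ⊗ₘ ε[B])) ≫ (λ_ (𝟙_ C)).hom
    have h := mul_counit_of_cocycle hfg
    rw [← hc] at h
    rw [Preadditive.comp_neg, h, MonoidalCategory.tensorHom_def _ (-c), tensorHom_def' (-c)]
    simp only [whiskerLeft_neg', neg_whiskerRight', Preadditive.comp_neg, Preadditive.neg_comp,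
      Preadditive.add_comp, MonoidalCategory.tensorHom_def _ c, tensorHom_def' c]
    abel
  one_counit := hom_ext_one ((coeff_comp_zero _ _).trans (BimonObj.one_counit B)) <| by
    rw [coeff_const_comp]
    change η[B] ≫ (-(g ≫ (ε[B] ⊗ₘ ε[B]) ≫ (λ_ (𝟙_ C)).hom)) = 0
    rw [Preadditive.comp_neg, ← Category.assoc, hηg, zero_comp, neg_zero]

end FirstOrder

/-! ### Vanishing of the cohomology in negative degrees -/

section Vanishing

open TruncSeries

variable {k : Type u} [Field k] {C : Type u₁} [Category.{v₁} C] [Abelian C] [Linear k C]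
  [MonoidalCategory C] [MonoidalPreadditive C] [BraidedCategory C]
  {F : C ⥤ ModuleCat.{u} k}

theorem isGraded_linear {X Y : C} {p : ℕ → (X ⟶ X)} {q : ℕ → (Y ⟶ Y)} {ℓ : ℤ} {a b : X ⟶ Y}
    (ha : a ∈ homDeg k p q 0) (hb : b ∈ homDeg k p q ℓ) :
    TruncSeries.IsGraded k (-ℓ) (X := ⟨X⟩) (Y := ⟨Y⟩) p q (linear a b)
  | 0 => by simpa using ha
  | 1 => by simpa using hb
  | n + 2 => zero_mem _

/-- The counit factors through the projection to degree 0, since that projection is ηε. -/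
theorem counit_mem_homDeg {B : C} [BimonObj B] {q : ℕ → (B ⟶ B)} (hq : IsDecomposition F q)
    (h₀ : q 0 = ε[B] ≫ η[B]) : ε[B] ∈ homDeg k q (unitProj C) 0 := by
  have hε : q 0 ≫ ε[B] = ε[B] := by
    rw [h₀, Category.assoc, BimonObj.one_counit, Category.comp_id]
  intro m n hmn
  rw [unitProj]
  split_ifs with h
  · rw [Category.comp_id, ← hε, ← Category.assoc, hq.orth m 0 (by omega), zero_comp]
  · rw [comp_zero, comp_zero]

theorem tensorUnit_isDecomposition [F.Additive] : IsDecomposition F (unitProj C) :=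
  isDecomposition_single (𝟙_ C) 0

variable [HasColimitsOfShape (Discrete ℕ) C]
  [∀ X : C, PreservesColimitsOfShape (Discrete ℕ) (tensorLeft X)]
  [∀ X : C, PreservesColimitsOfShape (Discrete ℕ) (tensorRight X)]
  {V : C} {B : C} [BimonObj B]

theorem tensorProj_unitProj : tensorProj (unitProj C) (unitProj C) =
    fun n => if n = 0 then 𝟙 (𝟙_ C ⊗ 𝟙_ C) else 0 :=
  tensorProj_single (𝟙_ C) (𝟙_ C) 0 0

theorem unitor_mem_homDeg :
    (λ_ (𝟙_ C)).hom ∈ homDeg k (tensorProj (unitProj C) (unitProj C)) (unitProj C) 0 := by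
  intro m n hmn
  rw [tensorProj_unitProj, unitProj]
  dsimp only
  split_ifs with h₁ h₂
  · omega
  all_goals simp

section Quotient

variable [F.Additive] [F.Faithful] [F.Monoidal] [PreservesFiniteColimits F]
  [PreservesColimitsOfShape (Discrete ℕ) F] {q : ℕ → (B ⟶ B)} {π : tensorObject V ⟶ B}
  [IsBimonHom π] [Epi π]

/-- Homogeneity of the product is inherited from T(V) along the epimorphism π ⊗ π; that of the
coproduct, along π. -/
theorem mul_mem_homDeg (hq : IsDecomposition F q) (hπ : π ∈ homDeg k (tproj V) q 0) :
    μ[B] ∈ homDeg k (tensorProj q q) q 0 := by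
  have hT : IsDecomposition F (tproj V) := isDecomposition_tproj F V
  have := epi_tensorHom F π π
  refine mem_homDeg_zero_of_comm hq fun n => ?_
  have hπμ : (π ⊗ₘ π) ≫ μ[B] = tensorMul V ≫ π := (IsMonHom.mul_hom π).symm
  rw [← cancel_epi (π ⊗ₘ π), ← Category.assoc, ← comm_of_mem_homDeg_zero (hT.tensor hT)
    (hq.tensor hq) (tensorHom_mem_homDeg hπ hπ rfl), Category.assoc, hπμ, ← Category.assoc,
    ← mul_tproj, Category.assoc, comm_of_mem_homDeg_zero hT hq hπ, ← Category.assoc, ← hπμ,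
    Category.assoc]

theorem comul_mem_homDeg (hq : IsDecomposition F q) (hπ : π ∈ homDeg k (tproj V) q 0) :
    Δ[B] ∈ homDeg k q (tensorProj q q) 0 := by
  have hT : IsDecomposition F (tproj V) := isDecomposition_tproj F V
  refine mem_homDeg_zero_of_comm (hq.tensor hq) fun n => ?_
  have hπΔ : π ≫ Δ[B] = tensorComul V ≫ (π ⊗ₘ π) := IsComonHom.hom_comul π
  rw [← cancel_epi π, ← Category.assoc, ← comm_of_mem_homDeg_zero hT hq hπ, Category.assoc, hπΔ,
    ← Category.assoc, tproj_comul, Category.assoc, comm_of_mem_homDeg_zero (hT.tensor hT)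
    (hq.tensor hq) (tensorHom_mem_homDeg hπ hπ rfl), ← Category.assoc, ← hπΔ, Category.assoc]

end Quotient

variable [MonoidalLinear k C] {R : Subobject (tensorObject V)}

/-- A cocycle of degree ℓ is a graded first-order deformation when t has degree -ℓ, and a
trivialization of it exhibits the cocycle as a coboundary. -/
theorem subsingleton_truncatedH₂ [F.Additive] [F.Faithful] [F.Monoidal]
    [PreservesFiniteColimits F] [PreservesColimitsOfShape (Discrete ℕ) F]
    (hI : IsBiideal (generatedIdeal R)) {gR : Grading (R : C)}
    (hR : R.arrow ∈ homDeg k gR.proj (tproj V) 0) {gB : Grading B}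
    {π : tensorObject V ⟶ B} [IsBimonHom π] [Epi π] (hker : kernelSubobject π = generatedIdeal R)
    (hπ : π ∈ homDeg k (tproj V) gB.proj 0) {ℓ : ℤ} (hℓ : ℓ < 0)
    (hP : homPrimitivesDeg k gR gB ℓ = ⊥) : Subsingleton (truncatedH₂ k gB ℓ) := by
  rw [Submodule.Quotient.subsingleton_iff, Submodule.submoduleOf, Submodule.comap_subtype_eq_top]
  rintro ⟨f, g⟩ ⟨⟨hf, hg⟩, hfg⟩
  have hfg' : (dh₂₁ k B f, dc₂₁ k B f + dh₁₂ k B g, -dc₁₂ k B g) = 0 := hfg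
  rw [Prod.mk_eq_zero, Prod.mk_eq_zero, neg_eq_zero] at hfg'
  obtain ⟨hf', hfg', hg'⟩ := hfg'
  have hB : IsDecomposition F gB.proj := gB.isDecomposition
  have h₀ := proj_zero_of_quotient hB hπ
  have hη : η[B] ∈ homDeg k (unitProj C) gB.proj 0 := one_mem_homDeg hB h₀
  have hε : ε[B] ∈ homDeg k gB.proj (unitProj C) 0 := counit_mem_homDeg hB h₀
  have hBB := hB.tensor hB
  have hU : IsDecomposition F (unitProj C) := tensorUnit_isDecomposition
  -- f(1, 1) and g(1) have degree ℓ < 0, so they vanish; hence the first-order deformation keeps the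
  -- unit of B.
  have hηf : (η[B] ⊗ₘ η[B]) ≫ f = 0 := by
    have h := comp_mem_homDeg hBB (tensorHom_mem_homDeg hη hη rfl) hf (by omega : ℓ = _)
    rw [tensorProj_unitProj] at h
    exact eq_zero_of_mem_homDeg_neg hB hℓ h
  have hηg : η[B] ≫ g = 0 :=
    eq_zero_of_mem_homDeg_neg hBB hℓ (comp_mem_homDeg hB hη hg (zero_add ℓ).symm)
  let _ := firstOrderBimonObj k hf' hfg' hg' hηf hηg
  obtain ⟨ψ, hψ₀, hψg, hψμ, -, hψΔ, -⟩ := exists_trivialization (N := 1) (L := -ℓ)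
    (F := F) hI hR hker hπ (by omega) (fun i hi hi' => by
      obtain rfl : i = 1 := le_antisymm (by exact_mod_cast hi') hi
      simpa using hP) rfl rfl rfl rfl
    (isGraded_linear (mul_mem_homDeg hB hπ) hf) (isGraded_linear (comul_mem_homDeg hB hπ) hg)
    (isGraded_linear hε (neg_mem (comp_mem_homDeg hBB hg
      (comp_mem_homDeg (hU.tensor hU) (tensorHom_mem_homDeg hε hε rfl) unitor_mem_homDeg rfl)
      (by omega))))
  -- The coefficient of t in the multiplicativity of ψ = id + ψ₁ t.
  have hμ : μ[B] ≫ coeff ψ 1 = f + (B ◁ coeff ψ 1 + coeff ψ 1 ▷ B) ≫ μ[B] := by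
    have h := congrArg (fun φ => coeff φ 1) hψμ
    simp only [coeff_const_comp, coeff_comp_one, coeff_tensorHom_one, coeff_tensorHom_zero,
      hψ₀] at h
    refine h.trans ?_
    rw [id_tensorHom_id, id_tensorHom, tensorHom_id]
    exact congrArg (· + _) (Category.id_comp f)
  have hΔ : g + coeff ψ 1 ≫ Δ[B] = Δ[B] ≫ (B ◁ coeff ψ 1 + coeff ψ 1 ▷ B) := by
    have h := congrArg (fun φ => coeff φ 1) hψΔ
    simp only [coeff_const_comp, coeff_comp_one, coeff_tensorHom_one, hψ₀] at h
    refine Eq.trans ?_ (h.trans ?_)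
    · exact congrArg (· + _) (Category.id_comp g).symm
    · rw [id_tensorHom, tensorHom_id]
  -- The sign arises because ψ maps the constant bialgebra to the deformed one.
  refine ⟨-coeff ψ 1, neg_mem (by simpa using hψg 1), ?_⟩
  rw [map_neg]
  refine Prod.ext ?_ ?_
  · change -(B ◁ coeff ψ 1 ≫ μ[B] - μ[B] ≫ coeff ψ 1 + coeff ψ 1 ▷ B ≫ μ[B]) = f
    rw [hμ, Preadditive.add_comp]
    abel
  · change - -(Δ[B] ≫ B ◁ coeff ψ 1 - coeff ψ 1 ≫ Δ[B] + Δ[B] ≫ coeff ψ 1 ▷ B) = g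
    rw [Preadditive.comp_add] at hΔ
    rw [neg_neg, sub_add_eq_add_sub, ← hΔ]
    abel

end Vanishing

end

end BraidedRigidity

open BraidedRigidity in
theorem mainTheorem4 {k : Type u} [Field k] {C : Type u₁} [Category.{v₁} C]
    -- `C` is a braided tensor category over `k` ...
    [Abelian C] [Linear k C] [MonoidalCategory C] [MonoidalPreadditive C] [MonoidalLinear k C]
    [BraidedCategory C] [HasColimitsOfShape (Discrete ℕ) C]
    -- ... that consists of vector spaces and linear maps
    (F : C ⥤ ModuleCat.{u} k) [F.Monoidal] [F.Faithful] [F.Additive] [F.Linear k]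
    [PreservesFiniteLimits F] [PreservesFiniteColimits F]
    [PreservesColimitsOfShape (Discrete ℕ) F]
    -- `R` is a graded subobject of `T(V)`, concentrated in degrees at least two, that generates
    -- a biideal
    (V : C) (R : Subobject (tensorBialgebra F V)) (gR : Grading (R : C))
    (hR : R.arrow ∈ homDeg k gR.proj (tensorGrading F V).proj 0)
    (hR₂ : ∀ n < 2, R.arrow ≫ (tensorGrading F V).proj n = 0)
    (hI : IsBiideal (generatedIdeal R))
    -- `B` is the graded bialgebra `T(V) / ⟨R⟩`, with quotient map `π`
    (B : C) [BimonObj B] (gB : Grading B) (π : tensorBialgebra F V ⟶ B) [IsBimonHom π] [Epi π]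
    (hker : kernelSubobject π = generatedIdeal R)
    (hπ : π ∈ homDeg k (tensorGrading F V).proj gB.proj 0)
    -- the multiplication `B⁺ ⊗_B B⁺ → (B⁺)²` splits
    (hsplit : AugMulSplits B) :
    (∀ ℓ : ℤ, ℓ < 0 → homPrimitivesDeg k gR gB ℓ = ⊥ → Subsingleton (truncatedH₂ k gB ℓ)) ∧
    ((∀ ℓ : ℤ, ℓ < 0 → homPrimitivesDeg k gR gB ℓ = ⊥) → IsRigid k gB) := by
  have := preserves_tensorLeft F
  have := preserves_tensorRight F
  have hπ' : IsBimonHom (M := tensorObject V) (N := B) π := ‹IsBimonHom π›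
  have hπ'' : Epi (X := tensorObject V) (Y := B) π := ‹Epi π›
  exact ⟨fun ℓ hℓ hP => subsingleton_truncatedH₂ (F := F) (V := V) (R := R) (π := π) hI hR hker hπ
    hℓ hP, fun hP => isRigid_of_homPrimitivesDeg_eq_bot (F := F) (V := V) (R := R) (π := π)
      hI hR hker hπ hP⟩
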